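/- **Setting.** A *singular grid diagram* $G$ of size $n$ is a rectangular grid with some squares decorated by one $O$ or one $X$, with $n$ decorations $O_1,\dots,O_n$ and $n$ decorations $X_1,\dots,X_n$, such that each row or column (RoC) is either *regular* (one $O$ and one $X$) or *singular* (two $O$'s and two $X$'s, reading $OOXX$, $OXXO$, $XXOO$ or $XOOX$). Opposite sides are identified to get an oriented torus. A singular column is split into two regular columns by separating its first and third decorations from its second and fourth ones. It is *$0$-resolved* if the line through its two topmost decorations has negative slope when they are of the same kind and positive slope when they are not, and *$1$-resolved* otherwise; for singular rows use the two rightmost decorations. Each singular RoC carries *winding arcs* $\alpha$, $\beta$, passing between the decorations according to the $0$- and the $1$-resolution, and meeting in four points off the grid lines, one between any two cyclically consecutive decorations; they bound four bigons, each with one decoration. These points lie outside the bigons of the perpendicular singular RoCs, and an arc meets each perpendicular grid line or winding arc once. A *set of peaks* $P$ consists of one point of $\alpha\cap\beta$ for each singular RoC, common to two bigons with decorations of different kinds. A *compass convention* $C$ maps each peak of a singular row to North or South, each peak of a singular column to East or West. **Complexes.** For a set $I$ of singular RoCs let $G_I$ be the regular grid in which those of $I$ are $1$-resolved and the others $0$-resolved.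 Generators of $C^-(G_I)$ are sets of $n$ dots on the torus, one on each vertical and each horizontal grid line of $G_I$ (each singular RoC giving one line: $\alpha$ if $0$-resolved, $\beta$ if $1$-resolved). For finite planar sets let $\mathcal J(A,B)$ be half the number of pairs $(a,b)\in A\times B$ with $(b_1-a_1)(b_2-a_2)>0$, and $M_B(A)=\mathcal J(A,A)-2\mathcal J(A,B)+\mathcal J(B,B)+1$. A generator $x$ of $C^-(G_I)$ has Maslov grading $M(x)=M_{\mathbb O}(x)$ and Alexander grading $A(x)=\frac12(M_{\mathbb O}(x)-M_{\mathbb X}(x))-\frac{n-\ell}2$, with $\ell$ the number of components of the link of $G_I$; each variable $U_{O_i}$ has bidegree $(-2,-1)$. As a bigraded module over $R=\mathbb Z[U_{O_1},\dots,U_{O_n}]$, $$CV^-(G)=\bigoplus_I C^-(G_I)[-\#I],$$ where $[-\#I]$ lowers $M$ by $\#I$. For generators $x,y$, let $\mathrm{Pol}(x,y,P)$ be the set of empty grid polygons from $x$ to $y$: polygons $\pi$ embedded in the torus with boundary in the grid lines and winding arcs, with four corners alternately at dots of $x$ and $y$, and possibly a corner in $P$ (a *peak* of $\pi$) on an edge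 between two of them; running positively along $\partial\pi$, horizontal edges go from $x$ to $y$ and vertical ones from $y$ to $x$; off $\partial\pi$, $x$ and $y$ coincide; near each corner the interior of $\pi$ meets no grid line or winding arc; and the interior contains no dot of $x$. Flattening the peaks and moving all dots to the arcs $\alpha$ turns $\pi$ into an empty rectangle $\phi(\pi)$ of $G_{\emptyset}$. Fix a sign assignment $\varepsilon$ on empty rectangles in the sense of Manolescu–Ozsváth–Szabó–Thurston (two distinct decompositions of a domain into two empty rectangles have opposite sign products; the product is $-1$ for a vertical annulus and $+1$ for a horizontal annulus). Put $\varepsilon(\pi)=(-1)^{\mu(\pi,C)}\varepsilon(\phi(\pi))$, where $\mu(\pi,C)$ is the number of peaks $p$ of $\pi$ lying on the edge of $\pi$ of compass type $C(p)$, let $O_i(\pi)\in\{0,1\}$ tell whether $O_i\in\pi$, and define the $R$-linear map $\partial^-_{G,P,C}$ by $$\partial^-_{G,P,C}(x)=\sum_y\ \sum_{\pi\in\mathrm{Pol}(x,y,P)}\varepsilon(\pi)\,U_{O_1}^{O_1(\pi)}\cdots U_{O_n}^{O_n(\pi)}\,y .$$ **Statement.** Let $r$ be a singular row or column of $G$,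 let $p\in P$ be its peak, and let $G_+$ and $G_-$ be the grids obtained from $G$ by $0$-resolving, respectively $1$-resolving, $r$, with the remaining winding arcs, the peaks $P'=P\setminus\{p\}$ and the convention $C'=C|_{P'}$ (these are again singular grids with such data). Let $f_p:CV^-(G_+)\to CV^-(G_-)$ be the $R$-linear map $$f_p(x)=\sum_{y}\ \sum_{\pi}\varepsilon(\pi)\,U_{O_1}^{O_1(\pi)}\cdots U_{O_n}^{O_n(\pi)}\,y ,$$ where $y$ runs over the generators of $CV^-(G_-)$ and $\pi$ over the polygons in $\mathrm{Pol}(x,y,P)$ having $p$ as a peak. Then: 1. $CV^-(G)$, $CV^-(G_+)$ and $CV^-(G_-)$, with $\partial^-_{G}=\partial^-_{G,P,C}$ and $\partial^-_{G_\pm}=\partial^-_{G_\pm,P',C'}$, are chain complexes: the differentials have square zero, lower $M$ by one and preserve the filtration induced by $A$. 2. $f_p$ preserves $M$ and the filtration induced by $A$, and it anticommutes with the differentials: $\partial^-_{G_-}\circ f_p=-f_p\circ\partial^-_{G_+}$. 3. $CV^-(G)$ is the mapping cone of $f_p$: the decomposition of the generators according to the resolution of $r$ identifies it, as a bigraded $R$-module,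 with $CV^-(G_+)\oplus CV^-(G_-)[-1]$, and $\partial^-_G$ with $(u,v)\mapsto(\partial^-_{G_+}u,\ f_p(u)+\partial^-_{G_-}v)$. 4. Consequently the graded Euler characteristics $\chi(\cdot)=\sum_{i,j}(-1)^i\operatorname{rk}_{\mathbb Z}(\cdot)_i^j\,q^j$ satisfy the Vassiliev skein relation $\chi(CV^-(G))=\chi(CV^-(G_+))-\chi(CV^-(G_-))$. -/

import Mathlib

namespace SingularGridHomology

/-- The two families of grid lines: vertical ones (and columns) and horizontal ones (and rows). -/
inductive Dir
  | col
  | row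
  deriving DecidableEq

instance : Fintype Dir := ⟨{.col, .row}, fun x => by cases x <;> simp⟩

/-- The transverse direction. -/
def Dir.other : Dir → Dir
  | .col => .row
  | .row => .col

/-- The two kinds of decorations. -/
inductive Kind
  | O
  | X
  deriving DecidableEq

instance : Fintype Kind := ⟨{.O, .X}, fun x => by cases x <;> simp⟩

/-- The four compass directions. -/
inductive Compass
  | north
  | south
  | east
  | west
  deriving DecidableEq

/-- The decorations of a grid of size `n`: `O_0, …, O_{n-1}` and `X_0, …, X_{n-1}`. -/
abbrev Deco (n : ℕ) := Kind × Fin n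

/-- `(κ, i)` is the `i`-th vertical (`κ = col`) or horizontal (`κ = row`) circle of the torus.
A singular row or column is named after the place of its winding arcs. -/
abbrev Circ (n : ℕ) := Dir × Fin n

/-! ### Singular grids

A singular grid of size `n` is drawn in the square `[0,n] × [0,n]`, each regular row or column
having width `1` and each singular one having width `2`.  *All coordinates are doubled* in order to
be integers.  A place `i` with `0 ≤ i < n` carries a straight grid line at the (doubled) coordinate
`2 * i`, unless `(κ, i) ∈ sing`; in that case `2 * i` is the middle of a singular
row or column, whose two winding arcs run along the coordinate `2 * i` and whose boundary lines are
at `2 * i - 2` and `2 * i + 2`.  Identifying opposite sides of the square gives the torus, all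
coordinates becoming integers modulo `2 * n`. -/

/-- The doubled coordinate of the `i`-th circle of a family. -/
def line {n : ℕ} (i : Fin n) : ℤ := 2 * ((i : ℕ) : ℤ)

/-- The doubled coordinate of the middle of the `u`-th unit strip, between places `u`, `u + 1`. -/
def strip {n : ℕ} (u : Fin n) : ℤ := 2 * ((u : ℕ) : ℤ) + 1

/-- How far one has to go from `a` in the positive direction of the circle `ℤ / 2n` to reach `z`. -/
def offset (n : ℕ) (a z : ℤ) : ℤ := (z - a) % (2 * (n : ℤ))

/-- `z` lies in the open arc of the circle `ℤ / 2n` going from `a` in positive direction to `b`. -/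
def Btw (n : ℕ) (a z b : ℤ) : Prop := 0 < offset n a z ∧ offset n a z < offset n a b

/-- The data of a decorated grid: the places of the winding arcs, and the doubled coordinates of
the decorations (`coord col d` is the abscissa of `d` and `coord row d` its ordinate). -/
structure Grid (n : ℕ) where
  sing : Finset (Circ n)
  coord : Dir → Deco n → ℤ

namespace Grid

variable {n : ℕ} (G : Grid n)

/-- `m` is the coordinate of the middle of a column (`κ = col`), resp. row (`κ = row`), of `G`. -/
def IsCenter (κ : Dir) (m : ℤ) : Prop :=
  (∃ i : Fin n, (κ, i) ∈ G.sing ∧ m = line i) ∨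
  (∃ j : Fin n, m = strip j ∧ (κ, j) ∉ G.sing ∧
    ∀ i : Fin n, (i : ℕ) = (j : ℕ) + 1 → (κ, i) ∉ G.sing)

/-- The number of decorations that lie in the same column as `d` and above it (`κ = col`),
resp. in the same row as `d` and to the right of it (`κ = row`). -/
def rank (κ : Dir) (d : Deco n) : ℕ :=
  (Finset.univ.filter fun e : Deco n =>
    G.coord κ e = G.coord κ d ∧ G.coord κ.other d < G.coord κ.other e).card

/-- `G` is a singular grid diagram of size `n`. -/
structure IsSingularGrid : Prop where
  /-- The winding arcs run in the middle of a column or row of width two,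
  and these columns and rows do not overlap. -/
  sing_pos : ∀ κ (i : Fin n), (κ, i) ∈ G.sing → 0 < (i : ℕ)
  sing_sep : ∀ κ (i j : Fin n), (κ, i) ∈ G.sing → (κ, j) ∈ G.sing → (j : ℕ) ≠ (i : ℕ) + 1
  /-- Decorations are in squares, at most one in each. -/
  center : ∀ κ d, G.IsCenter κ (G.coord κ d)
  square : ∀ d e : Deco n, (∀ κ, G.coord κ d = G.coord κ e) → d = e
  /-- Regular rows and columns contain one decoration of each kind, singular ones contain two. -/
  regular : ∀ κ t m, G.IsCenter κ m → Odd m →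
    (Finset.univ.filter fun k : Fin n => G.coord κ (t, k) = m).card = 1
  singular : ∀ κ t m, G.IsCenter κ m → Even m →
    (Finset.univ.filter fun k : Fin n => G.coord κ (t, k) = m).card = 2
  /-- In a singular row or column, the two neighbours of each of the two middle decorations are of
  different kinds: the pattern is `OOXX`, `OXXO`, `XXOO` or `XOOX`. -/
  pattern : ∀ κ (d e : Deco n), G.coord κ d = G.coord κ e → G.rank κ d = G.rank κ e + 2 →
    d.1 ≠ e.1

/-! ### Desingularization -/

/-- The two topmost (`κ = col`), resp. rightmost (`κ = row`), decorations of the singular column,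
resp. row, with middle `m` are of the same kind. -/
def SameTop (κ : Dir) (m : ℤ) : Prop :=
  ∃ d e : Deco n, G.coord κ d = m ∧ G.coord κ e = m ∧ G.rank κ d = 0 ∧ G.rank κ e = 1 ∧ d.1 = e.1

/-- In the `0`-resolution of its singular column, resp. row, `d` goes to the left, resp. to the
bottom.  Both resolutions separate the first and third decorations from the second and fourth ones.
In the `0`-resolution, the line through the two topmost (resp. rightmost) decorations has negative
slope if they are of the same kind and positive slope otherwise: so the topmost (resp.
rightmost) one goes to the left (resp. to the bottom) if and only if they are of the same kind. -/
def IsLow (κ : Dir) (d : Deco n) : Prop := Even (G.rank κ d) ↔ G.SameTop κ (G.coord κ d)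

open Classical in
/-- The coordinate of `d` after the `0`-resolution (`b` false) or the `1`-resolution (`b` true) of
its singular column or row; the `1`-resolution exchanges the two sides. -/
noncomputable def shifted (κ : Dir) (d : Deco n) (b : Prop) : ℤ :=
  if G.IsLow κ d ↔ ¬ b then G.coord κ d - 1 else G.coord κ d + 1

open Classical in
/-- The grid obtained by desingularizing the elements of `S`, those of `I` being `1`-resolved and
the other ones `0`-resolved. -/
noncomputable def resolve (S I : Finset (Circ n)) : Grid n where
  sing := G.sing \ S
  coord κ d :=
    if ∃ i : Fin n, (κ, i) ∈ S ∧ G.coord κ d = line i then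
      G.shifted κ d (∃ i : Fin n, (κ, i) ∈ I ∧ G.coord κ d = line i)
    else G.coord κ d

/-! ### Gradings -/

/-- The number of pairs `(a, b)` of a point `a` of `A` and a point `b` of `B` such that `a` lies in
the open south-west quadrant of `b`.  So `𝒥(A,B) = (southWest A B + southWest B A) / 2`. -/
def southWest {ι ι' : Type} [Fintype ι] [Fintype ι'] (A : ι → ℤ × ℤ) (B : ι' → ℤ × ℤ) : ℕ :=
  (Finset.univ.filter fun p : ι × ι' => (A p.1).1 < (B p.2).1 ∧ (A p.1).2 < (B p.2).2).card

/-- `M_B(A) = 𝒥(A,A) - 2 𝒥(A,B) + 𝒥(B,B) + 1`. -/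
def relMaslov {ι ι' : Type} [Fintype ι] [Fintype ι'] (A : ι → ℤ × ℤ) (B : ι' → ℤ × ℤ) : ℤ :=
  southWest A A - (southWest A B + southWest B A) + southWest B B + 1

/-- The dots of the generator of the chain module of a regular grid given by the bijection `σ` from
the vertical to the horizontal circles. -/
def dots (σ : Equiv.Perm (Fin n)) (i : Fin n) : ℤ × ℤ := (line i, line (σ i))

/-- The positions of the decorations of kind `t`. -/
def decos (t : Kind) (k : Fin n) : ℤ × ℤ := (G.coord .col (t, k), G.coord .row (t, k))

/-- The number of components of the link of a regular grid: horizontal strands join the `O` and the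
`X` of a row, vertical strands those of a column. -/
noncomputable def components : ℕ :=
  Nat.card (Quot fun k l : Fin n => ∃ m : Fin n,
    G.coord .row (.O, k) = G.coord .row (.X, m) ∧ G.coord .col (.X, m) = G.coord .col (.O, l))

/-- Maslov grading of a generator of `C⁻(G)`, for a regular grid `G`. -/
def maslovReg (σ : Equiv.Perm (Fin n)) : ℤ := relMaslov (dots σ) (G.decos .O)

/-- Alexander grading of a generator of `C⁻(G)`, for a regular grid `G`. -/
noncomputable def alexanderReg (σ : Equiv.Perm (Fin n)) : ℚ :=
  ((relMaslov (dots σ) (G.decos .O) : ℚ) - (relMaslov (dots σ) (G.decos .X) : ℚ)) / 2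
    - ((n : ℚ) - (G.components : ℚ)) / 2

/-- The generators of `CV⁻(G)`: a resolution `I` of all singular rows and columns (given as the set
of the `1`-resolved ones) and a generator of `C⁻(G_I)`. -/
abbrev Gen : Type := {I : Finset (Circ n) // I ⊆ G.sing} × Equiv.Perm (Fin n)

/-- Maslov grading of the generators of `CV⁻(G) = ⨁_I C⁻(G_I)[-#I]`. -/
noncomputable def maslov (x : G.Gen) : ℤ :=
  (G.resolve G.sing x.1.1).maslovReg x.2 - (x.1.1.card : ℤ)

/-- Alexander grading of the generators of `CV⁻(G)`. -/
noncomputable def alexander (x : G.Gen) : ℚ := (G.resolve G.sing x.1.1).alexanderReg x.2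

/-! ### Winding arcs, peaks, compass convention

In a singular column (resp. row), the arc `α` passes between the decorations as prescribed by the
`0`-resolution and `β` as prescribed by the `1`-resolution.  They meet in four points, one between
any two cyclically consecutive decorations.  Each of these points is named after the decoration `d`
just below it (resp. just to its left) and it is located in a unit strip `W κ d` of the transverse
direction; being in the same strip as a decoration of a regular row (resp. column), it can be on any
side of it.  It is outside the bigons of the winding arcs of the transverse family, so it is on the
same side of both winding arcs of each of these pairs. -/

/-- `d` and `e` lie in the same column (`κ = col`), resp. row. -/
def SameRoC (κ : Dir) (d e : Deco n) : Prop := G.coord κ d = G.coord κ e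

/-- `e` is the decoration that comes cyclically next above `d` in its column, resp. next to the
right of `d` in its row. -/
def IsNext (κ : Dir) (d e : Deco n) : Prop :=
  e ≠ d ∧ G.SameRoC κ d e ∧ ∀ f : Deco n, f ≠ d → G.SameRoC κ d f →
    offset n (G.coord κ.other d) (G.coord κ.other e) ≤
      offset n (G.coord κ.other d) (G.coord κ.other f)

/-- `W` gives the positions of the points of `α ∩ β` of a set of winding arcs for each singular row
or column: the point named after `d` is between `d` and the next decoration. -/
def IsWindingArcs (W : Dir → Deco n → Fin n) : Prop :=
  ∀ κ (i : Fin n), (κ, i) ∈ G.sing → ∀ d e : Deco n, G.coord κ d = line i → G.IsNext κ d e →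
    offset n (G.coord κ.other d) (strip (W κ d)) ≤
      offset n (G.coord κ.other d) (G.coord κ.other e)

/-- `P` is a set of peaks: a choice, for each singular row or column, of a point of `α ∩ β` that is
the common point of two bigons containing decorations of different kinds. -/
def IsPeakSet (P : Circ n → Deco n) : Prop :=
  ∀ κ (i : Fin n), (κ, i) ∈ G.sing → G.coord κ (P (κ, i)) = line i ∧
    ∀ e : Deco n, G.IsNext κ (P (κ, i)) e → (P (κ, i)).1 ≠ e.1

/-- `C` is a compass convention: North or South for rows, East or West for columns. -/
def IsCompass (C : Circ n → Compass) : Prop :=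
  ∀ i : Fin n, ((Dir.row, i) ∈ G.sing → C (.row, i) = .north ∨ C (.row, i) = .south) ∧
    ((Dir.col, i) ∈ G.sing → C (.col, i) = .east ∨ C (.col, i) = .west)

end Grid

/-! ### Rectangles and sign assignments

A rectangle connecting `σ` to another generator of a regular grid of size `n` is determined by the
places `a ≠ b` of its west and east edges.  Its south-west corner is `(a, σ a)`, its north-east one
is `(b, σ b)`, and it connects `σ` to `σ * swap a b`. -/

/-- The rectangle with south-west corner `(a, σ a)` and north-east corner `(b, σ b)` contains no dot
of `σ` in its interior. -/
def RectEmpty {n : ℕ} (σ : Equiv.Perm (Fin n)) (a b : Fin n) : Prop :=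
  ∀ c : Fin n, ¬ (Btw n (line a) (line c) (line b) ∧
    Btw n (line (σ a)) (line (σ c)) (line (σ b)))

open Classical in
/-- The multiplicity (`0` or `1`) of the rectangle at the unit cell `c` of the torus. -/
noncomputable def rectDomain {n : ℕ} (σ : Equiv.Perm (Fin n)) (a b : Fin n) (c : Fin n × Fin n) :
    ℕ :=
  if Btw n (line a) (strip c.1) (line b) ∧ Btw n (line (σ a)) (strip c.2) (line (σ b))
  then 1 else 0

/-- `ε` is a sign assignment on the empty rectangles of the grids of size `n`, in the sense of
Manolescu, Ozsváth, Szabó and Thurston: two distinct decompositions of a same domain into two empty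
rectangles have opposite signs, the product of the signs of the two rectangles of a
decomposition of a vertical annulus is `-1`, and `1` for a horizontal annulus. -/
structure IsSignAssignment {n : ℕ} (ε : Equiv.Perm (Fin n) → Fin n → Fin n → ℤˣ) : Prop where
  square : ∀ (σ : Equiv.Perm (Fin n)) (a b c d a' b' c' d' : Fin n),
    a ≠ b → c ≠ d → a' ≠ b' → c' ≠ d' →
    RectEmpty σ a b → RectEmpty (σ * Equiv.swap a b) c d →
    RectEmpty σ a' b' → RectEmpty (σ * Equiv.swap a' b') c' d' →
    σ * Equiv.swap a b * Equiv.swap c d = σ * Equiv.swap a' b' * Equiv.swap c' d' →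
    rectDomain σ a b + rectDomain (σ * Equiv.swap a b) c d =
      rectDomain σ a' b' + rectDomain (σ * Equiv.swap a' b') c' d' →
    (a, b, c, d) ≠ (a', b', c', d') →
    ε σ a b * ε (σ * Equiv.swap a b) c d = -(ε σ a' b' * ε (σ * Equiv.swap a' b') c' d')
  vertical : ∀ (σ : Equiv.Perm (Fin n)) (a b : Fin n), a ≠ b →
    RectEmpty σ a b → RectEmpty (σ * Equiv.swap a b) a b →
    ε σ a b * ε (σ * Equiv.swap a b) a b = -1
  horizontal : ∀ (σ : Equiv.Perm (Fin n)) (a b : Fin n), a ≠ b →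
    RectEmpty σ a b → RectEmpty (σ * Equiv.swap a b) b a →
    ε σ a b * ε (σ * Equiv.swap a b) b a = 1

/-! ### Grid polygons

A grid polygon with at least four corners at dots is obtained from a rectangle by adding peaks on
some of its edges.  So it is given, when it starts at the generator `x = (I, σ)`, by the places of
its west and east edges and by the set of the singular rows and columns whose peaks are peaks
of the polygon. -/

/-- The data of a grid polygon. -/
structure Polygon (n : ℕ) where
  west : Fin n
  east : Fin n
  peaks : Finset (Circ n)
  deriving DecidableEq, Fintype

namespace Polygon

variable {n : ℕ}

/-- The circles that contain the four edges of the polygon, when it starts at `σ`.  The corners at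
dots of `σ` are `(west, σ west)` (south-west) and `(east, σ east)` (north-east). -/
def side (π : Polygon n) (σ : Equiv.Perm (Fin n)) : Compass → Circ n
  | .west => (.col, π.west)
  | .east => (.col, π.east)
  | .south => (.row, σ π.west)
  | .north => (.row, σ π.east)

/-- The coordinate at which the west and east (`κ = col`), resp. south and north (`κ = row`), edges
begin. -/
def lower (π : Polygon n) (σ : Equiv.Perm (Fin n)) : Dir → ℤ
  | .col => line (σ π.west)
  | .row => line π.west

/-- The coordinate at which the west and east (`κ = col`), resp. south and north (`κ = row`), edges
end. -/
def upper (π : Polygon n) (σ : Equiv.Perm (Fin n)) : Dir → ℤ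
  | .col => line (σ π.east)
  | .row => line π.east

end Polygon

/-- The ground ring `ℤ[U_{O_1}, …, U_{O_n}]`. -/
abbrev GroundRing (n : ℕ) := MvPolynomial (Fin n) ℤ

namespace Grid

variable {n : ℕ} (G : Grid n)

/-- `π` is an empty grid polygon (with at least four corners at dots) connecting `x` to `y`.
Horizontal edges go from `x` to `y` and vertical ones from `y` to `x` when running positively along
the boundary.  An edge on a singular row or column follows the same winding arc all along or it
turns from the arc of one end to the arc of the other end at the peak.  As the interior of `π`
occupies only one of the four quadrants at a peak, the dot of `x` is then on `α` and the one of `y`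
on `β`.  In particular the peak has to lie between the two ends of the edge. -/
structure IsPolygon (W : Dir → Deco n → Fin n) (P : Circ n → Deco n)
    (x y : G.Gen) (π : Polygon n) : Prop where
  ne : π.west ≠ π.east
  empty : RectEmpty x.2 π.west π.east
  peak_sing : π.peaks ⊆ G.sing
  peak_side : ∀ r ∈ π.peaks, ∃ c : Compass, π.side x.2 c = r
  peak_alpha : ∀ r ∈ π.peaks, r ∉ x.1.1
  peak_mem : ∀ r ∈ π.peaks, Btw n (π.lower x.2 r.1) (strip (W r.1 (P r))) (π.upper x.2 r.1)
  target_res : y.1.1 = x.1.1 ∪ π.peaks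
  target_perm : y.2 = x.2 * Equiv.swap π.west π.east

open Classical in
/-- The set `Pol(x, y, P)`. -/
noncomputable def polygons (W : Dir → Deco n → Fin n) (P : Circ n → Deco n) (x y : G.Gen) :
    Finset (Polygon n) :=
  Finset.univ.filter fun π => G.IsPolygon W P x y π

/-- Going up (resp. right) along an edge of `π` whose peak is the peak of `r`, the decoration `d` of
the singular column (resp. row) `r` comes after the peak.  If both are in the same unit strip, the
peak comes just after the decoration it is named after and before the other ones. -/
def AfterPeak (W : Dir → Deco n → Fin n) (P : Circ n → Deco n) (x : G.Gen) (π : Polygon n)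
    (r : Circ n) (d : Deco n) : Prop :=
  offset n (π.lower x.2 r.1) (strip (W r.1 (P r))) <
      offset n (π.lower x.2 r.1) (G.coord r.1.other d) ∨
    (G.coord r.1.other d = strip (W r.1 (P r)) ∧ d ≠ P r)

/-- At the decoration `d` of the singular row or column `r`, the edges of `π` (or, if there are none
on `r`, the grid line of `x`) follow the arc `β`.  If the peak of `r` is on an edge of `π`, this edge
goes, positively along the boundary, from `β` to `α` if it is vertical and from `α` to
`β` if it is horizontal.  So `β` is after the peak on west and south edges and before the peak on
east and north edges, with respect to the upward and rightward directions. -/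
def OnBeta (W : Dir → Deco n → Fin n) (P : Circ n → Deco n) (x : G.Gen) (π : Polygon n)
    (r : Circ n) (d : Deco n) : Prop :=
  (r ∉ π.peaks ∧ r ∈ x.1.1) ∨
  (r ∈ π.peaks ∧ (π.side x.2 .west = r ∨ π.side x.2 .south = r) ∧ G.AfterPeak W P x π r d) ∨
  (r ∈ π.peaks ∧ (π.side x.2 .east = r ∨ π.side x.2 .north = r) ∧ ¬ G.AfterPeak W P x π r d)

open Classical in
/-- The coordinate of `d`, moved by one to the side of the winding arc of `π` it lies on if it is in
a singular column, resp. row. -/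
noncomputable def seen (W : Dir → Deco n → Fin n) (P : Circ n → Deco n) (x : G.Gen)
    (π : Polygon n) (κ : Dir) (d : Deco n) : ℤ :=
  if ∃ i : Fin n, (κ, i) ∈ G.sing ∧ G.coord κ d = line i then
    G.shifted κ d (∃ i : Fin n, G.coord κ d = line i ∧ G.OnBeta W P x π (κ, i) d)
  else G.coord κ d

/-- The polygon `π`, starting at `x`, contains the decoration `d`. -/
def Contains (W : Dir → Deco n → Fin n) (P : Circ n → Deco n) (x : G.Gen) (π : Polygon n)
    (d : Deco n) : Prop :=
  ∀ κ : Dir, Btw n (π.lower x.2 κ.other) (G.seen W P x π κ d) (π.upper x.2 κ.other)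

open Classical in
/-- The number `μ(π, C)` of peaks of `π` on the edge of compass type prescribed by `C`. -/
noncomputable def mu (C : Circ n → Compass) (x : G.Gen) (π : Polygon n) : ℕ :=
  (π.peaks.filter fun r => π.side x.2 (C r) = r).card

open Classical in
/-- The contribution `ε(π) U_{O_1}^{O_1(π)} ⋯ U_{O_n}^{O_n(π)}` of a polygon `π` starting at `x`,
with `ε(π) = (-1)^{μ(π, C)} ε(φ(π))`.  Embanking the peaks of `π` and moving dots to the arcs `α`
gives the rectangle `φ(π)`, which starts at the same bijection and has the same west and
east places. -/
noncomputable def weight (ε : Equiv.Perm (Fin n) → Fin n → Fin n → ℤˣ)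
    (W : Dir → Deco n → Fin n) (P : Circ n → Deco n) (C : Circ n → Compass)
    (x : G.Gen) (π : Polygon n) : GroundRing n :=
  MvPolynomial.C ((-1) ^ G.mu C x π * ((ε x.2 π.west π.east : ℤˣ) : ℤ)) *
    ∏ k ∈ Finset.univ.filter (fun k : Fin n => G.Contains W P x π (.O, k)), MvPolynomial.X k

/-- The differential of `CV⁻(G)`. -/
noncomputable def differential (ε : Equiv.Perm (Fin n) → Fin n → Fin n → ℤˣ)
    (W : Dir → Deco n → Fin n) (P : Circ n → Deco n) (C : Circ n → Compass) :
    (G.Gen →₀ GroundRing n) →ₗ[GroundRing n] (G.Gen →₀ GroundRing n) :=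
  Finsupp.linearCombination (GroundRing n) fun x : G.Gen =>
    ∑ y : G.Gen, ∑ π ∈ G.polygons W P x y, Finsupp.single y (G.weight ε W P C x π)

end Grid

/-! ### Bigraded modules with an endomorphism, mapping cones -/

/-- A free `ℤ[U_{O_1}, …, U_{O_n}]`-module with a basis whose elements have Maslov and Alexander
gradings, together with an endomorphism.  Each variable has Maslov degree `-2` and Alexander
degree `-1`. -/
structure BasedModule (n : ℕ) where
  Gen : Type
  maslov : Gen → ℤ
  alexander : Gen → ℚ
  d : (Gen →₀ GroundRing n) →ₗ[GroundRing n] (Gen →₀ GroundRing n)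

namespace BasedModule

variable {n : ℕ}

/-- `F` changes the Maslov grading by `k` exactly. -/
def HasDegree (A B : BasedModule n) (F : (A.Gen →₀ GroundRing n) →ₗ[GroundRing n] (B.Gen →₀ GroundRing n)) (k : ℤ) :
    Prop :=
  ∀ (x : A.Gen) (y : B.Gen), ∀ m ∈ (F (Finsupp.single x 1) y).support,
    B.maslov y - 2 * ((Finsupp.degree m : ℕ) : ℤ) = A.maslov x + k

/-- `F` preserves the filtration induced by the Alexander grading. -/
def IsFiltered (A B : BasedModule n) (F : (A.Gen →₀ GroundRing n) →ₗ[GroundRing n] (B.Gen →₀ GroundRing n)) : Prop :=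
  ∀ (x : A.Gen) (y : B.Gen), ∀ m ∈ (F (Finsupp.single x 1) y).support,
    B.alexander y - ((Finsupp.degree m : ℕ) : ℚ) ≤ A.alexander x

/-- `A` is a filtered chain complex. -/
structure IsComplex (A : BasedModule n) : Prop where
  d_comp_d : A.d ∘ₗ A.d = 0
  degree : HasDegree A A A.d (-1)
  filtered : IsFiltered A A A.d

/-- The mapping cone `A ⊕ B[-1]` of an anticommuting map `f : A → B`, with the differential
`(u, v) ↦ (d u, f u + d v)`. -/
noncomputable def cone (A B : BasedModule n)
    (f : (A.Gen →₀ GroundRing n) →ₗ[GroundRing n] (B.Gen →₀ GroundRing n)) : BasedModule n where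
  Gen := A.Gen ⊕ B.Gen
  maslov := Sum.elim A.maslov fun y => B.maslov y - 1
  alexander := Sum.elim A.alexander B.alexander
  d :=
    let E := Finsupp.sumFinsuppLEquivProdFinsupp (α := A.Gen) (β := B.Gen) (M := GroundRing n) (GroundRing n)
    E.symm.toLinearMap ∘ₗ
      LinearMap.prod (A.d ∘ₗ LinearMap.fst _ _ _)
        (f ∘ₗ LinearMap.fst _ _ _ + B.d ∘ₗ LinearMap.snd _ _ _) ∘ₗ
      E.toLinearMap

/-- A bijection between the bases that identifies gradings and endomorphisms. -/
structure IsIso (A B : BasedModule n) (e : A.Gen ≃ B.Gen) : Prop where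
  maslov : ∀ x, B.maslov (e x) = A.maslov x
  alexander : ∀ x, B.alexander (e x) = A.alexander x
  d : ∀ z, B.d (Finsupp.domLCongr (R := GroundRing n) e z) = Finsupp.domLCongr (R := GroundRing n) e (A.d z)

/-- The coefficient of `q ^ j` in the graded Euler characteristic: the sum over `i` of `(-1) ^ i`
times the rank over `ℤ` of the part of Maslov degree `i` and Alexander degree `j`.  A `ℤ`-basis
consists of the products of a monomial with an element of the basis. -/
noncomputable def eulerCoeff (A : BasedModule n) (j : ℚ) : ℤ :=
  ∑ᶠ p ∈ {p : A.Gen × (Fin n →₀ ℕ) | A.alexander p.1 - ((Finsupp.degree p.2 : ℕ) : ℚ) = j},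
    (((A.maslov p.1 - 2 * ((Finsupp.degree p.2 : ℕ) : ℤ)).negOnePow : ℤˣ) : ℤ)

end BasedModule

namespace Grid

variable {n : ℕ} (G : Grid n)

/-- `CV⁻(G)` with its gradings and its differential. -/
noncomputable def CV (ε : Equiv.Perm (Fin n) → Fin n → Fin n → ℤˣ)
    (W : Dir → Deco n → Fin n) (P : Circ n → Deco n) (C : Circ n → Compass) : BasedModule n where
  Gen := G.Gen
  maslov := G.maslov
  alexander := G.alexander
  d := G.differential ε W P C

/-- `G_+`: the singular row or column `r` is `0`-resolved. -/
noncomputable def pos (r : Circ n) : Grid n := G.resolve {r} ∅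

/-- `G_-`: the singular row or column `r` is `1`-resolved. -/
noncomputable def neg (r : Circ n) : Grid n := G.resolve {r} {r}

/-- Generators of `CV⁻(G_+)` as generators of `CV⁻(G)`. -/
def inclPos (r : Circ n) (x : (G.pos r).Gen) : G.Gen :=
  (⟨x.1.1, x.1.2.trans Finset.sdiff_subset⟩, x.2)

/-- Generators of `CV⁻(G_-)` as generators of `CV⁻(G)`. -/
def inclNeg {r : Circ n} (hr : r ∈ G.sing) (x : (G.neg r).Gen) : G.Gen :=
  (⟨insert r x.1.1, Finset.insert_subset hr (x.1.2.trans Finset.sdiff_subset)⟩, x.2)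

/-- The generators of `CV⁻(G)` are those of `CV⁻(G_+)` and those of `CV⁻(G_-)`. -/
def splitGen {r : Circ n} (hr : r ∈ G.sing) : (G.pos r).Gen ⊕ (G.neg r).Gen ≃ G.Gen where
  toFun := Sum.elim (G.inclPos r) (G.inclNeg hr)
  invFun x :=
    if h : r ∈ x.1.1 then
      Sum.inr (⟨x.1.1.erase r, by
        intro s hs
        rw [Finset.mem_erase] at hs
        exact Finset.mem_sdiff.2 ⟨x.1.2 hs.2, by simpa using hs.1⟩⟩, x.2)
    else
      Sum.inl (⟨x.1.1, by
        intro s hs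
        refine Finset.mem_sdiff.2 ⟨x.1.2 hs, ?_⟩
        rw [Finset.mem_singleton]
        rintro rfl
        exact h hs⟩, x.2)
  left_inv := by
    rintro (⟨⟨I, hI⟩, σ⟩ | ⟨⟨I, hI⟩, σ⟩)
    · have h : r ∉ I := fun h => by simpa using (Finset.mem_sdiff.1 (hI h)).2
      simp [inclPos, h]
    · have h : r ∉ I := fun h => by simpa using (Finset.mem_sdiff.1 (hI h)).2
      simp [inclNeg, h]
  right_inv := by
    rintro ⟨⟨I, hI⟩, σ⟩
    by_cases h : r ∈ I
    · simp [inclNeg, h]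
    · simp [inclPos, h]

/-- The map `f_p : CV⁻(G_+) → CV⁻(G_-)`, where `p` is the peak of `r`, that counts the grid polygons
of `G` having `p` as a peak. -/
noncomputable def peakMap (ε : Equiv.Perm (Fin n) → Fin n → Fin n → ℤˣ)
    (W : Dir → Deco n → Fin n) (P : Circ n → Deco n) (C : Circ n → Compass)
    {r : Circ n} (hr : r ∈ G.sing) :
    ((G.pos r).Gen →₀ GroundRing n) →ₗ[GroundRing n] ((G.neg r).Gen →₀ GroundRing n) :=
  Finsupp.linearCombination (GroundRing n) fun x : (G.pos r).Gen =>
    ∑ y : (G.neg r).Gen,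
      ∑ π ∈ (G.polygons W P (G.inclPos r x) (G.inclNeg hr y)).filter (fun π => r ∈ π.peaks),
        Finsupp.single y (G.weight ε W P C (G.inclPos r x) π)

/-- `G` is a singular grid enhanced with winding arcs, a set of peaks and a compass convention. -/
structure IsEnhanced (W : Dir → Deco n → Fin n) (P : Circ n → Deco n) (C : Circ n → Compass) :
    Prop where
  grid : G.IsSingularGrid
  arcs : G.IsWindingArcs W
  peaks : G.IsPeakSet P
  compass : G.IsCompass C

end Grid

end SingularGridHomology

/-!
The module of a singular grid `G` is, as a module, the direct sum of those of the resolutions `G_+`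
and `G_-` of a singular row or column `r`, and the polygons counted by its differential are of three
kinds: those between generators of `G_+`, those between generators of `G_-`, and those from `G_+` to
`G_-`, which are the ones with a peak in `r` and define `f_p`. Hence the differential of `G` is the
matrix of a mapping cone (`Grid.IsEnhanced.differential_eq_coneMap`), and its square is zero as soon
as the differentials `∂_+` and `∂_-` have square zero and `f_p` anticommutes with them. Everything
is thus reduced, by induction on the number of singular rows and columns, to the anticommutation
relation and to regular grids.

The anticommutation relation follows from a gauge transformation. The generators of `G_+` and `G_-`
correspond to each other, and `Γ` multiplies each of them by the product of those variables `U` of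
`r` whose decorations lie on a certain arc between the peak and the dot on `r`. When a polygon has
no edge on `r` that passes the peak, exchanging the arcs of `r` changes its decorations as predicted
by the two gauge factors. When it has such an edge, both terms fail by the same polygon with an
additional peak, up to the products of the variables in one or the other half of `r`. The result is
`∂_- Γ - Γ ∂_+ = c f_p`, where `c` is, up to sign, the difference of two distinct monomials
(`Grid.IsEnhanced.gauge_relation`). As `∂_+` and `∂_-` have square zero, this yields
`c (∂_- f_p + f_p ∂_+) = 0`, and `c` is not a zero divisor (`Grid.IsEnhanced.anticomm`).

In a regular grid the polygons are empty rectangles. A juxtaposition of two of them either is a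
thin annulus, or its domain can be cut in another way (`IsJuxt.exists_partner`), and the signs of
the two are then opposite, so that the terms cancel in pairs. The vertical and the horizontal annuli
through the decoration `O_i` have opposite signs and contribute the same power of `U`, hence they
cancel.

For the gradings, an empty rectangle changes the Maslov grading as it should by a count of pairs of
points in the plane (`Grid.relMaslov_swap`), and a change of the resolution of `r` at a dot changes
it by the size of the gauge factor (`Grid.IsEnhanced.relMaslov_insert`). The general polygon is
reached by induction on the number of singular rows and columns
(`Grid.IsEnhanced.kindMaslov_polygon`); the Alexander grading is obtained by comparison of the two
kinds of decorations. The skein relation holds since the generators of `G` are those of `G_+`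
together with those of `G_-`, the degrees of the latter being lowered by one.
-/

namespace SingularGridHomology

/-! ### The cyclic order on the coordinate circle -/

theorem offset_eq {n : ℕ} {a z : ℤ} (ha : 0 ≤ a) (ha' : a < 2 * n) (hz : 0 ≤ z) (hz' : z < 2 * n) :
    offset n a z = if a ≤ z then z - a else z - a + 2 * n := by
  unfold offset
  split_ifs with h
  · exact Int.emod_eq_of_lt (by omega) (by omega)
  · rw [← Int.add_emod_right]
    exact Int.emod_eq_of_lt (by omega) (by omega)

theorem btw_iff {n : ℕ} {a z b : ℤ} (ha : 0 ≤ a) (ha' : a < 2 * n) (hz : 0 ≤ z) (hz' : z < 2 * n)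
    (hb : 0 ≤ b) (hb' : b < 2 * n) :
    Btw n a z b ↔ (a < z ∧ z < b) ∨ (z < b ∧ b < a) ∨ (b < a ∧ a < z) := by
  unfold Btw
  rw [offset_eq ha ha' hz hz', offset_eq ha ha' hb hb']
  split_ifs <;> omega

theorem line_nonneg {n : ℕ} (i : Fin n) : 0 ≤ line i := by unfold line; omega

theorem line_lt {n : ℕ} (i : Fin n) : line i < 2 * n := by unfold line; omega

theorem strip_nonneg {n : ℕ} (i : Fin n) : 0 ≤ strip i := by unfold strip; omega

theorem strip_lt {n : ℕ} (i : Fin n) : strip i < 2 * n := by unfold strip; omega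

theorem line_injective {n : ℕ} : Function.Injective (line (n := n)) := by
  intro i j h; unfold line at h; ext; omega

theorem even_line {n : ℕ} (i : Fin n) : Even (line i) := even_two_mul _

theorem odd_strip {n : ℕ} (i : Fin n) : Odd (strip i) := ⟨_, rfl⟩

theorem line_ne_strip {n : ℕ} (i j : Fin n) : line i ≠ strip j := by
  unfold line strip; omega

theorem exists_line_iff {n : ℕ} {c : ℤ} {i : Fin n} (h : c = line i) {p : Fin n → Prop} :
    (∃ j, p j ∧ c = line j) ↔ p i := by
  constructor
  · rintro ⟨j, hj, h'⟩
    rwa [← line_injective (h'.symm.trans h)]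
  · exact fun hp => ⟨i, hp, h⟩

theorem exists_line_iff' {n : ℕ} {c : ℤ} {i : Fin n} (h : c = line i) {p : Fin n → Prop} :
    (∃ j, c = line j ∧ p j) ↔ p i := by
  simp only [and_comm (a := c = _)]
  exact exists_line_iff h

@[simp] theorem Dir.other_other (κ : Dir) : κ.other.other = κ := by cases κ <;> rfl

theorem Dir.other_ne (κ : Dir) : κ.other ≠ κ := by cases κ <;> simp [Dir.other]

theorem Dir.eq_or_eq_other (κ κ' : Dir) : κ' = κ ∨ κ' = κ.other := by
  cases κ <;> cases κ' <;> simp [Dir.other]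

theorem Dir.forall_iff {p : Dir → Prop} (κ : Dir) : (∀ κ', p κ') ↔ p κ ∧ p κ.other :=
  ⟨fun h => ⟨h _, h _⟩, fun h κ' => by
    rcases Dir.eq_or_eq_other κ κ' with rfl | rfl
    exacts [h.1, h.2]⟩

namespace Grid

variable {n : ℕ} {G : Grid n}

/-! ### Positions of the decorations of a singular grid -/

theorem IsSingularGrid.coord_bounds (hG : G.IsSingularGrid) (κ : Dir) (d : Deco n) :
    0 < G.coord κ d ∧ G.coord κ d < 2 * n := by
  rcases hG.center κ d with ⟨i, hi, h⟩ | ⟨j, h, -⟩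
  · have := hG.sing_pos κ i hi
    rw [h]; unfold line; omega
  · rw [h]; unfold strip; omega

theorem IsSingularGrid.coord_even (hG : G.IsSingularGrid) {κ : Dir} {d : Deco n}
    (h : Even (G.coord κ d)) : ∃ i, (κ, i) ∈ G.sing ∧ G.coord κ d = line i := by
  rcases hG.center κ d with hi | ⟨j, h', -⟩
  · exact hi
  · rw [h'] at h
    exact absurd h (Int.not_even_iff_odd.2 (odd_strip j))

/-- A decoration outside a singular row or column keeps at distance from it. -/
theorem IsSingularGrid.coord_far (hG : G.IsSingularGrid) {κ : Dir} {i : Fin n}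
    (hi : (κ, i) ∈ G.sing) (d : Deco n) :
    G.coord κ d = line i ∨ G.coord κ d < line i - 1 ∨ line i + 1 < G.coord κ d := by
  rcases hG.center κ d with ⟨j, hj, h⟩ | ⟨j, h, hj, hj'⟩
  · rw [h]
    have h1 := hG.sing_sep κ i j hi hj
    have h2 := hG.sing_sep κ j i hj hi
    unfold line; omega
  · rw [h]
    have h1 : i ≠ j := fun e => hj (e ▸ hi)
    have h2 : (i : ℕ) ≠ (j : ℕ) + 1 := fun e => hj' i e hi
    have h3 : (i : ℕ) ≠ j := fun e => h1 (Fin.ext e)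
    unfold line strip; omega

theorem IsSingularGrid.eq_of_coord (hG : G.IsSingularGrid) (κ : Dir) {d e : Deco n}
    (h : G.coord κ d = G.coord κ e) (h' : G.coord κ.other d = G.coord κ.other e) : d = e :=
  hG.square d e ((Dir.forall_iff κ).2 ⟨h, h'⟩)

/-! ### Ranks in a singular row or column -/

theorem IsSingularGrid.rank_lt_rank {κ : Dir} {d e : Deco n}
    (h : G.coord κ d = G.coord κ e) (h' : G.coord κ.other d < G.coord κ.other e) :
    G.rank κ e < G.rank κ d := by
  unfold rank
  refine Finset.card_lt_card (Finset.ssubset_iff_of_subset ?_ |>.2 ⟨e, ?_, ?_⟩)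
  · intro f hf
    simp only [Finset.mem_filter, Finset.mem_univ, true_and] at hf ⊢
    exact ⟨hf.1.trans h.symm, h'.trans hf.2⟩
  · simpa using ⟨h.symm, h'⟩
  · simp

theorem IsSingularGrid.rank_lt_rank_iff (hG : G.IsSingularGrid) {κ : Dir} {d e : Deco n}
    (h : G.coord κ d = G.coord κ e) :
    G.rank κ e < G.rank κ d ↔ G.coord κ.other d < G.coord κ.other e := by
  constructor
  · intro hr
    rcases lt_trichotomy (G.coord κ.other d) (G.coord κ.other e) with h' | h' | h'
    · exact h'
    · rw [hG.eq_of_coord κ h h'] at hr; omega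
    · have := IsSingularGrid.rank_lt_rank h.symm h'; omega
  · exact IsSingularGrid.rank_lt_rank h

theorem IsSingularGrid.rank_injOn (hG : G.IsSingularGrid) {κ : Dir} {d e : Deco n}
    (h : G.coord κ d = G.coord κ e) (hr : G.rank κ d = G.rank κ e) : d = e := by
  rcases lt_trichotomy (G.coord κ.other d) (G.coord κ.other e) with h' | h' | h'
  · have := IsSingularGrid.rank_lt_rank h h'; omega
  · exact hG.eq_of_coord κ h h'
  · have := IsSingularGrid.rank_lt_rank h.symm h'; omega

theorem card_roc (G : Grid n) (κ : Dir) (m : ℤ) :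
    (Finset.univ.filter fun d : Deco n => G.coord κ d = m).card =
      (Finset.univ.filter fun k : Fin n => G.coord κ (.O, k) = m).card +
      (Finset.univ.filter fun k : Fin n => G.coord κ (.X, k) = m).card := by
  simp only [Finset.card_filter, Fintype.sum_prod_type]
  rw [show (Finset.univ : Finset Kind) = {.O, .X} from rfl, Finset.sum_pair (by simp)]

theorem IsSingularGrid.rank_lt_four (hG : G.IsSingularGrid) {κ : Dir} {i : Fin n}
    (hi : (κ, i) ∈ G.sing) {d : Deco n} (hd : G.coord κ d = line i) : G.rank κ d < 4 := by
  have hc : G.IsCenter κ (line i) := Or.inl ⟨i, hi, rfl⟩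
  have h := card_roc G κ (line i)
  rw [hG.singular κ .O _ hc (even_line i), hG.singular κ .X _ hc (even_line i)] at h
  rw [show (4 : ℕ) = 2 + 2 from rfl, ← h]
  refine Finset.card_lt_card (Finset.ssubset_iff_of_subset ?_ |>.2 ⟨d, ?_, ?_⟩)
  · intro f hf
    simp only [Finset.mem_filter, Finset.mem_univ, true_and] at hf ⊢
    exact hf.1.trans hd
  · simpa using hd
  · simp

/-- Both resolutions of a singular row or column separate its two decorations of a given kind. -/
theorem IsSingularGrid.isLow_iff_not (hG : G.IsSingularGrid) {κ : Dir} {i : Fin n}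
    (hi : (κ, i) ∈ G.sing) {t : Kind} {k l : Fin n} (hk : G.coord κ (t, k) = line i)
    (hl : G.coord κ (t, l) = line i) (hkl : k ≠ l) :
    G.IsLow κ (t, k) ↔ ¬ G.IsLow κ (t, l) := by
  have hkl' : G.coord κ (t, k) = G.coord κ (t, l) := hk.trans hl.symm
  have h1 := hG.rank_lt_four hi hk
  have h2 := hG.rank_lt_four hi hl
  have h3 : G.rank κ (t, k) ≠ G.rank κ (t, l) := fun h => by
    have := hG.rank_injOn hkl' h
    simp at this; exact hkl this
  have h4 : G.rank κ (t, k) ≠ G.rank κ (t, l) + 2 := fun h => hG.pattern κ _ _ hkl' h rfl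
  have h5 : G.rank κ (t, l) ≠ G.rank κ (t, k) + 2 := fun h => hG.pattern κ _ _ hkl'.symm h rfl
  have : Even (G.rank κ (t, k)) ↔ ¬ Even (G.rank κ (t, l)) := by
    rw [Nat.even_iff, Nat.even_iff]; omega
  unfold IsLow
  rw [hk, hl]
  tauto

/-- The two decorations of a given kind in a singular row or column, the one that goes to the high
side in the `0`-resolution coming first. -/
theorem IsSingularGrid.exists_pair (hG : G.IsSingularGrid) {κ : Dir} {i : Fin n}
    (hi : (κ, i) ∈ G.sing) (t : Kind) :
    ∃ k l : Fin n, k ≠ l ∧ G.coord κ (t, k) = line i ∧ G.coord κ (t, l) = line i ∧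
      ¬ G.IsLow κ (t, k) ∧ G.IsLow κ (t, l) ∧ ∀ j, G.coord κ (t, j) = line i → j = k ∨ j = l := by
  have h := hG.singular κ t _ (Or.inl ⟨i, hi, rfl⟩) (even_line i)
  obtain ⟨k, l, hkl, hs⟩ := Finset.card_eq_two.1 h
  have hm : ∀ j, G.coord κ (t, j) = line i ↔ j = k ∨ j = l := fun j => by
    have := Finset.ext_iff.1 hs j
    simpa using this
  have hk := (hm k).2 (Or.inl rfl)
  have hl := (hm l).2 (Or.inr rfl)
  have hx := hG.isLow_iff_not hi hk hl hkl
  by_cases hL : G.IsLow κ (t, k)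
  · exact ⟨l, k, hkl.symm, hl, hk, hx.1 hL, hL, fun j hj => ((hm j).1 hj).symm⟩
  · exact ⟨k, l, hkl, hk, hl, hL, by tauto, fun j hj => (hm j).1 hj⟩

end Grid

namespace Grid

variable {n : ℕ} {G : Grid n}

/-! ### Resolving one singular row or column -/

theorem shifted_of_low {κ : Dir} {d : Deco n} {b : Prop} (h : G.IsLow κ d ↔ ¬ b) :
    G.shifted κ d b = G.coord κ d - 1 := by
  unfold shifted; rw [if_pos h]

theorem shifted_of_high {κ : Dir} {d : Deco n} {b : Prop} (h : ¬ (G.IsLow κ d ↔ ¬ b)) :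
    G.shifted κ d b = G.coord κ d + 1 := by
  unfold shifted; rw [if_neg h]

theorem shifted_eq_or (κ : Dir) (d : Deco n) (b : Prop) :
    G.shifted κ d b = G.coord κ d - 1 ∨ G.shifted κ d b = G.coord κ d + 1 := by
  unfold shifted; split_ifs <;> simp

theorem shifted_congr {κ : Dir} {d : Deco n} {b b' : Prop} (h : b ↔ b') :
    G.shifted κ d b = G.shifted κ d b' := by rw [propext h]

theorem resolve_coord_of_mem {S I : Finset (Circ n)} {κ : Dir} {d : Deco n} {i : Fin n}
    (hd : G.coord κ d = line i) (hi : (κ, i) ∈ S) :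
    (G.resolve S I).coord κ d = G.shifted κ d ((κ, i) ∈ I) := by
  unfold resolve
  simp only [exists_line_iff hd (p := fun i => (κ, i) ∈ S),
    exists_line_iff hd (p := fun i => (κ, i) ∈ I), if_pos hi]

theorem resolve_coord_of_odd {S I : Finset (Circ n)} {κ : Dir} {d : Deco n}
    (hd : ¬ ∃ i, (κ, i) ∈ S ∧ G.coord κ d = line i) :
    (G.resolve S I).coord κ d = G.coord κ d := by
  unfold resolve
  simp only [if_neg hd]

/-- Away from the resolved row or column nothing moves. -/
theorem resolve_coord_far {κ κ' : Dir} {i : Fin n} {J : Finset (Circ n)} {d : Deco n}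
    (h : κ' = κ → G.coord κ' d ≠ line i) :
    (G.resolve {(κ, i)} J).coord κ' d = G.coord κ' d := by
  refine resolve_coord_of_odd ?_
  rintro ⟨j, hj, hd⟩
  simp only [Finset.mem_singleton, Prod.mk.injEq] at hj
  obtain ⟨rfl, rfl⟩ := hj
  exact h rfl hd

theorem resolve_coord_self {κ : Dir} {i : Fin n} {J : Finset (Circ n)} {d : Deco n}
    (h : G.coord κ d = line i) :
    (G.resolve {(κ, i)} J).coord κ d = G.shifted κ d ((κ, i) ∈ J) :=
  resolve_coord_of_mem h (Finset.mem_singleton_self _)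

theorem resolve_coord_other {κ : Dir} {i : Fin n} {J : Finset (Circ n)} {d : Deco n} :
    (G.resolve {(κ, i)} J).coord κ.other d = G.coord κ.other d :=
  resolve_coord_far fun h => absurd h (Dir.other_ne κ)

/-- The possible displacements when one singular row or column is resolved. -/
theorem IsSingularGrid.resolve_coord_cases (hG : G.IsSingularGrid) {κ : Dir} {i : Fin n}
    (hi : (κ, i) ∈ G.sing) (J : Finset (Circ n)) (d : Deco n) :
    (G.coord κ d = line i ∧ ((G.resolve {(κ, i)} J).coord κ d = line i - 1 ∨
        (G.resolve {(κ, i)} J).coord κ d = line i + 1)) ∨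
      ((G.resolve {(κ, i)} J).coord κ d = G.coord κ d ∧
        (G.coord κ d < line i - 1 ∨ line i + 1 < G.coord κ d)) := by
  rcases eq_or_ne (G.coord κ d) (line i) with h | h
  · left
    refine ⟨h, ?_⟩
    rw [resolve_coord_self h, ← h]
    exact shifted_eq_or _ _ _
  · right
    exact ⟨resolve_coord_far fun _ => h, (hG.coord_far hi d).resolve_left h⟩

theorem IsSingularGrid.resolve_coord_bounds (hG : G.IsSingularGrid) {κ : Dir} {i : Fin n}
    (hi : (κ, i) ∈ G.sing) (J : Finset (Circ n)) (κ' : Dir) (d : Deco n) :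
    0 < (G.resolve {(κ, i)} J).coord κ' d ∧ (G.resolve {(κ, i)} J).coord κ' d < 2 * n := by
  rcases Dir.eq_or_eq_other κ κ' with rfl | rfl
  · have h1 := hG.resolve_coord_cases hi J d
    have h2 := hG.coord_bounds κ' d
    have h3 := hG.sing_pos _ _ hi
    have h4 := line_lt i
    unfold line at *
    omega
  · rw [resolve_coord_other]; exact hG.coord_bounds _ d

theorem IsSingularGrid.resolve_coord_eq (hG : G.IsSingularGrid) {κ : Dir} {i : Fin n}
    (hi : (κ, i) ∈ G.sing) {J : Finset (Circ n)} {κ' : Dir} {d e : Deco n}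
    (h : (G.resolve {(κ, i)} J).coord κ' d = (G.resolve {(κ, i)} J).coord κ' e) :
    G.coord κ' d = G.coord κ' e := by
  rcases Dir.eq_or_eq_other κ κ' with rfl | rfl
  · have h1 := hG.resolve_coord_cases hi J d
    have h2 := hG.resolve_coord_cases hi J e
    omega
  · rwa [resolve_coord_other, resolve_coord_other] at h

/-- Inside a row or column crossing the resolved one, the order of the decorations is unchanged. -/
theorem IsSingularGrid.resolve_lt_iff (hG : G.IsSingularGrid) {κ : Dir} {i : Fin n}
    (hi : (κ, i) ∈ G.sing) {J : Finset (Circ n)} {d e : Deco n}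
    (h : G.coord κ.other d = G.coord κ.other e) :
    (G.resolve {(κ, i)} J).coord κ d < (G.resolve {(κ, i)} J).coord κ e ↔
      G.coord κ d < G.coord κ e := by
  by_cases hde : d = e
  · subst hde; simp
  have h0 : G.coord κ d ≠ G.coord κ e := fun h' => hde (hG.eq_of_coord κ h' h)
  have h1 := hG.resolve_coord_cases hi J d
  have h2 := hG.resolve_coord_cases hi J e
  omega

/-- Circles other than the resolved one carry the same decorations. -/
theorem IsSingularGrid.resolve_eq_line_iff (hG : G.IsSingularGrid) {κ κ' : Dir} {i j : Fin n}
    (hi : (κ, i) ∈ G.sing) (J : Finset (Circ n)) (hj : (κ', j) ≠ (κ, i)) (d : Deco n) :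
    (G.resolve {(κ, i)} J).coord κ' d = line j ↔ G.coord κ' d = line j := by
  rcases Dir.eq_or_eq_other κ κ' with rfl | rfl
  · have h1 := hG.resolve_coord_cases hi J d
    have hj' : (j : ℕ) ≠ i := fun h => hj (by rw [Fin.ext h])
    unfold line at *
    omega
  · rw [resolve_coord_other]

theorem IsSingularGrid.rank_resolve (hG : G.IsSingularGrid) {κ κ' : Dir} {i : Fin n}
    (hi : (κ, i) ∈ G.sing) (J : Finset (Circ n)) {d : Deco n}
    (hd : κ' = κ → G.coord κ' d ≠ line i) :
    (G.resolve {(κ, i)} J).rank κ' d = G.rank κ' d := by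
  unfold rank
  congr 1
  refine Finset.filter_congr fun e _ => ?_
  rcases Dir.eq_or_eq_other κ κ' with rfl | rfl
  · rw [resolve_coord_other, resolve_coord_other]
    have h1 := hG.resolve_coord_cases hi J d
    have h2 := hG.resolve_coord_cases hi J e
    have h3 := hd rfl
    refine and_congr_left fun _ => ?_
    omega
  · rw [resolve_coord_other, resolve_coord_other, Dir.other_other]
    refine and_congr_right fun h => ?_
    rw [hG.resolve_lt_iff hi h.symm]

theorem IsSingularGrid.sameTop_resolve (hG : G.IsSingularGrid) {κ κ' : Dir} {i j : Fin n}
    (hi : (κ, i) ∈ G.sing) (J : Finset (Circ n)) (hj : (κ', j) ≠ (κ, i)) :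
    (G.resolve {(κ, i)} J).SameTop κ' (line j) ↔ G.SameTop κ' (line j) := by
  unfold SameTop
  refine exists_congr fun d => exists_congr fun e => ?_
  rw [hG.resolve_eq_line_iff hi J hj, hG.resolve_eq_line_iff hi J hj]
  refine and_congr_right fun hd => and_congr_right fun he => ?_
  have hne : κ' = κ → line j ≠ line i := fun h h' => hj (by rw [h, line_injective h'])
  rw [hG.rank_resolve hi J (fun h => hd ▸ hne h), hG.rank_resolve hi J (fun h => he ▸ hne h)]

theorem IsSingularGrid.isLow_resolve (hG : G.IsSingularGrid) {κ κ' : Dir} {i j : Fin n}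
    (hi : (κ, i) ∈ G.sing) (J : Finset (Circ n)) (hj : (κ', j) ≠ (κ, i)) {d : Deco n}
    (hd : G.coord κ' d = line j) :
    (G.resolve {(κ, i)} J).IsLow κ' d ↔ G.IsLow κ' d := by
  have hne : κ' = κ → line j ≠ line i := fun h h' => hj (by rw [h, line_injective h'])
  unfold IsLow
  rw [hG.rank_resolve hi J (fun h => hd ▸ hne h), (hG.resolve_eq_line_iff hi J hj d).2 hd, hd,
    hG.sameTop_resolve hi J hj]

theorem IsSingularGrid.shifted_resolve (hG : G.IsSingularGrid) {κ κ' : Dir} {i j : Fin n}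
    (hi : (κ, i) ∈ G.sing) (J : Finset (Circ n)) (hj : (κ', j) ≠ (κ, i)) {d : Deco n}
    (hd : G.coord κ' d = line j) (b : Prop) :
    (G.resolve {(κ, i)} J).shifted κ' d b = G.shifted κ' d b := by
  have hl := hG.isLow_resolve hi J hj hd
  have hc := (hG.resolve_eq_line_iff hi J hj d).2 hd
  by_cases h : G.IsLow κ' d ↔ ¬ b
  · rw [shifted_of_low h, shifted_of_low (by rw [hl]; exact h), hc, hd]
  · rw [shifted_of_high h, shifted_of_high (by rw [hl]; exact h), hc, hd]

/-- Resolving one singular row or column and then all the other ones. -/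
theorem IsSingularGrid.resolve_resolve (hG : G.IsSingularGrid) {r : Circ n} (hr : r ∈ G.sing)
    {J I I' : Finset (Circ n)} (hI : ∀ s ≠ r, s ∈ I' ↔ s ∈ I) (hJ : r ∈ I' ↔ r ∈ J) :
    (G.resolve {r} J).resolve (G.sing \ {r}) I = G.resolve G.sing I' := by
  obtain ⟨κ, i⟩ := r
  have hs : ((G.resolve {(κ, i)} J).resolve (G.sing \ {(κ, i)}) I).sing =
      (G.resolve G.sing I').sing := by
    simp [resolve]
  have hc : ((G.resolve {(κ, i)} J).resolve (G.sing \ {(κ, i)}) I).coord =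
      (G.resolve G.sing I').coord := by
    funext κ' d
    by_cases hd : ∃ j, (κ', j) ∈ G.sing ∧ G.coord κ' d = line j
    · obtain ⟨j, hj, hd⟩ := hd
      rw [resolve_coord_of_mem hd hj]
      by_cases hji : (κ', j) = (κ, i)
      · simp only [Prod.mk.injEq] at hji
        obtain ⟨rfl, rfl⟩ := hji
        rw [resolve_coord_of_odd, resolve_coord_self hd]
        · exact shifted_congr hJ.symm
        · rintro ⟨l, hl, hl'⟩
          have hl2 : (κ', l) ≠ (κ', j) := by
            simpa using (Finset.mem_sdiff.1 hl).2
          rw [hG.resolve_eq_line_iff hr J hl2, hd] at hl'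
          exact hl2 (by rw [line_injective hl'])
      · rw [resolve_coord_of_mem ((hG.resolve_eq_line_iff hr J hji d).2 hd)
          (Finset.mem_sdiff.2 ⟨hj, by simpa using hji⟩), hG.shifted_resolve hr J hji hd]
        exact shifted_congr (hI _ hji).symm
    · rw [resolve_coord_of_odd hd]
      have hf : κ' = κ → G.coord κ' d ≠ line i := fun h h' => hd ⟨i, by rw [h]; exact hr, h'⟩
      rw [resolve_coord_of_odd, resolve_coord_far hf]
      rintro ⟨l, hl, hl'⟩
      rw [resolve_coord_far hf] at hl'
      exact hd ⟨l, (Finset.mem_sdiff.1 hl).1, hl'⟩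
  cases h1 : (G.resolve {(κ, i)} J).resolve (G.sing \ {(κ, i)}) I
  cases h2 : G.resolve G.sing I'
  rw [h1, h2] at hs hc
  simp only at hs hc
  rw [hs, hc]

end Grid

namespace Grid

variable {n : ℕ} {G : Grid n}

/-! ### The resolved grids are singular grids with the same enhancement -/

theorem mem_resolve_sing {r s : Circ n} {J : Finset (Circ n)} :
    s ∈ (G.resolve {r} J).sing ↔ s ∈ G.sing ∧ s ≠ r := by
  simp [resolve]

theorem IsSingularGrid.strip_right (hG : G.IsSingularGrid) {κ : Dir} {i : Fin n}
    (hi : (κ, i) ∈ G.sing) (J : Finset (Circ n)) :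
    (G.resolve {(κ, i)} J).IsCenter κ (line i + 1) := by
  refine Or.inr ⟨i, rfl, fun h => (mem_resolve_sing.1 h).2 rfl, fun j hj h => ?_⟩
  exact hG.sing_sep κ i j hi (mem_resolve_sing.1 h).1 hj

theorem IsSingularGrid.strip_left (hG : G.IsSingularGrid) {κ : Dir} {i : Fin n}
    (hi : (κ, i) ∈ G.sing) (J : Finset (Circ n)) :
    (G.resolve {(κ, i)} J).IsCenter κ (line i - 1) := by
  have h0 := hG.sing_pos κ i hi
  have h1 := i.2
  refine Or.inr ⟨⟨i - 1, by omega⟩, ?_, fun h => ?_, fun j hj h => ?_⟩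
  · unfold line strip; simp only; omega
  · exact hG.sing_sep κ _ i (mem_resolve_sing.1 h).1 hi (by simp only; omega)
  · refine (mem_resolve_sing.1 h).2 ?_
    rw [show j = i from Fin.ext (by simp only at hj; omega)]

theorem isCenter_resolve {r : Circ n} (J : Finset (Circ n)) {κ : Dir} {m : ℤ}
    (h : G.IsCenter κ m) (hm : ∀ i, (κ, i) = r → m ≠ line i) :
    (G.resolve {r} J).IsCenter κ m := by
  rcases h with ⟨i, hi, rfl⟩ | ⟨j, rfl, hj, hj'⟩
  · exact Or.inl ⟨i, mem_resolve_sing.2 ⟨hi, fun h => hm i h rfl⟩, rfl⟩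
  · exact Or.inr ⟨j, rfl, fun h => hj (mem_resolve_sing.1 h).1,
      fun i hi h => hj' i hi (mem_resolve_sing.1 h).1⟩

/-- The centers of the resolved grid: those of `G` and the two halves of the resolved one. -/
theorem IsSingularGrid.isCenter_of_resolve {κ κ' : Dir} {i : Fin n}
    {J : Finset (Circ n)} {m : ℤ}
    (h : (G.resolve {(κ, i)} J).IsCenter κ' m) :
    (G.IsCenter κ' m ∧ ∀ j, (κ', j) = (κ, i) → m ≠ line j) ∨
      (κ' = κ ∧ (m = line i - 1 ∨ m = line i + 1)) := by
  rcases h with ⟨j, hj, rfl⟩ | ⟨j, rfl, hj, hj'⟩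
  · left
    obtain ⟨h1, h2⟩ := mem_resolve_sing.1 hj
    exact ⟨Or.inl ⟨j, h1, rfl⟩, fun l hl h => h2 (by rw [line_injective h]; exact hl)⟩
  · by_cases h1 : (κ', j) = (κ, i)
    · simp only [Prod.mk.injEq] at h1
      obtain ⟨rfl, rfl⟩ := h1
      exact Or.inr ⟨rfl, Or.inr rfl⟩
    · by_cases h2 : κ' = κ ∧ (i : ℕ) = j + 1
      · obtain ⟨rfl, h2⟩ := h2
        exact Or.inr ⟨rfl, Or.inl (by unfold strip line; omega)⟩
      · left
        refine ⟨Or.inr ⟨j, rfl, fun h => hj (mem_resolve_sing.2 ⟨h, h1⟩), fun l hl h => ?_⟩,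
          fun l _ h => line_ne_strip l j h.symm⟩
        by_cases h3 : (κ', l) = (κ, i)
        · simp only [Prod.mk.injEq] at h3
          obtain ⟨rfl, rfl⟩ := h3
          exact h2 ⟨rfl, hl⟩
        · exact hj' l hl (mem_resolve_sing.2 ⟨h, h3⟩)

theorem IsSingularGrid.resolve_eq_iff_of_ne (hG : G.IsSingularGrid) {κ κ' : Dir} {i : Fin n}
    (hi : (κ, i) ∈ G.sing) (J : Finset (Circ n)) {m : ℤ} (hm : G.IsCenter κ' m)
    (hm' : ∀ j, (κ', j) = (κ, i) → m ≠ line j) (d : Deco n) :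
    (G.resolve {(κ, i)} J).coord κ' d = m ↔ G.coord κ' d = m := by
  rcases Dir.eq_or_eq_other κ κ' with rfl | rfl
  · have h1 := hG.resolve_coord_cases hi J d
    have h2 := hm' i rfl
    have h3 : m ≠ line i - 1 ∧ m ≠ line i + 1 := by
      rcases hm with ⟨j, hj, rfl⟩ | ⟨j, rfl, hj, hj'⟩
      · unfold line; omega
      · have h4 : j ≠ i := fun h => hj (h ▸ hi)
        have h5 : (i : ℕ) ≠ j + 1 := fun h => hj' i h hi
        have h6 : (j : ℕ) ≠ i := fun h => h4 (Fin.ext h)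
        unfold line strip; omega
    omega
  · rw [resolve_coord_other]

/-- After the resolution of a singular row or column, each of the two rows or columns that replace
it contains one decoration of each kind. -/
theorem IsSingularGrid.card_half (hG : G.IsSingularGrid) {κ : Dir} {i : Fin n}
    (hi : (κ, i) ∈ G.sing) (J : Finset (Circ n)) (t : Kind) {m : ℤ}
    (hm : m = line i - 1 ∨ m = line i + 1) :
    (Finset.univ.filter fun k : Fin n => (G.resolve {(κ, i)} J).coord κ (t, k) = m).card = 1 := by
  obtain ⟨k, l, hkl, hk, hl, hk', hl', hall⟩ := hG.exists_pair hi t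
  have hck : (G.resolve {(κ, i)} J).coord κ (t, k) =
      if (κ, i) ∈ J then line i - 1 else line i + 1 := by
    rw [resolve_coord_self hk]
    split_ifs with h
    · rw [shifted_of_low (by tauto), hk]
    · rw [shifted_of_high (by tauto), hk]
  have hcl : (G.resolve {(κ, i)} J).coord κ (t, l) =
      if (κ, i) ∈ J then line i + 1 else line i - 1 := by
    rw [resolve_coord_self hl]
    split_ifs with h
    · rw [shifted_of_high (by tauto), hl]
    · rw [shifted_of_low (by tauto), hl]
  have hmem : ∀ j, (G.resolve {(κ, i)} J).coord κ (t, j) = m → j = k ∨ j = l := by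
    intro j hj
    apply hall
    have := hG.resolve_coord_cases hi J (t, j)
    omega
  rw [Finset.card_eq_one]
  by_cases hc : (G.resolve {(κ, i)} J).coord κ (t, k) = m
  · refine ⟨k, ?_⟩
    ext j
    simp only [Finset.mem_filter, Finset.mem_univ, true_and, Finset.mem_singleton]
    refine ⟨fun hj => (hmem j hj).resolve_right ?_, fun h => h ▸ hc⟩
    rintro rfl
    rw [hck] at hc; rw [hcl] at hj
    split_ifs at hc hj <;> omega
  · refine ⟨l, ?_⟩
    ext j
    simp only [Finset.mem_filter, Finset.mem_univ, true_and, Finset.mem_singleton]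
    refine ⟨fun hj => (hmem j hj).resolve_left ?_, ?_⟩
    · rintro rfl
      exact hc hj
    · rintro rfl
      rw [hck] at hc; rw [hcl]
      split_ifs at hc ⊢ <;> omega

theorem IsSingularGrid.resolve_rank_lt_two (hG : G.IsSingularGrid) {κ : Dir} {i : Fin n}
    (hi : (κ, i) ∈ G.sing) (J : Finset (Circ n)) {d : Deco n} (hd : G.coord κ d = line i) :
    (G.resolve {(κ, i)} J).rank κ d < 2 := by
  have hm : (G.resolve {(κ, i)} J).coord κ d = line i - 1 ∨
      (G.resolve {(κ, i)} J).coord κ d = line i + 1 := by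
    have := hG.resolve_coord_cases hi J d
    omega
  have h := card_roc (G.resolve {(κ, i)} J) κ ((G.resolve {(κ, i)} J).coord κ d)
  rw [hG.card_half hi J .O hm, hG.card_half hi J .X hm] at h
  rw [show (2 : ℕ) = 1 + 1 from rfl, ← h]
  refine Finset.card_lt_card (Finset.ssubset_iff_of_subset ?_ |>.2 ⟨d, ?_, ?_⟩)
  · intro f hf
    simp only [Finset.mem_filter, Finset.mem_univ, true_and] at hf ⊢
    exact hf.1
  · simp
  · simp

theorem IsSingularGrid.isSingularGrid_resolve (hG : G.IsSingularGrid) {r : Circ n}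
    (hr : r ∈ G.sing) (J : Finset (Circ n)) : (G.resolve {r} J).IsSingularGrid := by
  obtain ⟨κ, i⟩ := r
  constructor
  · exact fun κ' j hj => hG.sing_pos κ' j (mem_resolve_sing.1 hj).1
  · exact fun κ' j l hj hl => hG.sing_sep κ' j l (mem_resolve_sing.1 hj).1 (mem_resolve_sing.1 hl).1
  · intro κ' d
    by_cases h : κ' = κ ∧ G.coord κ' d = line i
    · obtain ⟨rfl, h⟩ := h
      rcases hG.resolve_coord_cases hr J d with ⟨-, h1 | h1⟩ | ⟨h1, h2⟩
      · rw [h1]; exact hG.strip_left hr J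
      · rw [h1]; exact hG.strip_right hr J
      · omega
    · rw [resolve_coord_far fun hκ hd => h ⟨hκ, hd⟩]
      refine isCenter_resolve J (hG.center κ' d) fun j hj hd => h ?_
      simp only [Prod.mk.injEq] at hj
      exact ⟨hj.1, by rw [hd, hj.2]⟩
  · exact fun d e h => hG.square d e fun κ' => hG.resolve_coord_eq hr (h κ')
  · intro κ' t m hm ho
    rcases IsSingularGrid.isCenter_of_resolve hm with ⟨h1, h2⟩ | ⟨rfl, h1⟩
    · rw [← hG.regular κ' t m h1 ho]
      congr 1
      exact Finset.filter_congr fun k _ => hG.resolve_eq_iff_of_ne hr J h1 h2 _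
    · exact hG.card_half hr J t h1
  · intro κ' t m hm he
    rcases IsSingularGrid.isCenter_of_resolve hm with ⟨h1, h2⟩ | ⟨rfl, h1⟩
    · rw [← hG.singular κ' t m h1 he]
      congr 1
      exact Finset.filter_congr fun k _ => hG.resolve_eq_iff_of_ne hr J h1 h2 _
    · have := even_line i
      rw [Int.even_iff] at he this
      omega
  · intro κ' d e hde hrk
    have hde' := hG.resolve_coord_eq hr hde
    by_cases h : κ' = κ ∧ G.coord κ' d = line i
    · obtain ⟨rfl, h⟩ := h
      have := hG.resolve_rank_lt_two hr J h
      omega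
    · rw [hG.rank_resolve hr J fun h1 h2 => h ⟨h1, h2⟩,
        hG.rank_resolve hr J fun h1 h2 => h ⟨h1, hde'.trans h2⟩] at hrk
      exact hG.pattern κ' d e hde' hrk

theorem IsSingularGrid.offset_resolve_le_iff (hG : G.IsSingularGrid) {κ : Dir} {i : Fin n}
    (hi : (κ, i) ∈ G.sing) (J : Finset (Circ n)) {d e f : Deco n}
    (hde : G.coord κ.other d = G.coord κ.other e) (hdf : G.coord κ.other d = G.coord κ.other f)
    (he : e ≠ d) (hf : f ≠ d) :
    offset n ((G.resolve {(κ, i)} J).coord κ d) ((G.resolve {(κ, i)} J).coord κ e) ≤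
        offset n ((G.resolve {(κ, i)} J).coord κ d) ((G.resolve {(κ, i)} J).coord κ f) ↔
      offset n (G.coord κ d) (G.coord κ e) ≤ offset n (G.coord κ d) (G.coord κ f) := by
  by_cases hef : e = f
  · subst hef; simp
  have n1 : G.coord κ d ≠ G.coord κ e := fun h => he (hG.eq_of_coord κ h hde).symm
  have n2 : G.coord κ d ≠ G.coord κ f := fun h => hf (hG.eq_of_coord κ h hdf).symm
  have n3 : G.coord κ e ≠ G.coord κ f := fun h => hef (hG.eq_of_coord κ h (hde.symm.trans hdf))
  have b1 := hG.coord_bounds κ d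
  have b2 := hG.coord_bounds κ e
  have b3 := hG.coord_bounds κ f
  have c1 := hG.resolve_coord_bounds hi J κ d
  have c2 := hG.resolve_coord_bounds hi J κ e
  have c3 := hG.resolve_coord_bounds hi J κ f
  rw [offset_eq c1.1.le c1.2 c2.1.le c2.2, offset_eq c1.1.le c1.2 c3.1.le c3.2,
    offset_eq b1.1.le b1.2 b2.1.le b2.2, offset_eq b1.1.le b1.2 b3.1.le b3.2]
  have k1 := hG.resolve_coord_cases hi J d
  have k2 := hG.resolve_coord_cases hi J e
  have k3 := hG.resolve_coord_cases hi J f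
  rcases k1 with ⟨k1, k1' | k1'⟩ | ⟨k1, k1'⟩ <;> rcases k2 with ⟨k2, k2' | k2'⟩ | ⟨k2, k2'⟩ <;>
    rcases k3 with ⟨k3, k3' | k3'⟩ | ⟨k3, k3'⟩ <;> split_ifs <;> omega

theorem IsSingularGrid.isNext_resolve (hG : G.IsSingularGrid) {κ κ' : Dir} {i j : Fin n}
    (hi : (κ, i) ∈ G.sing) (J : Finset (Circ n)) (hj : (κ', j) ≠ (κ, i)) {d e : Deco n}
    (hd : G.coord κ' d = line j) :
    (G.resolve {(κ, i)} J).IsNext κ' d e ↔ G.IsNext κ' d e := by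
  have hs : ∀ f, (G.resolve {(κ, i)} J).SameRoC κ' d f ↔ G.SameRoC κ' d f := by
    intro f
    unfold SameRoC
    rw [(hG.resolve_eq_line_iff hi J hj d).2 hd, hd, eq_comm, hG.resolve_eq_line_iff hi J hj f,
      eq_comm]
  unfold IsNext
  refine and_congr_right fun he => ?_
  rw [hs e]
  refine and_congr_right fun hde => forall_congr' fun f => forall_congr' fun hf => ?_
  rw [hs f]
  refine forall_congr' fun hdf => ?_
  rcases Dir.eq_or_eq_other κ κ' with rfl | rfl
  · simp only [resolve_coord_other]
  · simp only [Dir.other_other]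
    exact hG.offset_resolve_le_iff hi J hde hdf he hf

theorem IsEnhanced.resolve {W : Dir → Deco n → Fin n} {P : Circ n → Deco n} {C : Circ n → Compass}
    (hG : G.IsEnhanced W P C) {r : Circ n} (hr : r ∈ G.sing) (J : Finset (Circ n)) :
    (G.resolve {r} J).IsEnhanced W P C := by
  obtain ⟨κ, i⟩ := r
  have hg := hG.grid
  refine ⟨hg.isSingularGrid_resolve hr J, ?_, ?_, ?_⟩
  · intro κ' j hj d e hd hn
    obtain ⟨hj, hji⟩ := mem_resolve_sing.1 hj
    rw [hg.resolve_eq_line_iff hr J hji] at hd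
    rw [hg.isNext_resolve hr J hji hd] at hn
    have h := hG.arcs κ' j hj d e hd hn
    rcases Dir.eq_or_eq_other κ κ' with rfl | rfl
    · simpa only [resolve_coord_other] using h
    · simp only [Dir.other_other] at h ⊢
      have hne : G.coord κ d ≠ G.coord κ e := fun h' =>
        hn.1 (hg.eq_of_coord κ h' hn.2.1).symm
      have b1 := hg.coord_bounds κ d
      have b2 := hg.coord_bounds κ e
      have c1 := hg.resolve_coord_bounds hr J κ d
      have c2 := hg.resolve_coord_bounds hr J κ e
      rw [offset_eq c1.1.le c1.2 c2.1.le c2.2,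
        offset_eq c1.1.le c1.2 (strip_nonneg _) (strip_lt _)]
      rw [offset_eq b1.1.le b1.2 b2.1.le b2.2,
        offset_eq b1.1.le b1.2 (strip_nonneg _) (strip_lt _)] at h
      have k1 := hg.resolve_coord_cases hr J d
      have k2 := hg.resolve_coord_cases hr J e
      unfold strip line at *
      rcases k1 with ⟨k1, k1' | k1'⟩ | ⟨k1, k1'⟩ <;> rcases k2 with ⟨k2, k2' | k2'⟩ | ⟨k2, k2'⟩ <;>
        split_ifs at h ⊢ <;> omega
  · intro κ' j hj
    obtain ⟨hj, hji⟩ := mem_resolve_sing.1 hj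
    obtain ⟨h1, h2⟩ := hG.peaks κ' j hj
    rw [hg.resolve_eq_line_iff hr J hji]
    refine ⟨h1, fun e he => h2 e ?_⟩
    rwa [hg.isNext_resolve hr J hji h1] at he
  · intro j
    exact ⟨fun h => (hG.compass j).1 (mem_resolve_sing.1 h).1,
      fun h => (hG.compass j).2 (mem_resolve_sing.1 h).1⟩

end Grid

namespace Grid

variable {n : ℕ} {G : Grid n} {W : Dir → Deco n → Fin n} {P : Circ n → Deco n}
  {C : Circ n → Compass}

/-! ### Polygons that avoid the peak of a resolved row or column -/

theorem seen_of_mem {x : G.Gen} {π : Polygon n} {κ : Dir} {d : Deco n} {i : Fin n}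
    (hd : G.coord κ d = line i) (hi : (κ, i) ∈ G.sing) :
    G.seen W P x π κ d = G.shifted κ d (G.OnBeta W P x π (κ, i) d) := by
  unfold seen
  rw [if_pos ⟨i, hi, hd⟩]
  exact shifted_congr (exists_line_iff' hd (p := fun i => G.OnBeta W P x π (κ, i) d))

theorem seen_of_not_mem {x : G.Gen} {π : Polygon n} {κ : Dir} {d : Deco n}
    (hd : ¬ ∃ i, (κ, i) ∈ G.sing ∧ G.coord κ d = line i) :
    G.seen W P x π κ d = G.coord κ d := by
  unfold seen
  rw [if_neg hd]

theorem IsSingularGrid.seen_cases (hG : G.IsSingularGrid) (x : G.Gen) (π : Polygon n) (κ : Dir)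
    (d : Deco n) :
    (Odd (G.coord κ d) ∧ G.seen W P x π κ d = G.coord κ d) ∨
    (Even (G.coord κ d) ∧ (G.seen W P x π κ d = G.coord κ d - 1 ∨
      G.seen W P x π κ d = G.coord κ d + 1)) := by
  by_cases hd : ∃ i, (κ, i) ∈ G.sing ∧ G.coord κ d = line i
  · obtain ⟨i, hi, hd⟩ := hd
    right
    rw [seen_of_mem hd hi]
    exact ⟨hd ▸ even_line i, shifted_eq_or _ _ _⟩
  · left
    rw [seen_of_not_mem hd]
    refine ⟨?_, rfl⟩
    rw [← Int.not_even_iff_odd]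
    exact fun h => hd (hG.coord_even h)

theorem IsSingularGrid.exists_ne (hG : G.IsSingularGrid) {κ : Dir} {i : Fin n}
    (hi : (κ, i) ∈ G.sing) (d : Deco n) : ∃ f, f ≠ d ∧ G.coord κ f = line i := by
  obtain ⟨k, l, hkl, hk, hl, -⟩ := hG.exists_pair hi .O
  by_cases h : ((Kind.O, k) : Deco n) = d
  · exact ⟨(.O, l), fun h' => hkl (by simpa using h.trans h'.symm), hl⟩
  · exact ⟨_, h, hk⟩

/-- The peak lies between the decoration it is named after and all the other ones. -/
theorem IsEnhanced.peak_le (hG : G.IsEnhanced W P C) {κ : Dir} {i : Fin n} (hi : (κ, i) ∈ G.sing)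
    {f : Deco n} (hf : f ≠ P (κ, i)) (hf' : G.coord κ f = line i) :
    offset n (G.coord κ.other (P (κ, i))) (strip (W κ (P (κ, i)))) ≤
      offset n (G.coord κ.other (P (κ, i))) (G.coord κ.other f) := by
  classical
  set p := P (κ, i)
  have hp : G.coord κ p = line i := (hG.peaks κ i hi).1
  obtain ⟨e, he, hmin⟩ := Finset.exists_min_image
    (Finset.univ.filter fun e => e ≠ p ∧ G.SameRoC κ p e)
    (fun e => offset n (G.coord κ.other p) (G.coord κ.other e))
    ⟨f, by simpa using ⟨hf, hp.trans hf'.symm⟩⟩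
  simp only [Finset.mem_filter, Finset.mem_univ, true_and] at he hmin
  refine (hG.arcs κ i hi p e hp ⟨he.1, he.2, fun g hg hg' => hmin g ⟨hg, hg'⟩⟩).trans ?_
  exact hmin f ⟨hf, hp.trans hf'.symm⟩

/-- When a decoration in a crossing of two singular rows and columns moves to the place of the peak
of one of them, it is on the right side of it. -/
theorem IsEnhanced.peak_eq_iff (hG : G.IsEnhanced W P C) {κ : Dir} {i j : Fin n}
    (hi : (κ, i) ∈ G.sing) (hj : (κ.other, j) ∈ G.sing) {d : Deco n} (hd : G.coord κ d = line i)
    (hd' : G.coord κ.other d = line j) :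
    (strip (W κ.other (P (κ.other, j))) = line i + 1 → d = P (κ.other, j)) ∧
      (strip (W κ.other (P (κ.other, j))) = line i - 1 → d ≠ P (κ.other, j)) := by
  have hg := hG.grid
  have hp : G.coord κ.other (P (κ.other, j)) = line j := (hG.peaks _ j hj).1
  constructor
  · intro h
    by_contra hne
    have h1 := hG.peak_le hj hne hd'
    have h2 : G.coord κ d ≠ G.coord κ (P (κ.other, j)) := fun h' =>
      hne (hg.eq_of_coord κ h' (hd'.trans hp.symm))
    rw [Dir.other_other, h, hd] at h1
    rw [hd] at h2
    have b1 := hg.coord_bounds κ (P (κ.other, j))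
    have b2 := line_lt i
    have b3 := line_nonneg i
    have b4 := hg.coord_far hi (P (κ.other, j))
    rw [offset_eq b1.1.le b1.2 b3 b2,
      offset_eq b1.1.le b1.2 (by omega) (by unfold line at *; omega)] at h1
    split_ifs at h1 <;> omega
  · rintro h rfl
    obtain ⟨f, hf, hf'⟩ := hg.exists_ne hj (P (κ.other, j))
    have h1 := hG.peak_le hj hf hf'
    have h2 : G.coord κ f ≠ G.coord κ (P (κ.other, j)) := fun h' =>
      hf (hg.eq_of_coord κ h' (hf'.trans hp.symm))
    rw [Dir.other_other, h, hd] at h1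
    rw [hd] at h2
    have b0 := hg.sing_pos _ _ hi
    have b1 := hg.coord_bounds κ f
    have b2 := line_lt i
    have b3 := line_nonneg i
    have b4 := hg.coord_far hi f
    rw [offset_eq b3 b2 b1.1.le b1.2,
      offset_eq b3 b2 (by unfold line; omega) (by unfold line at *; omega)] at h1
    unfold line at *
    split_ifs at h1 <;> omega

/-- The generator `X` of the module of `G` corresponds to the generator `x` of the module of the
grid in which `r` is resolved according to whether `r ∈ J`. -/
structure IsLift (r : Circ n) (J : Finset (Circ n)) (x : (G.resolve {r} J).Gen) (X : G.Gen) :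
    Prop where
  perm : X.2 = x.2
  mem_iff : ∀ s ≠ r, (s ∈ X.1.1 ↔ s ∈ x.1.1)
  mem_self : r ∈ X.1.1 ↔ r ∈ J

theorem isLift_inclPos (r : Circ n) (x : (G.pos r).Gen) : IsLift r ∅ x (G.inclPos r x) := by
  refine ⟨rfl, fun s _ => Iff.rfl, ?_⟩
  simp only [Finset.notMem_empty, iff_false]
  exact fun h => (mem_resolve_sing.1 (x.1.2 h)).2 rfl

theorem isLift_inclNeg {r : Circ n} (hr : r ∈ G.sing) (x : (G.neg r).Gen) :
    IsLift r {r} x (G.inclNeg hr x) := by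
  refine ⟨rfl, fun s hs => ?_, ?_⟩ <;> simp [inclNeg]
  tauto

theorem afterPeak_congr {G' : Grid n} {x : G.Gen} {x' : G'.Gen} {π : Polygon n} {s : Circ n}
    {d : Deco n} (hx : x'.2 = x.2) (hd : G'.coord s.1.other d = G.coord s.1.other d) :
    G'.AfterPeak W P x' π s d ↔ G.AfterPeak W P x π s d := by
  unfold AfterPeak
  rw [hx, hd]

theorem onBeta_congr {G' : Grid n} {x : G.Gen} {x' : G'.Gen} {π : Polygon n} {s : Circ n}
    {d : Deco n} (hx : x'.2 = x.2) (hs : s ∈ x'.1.1 ↔ s ∈ x.1.1)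
    (ha : s ∈ π.peaks → (G'.AfterPeak W P x' π s d ↔ G.AfterPeak W P x π s d)) :
    G'.OnBeta W P x' π s d ↔ G.OnBeta W P x π s d := by
  unfold OnBeta
  rw [hx, hs]
  by_cases h : s ∈ π.peaks
  · rw [ha h]
  · simp [h]

/-- A polygon without a peak in `r` has the same content in `G` and in the grid where `r` is
resolved. The positions of the decorations do not agree on the nose: whether a decoration in a
crossing is after the peak of the transverse circle depends on the resolution of `r`, but only for
decorations that are not in the range of the polygon. -/
theorem IsLift.contains_iff (hG : G.IsEnhanced W P C) {r : Circ n} (hr : r ∈ G.sing)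
    {J : Finset (Circ n)} {x : (G.resolve {r} J).Gen} {X : G.Gen} (hX : IsLift r J x X)
    {π : Polygon n} (hπ : r ∉ π.peaks) (d : Deco n) :
    (G.resolve {r} J).Contains W P x π d ↔ G.Contains W P X π d := by
  obtain ⟨κ, i⟩ := r
  have hg := hG.grid
  unfold Contains
  rw [Dir.forall_iff κ, Dir.forall_iff κ, ← hX.perm]
  -- Transversally to the resolved row or column, the position is the same.
  have h1 : (G.resolve {(κ, i)} J).seen W P x π κ d = G.seen W P X π κ d := by
    by_cases hd : ∃ j, (κ, j) ∈ G.sing ∧ G.coord κ d = line j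
    · obtain ⟨j, hj, hd⟩ := hd
      rw [seen_of_mem hd hj]
      by_cases hji : (κ, j) = (κ, i)
      · simp only [Prod.mk.injEq, true_and] at hji
        subst hji
        rw [seen_of_not_mem, resolve_coord_self hd]
        · refine shifted_congr ?_
          unfold OnBeta
          rw [← hX.mem_self]
          simp [hπ]
        · rintro ⟨l, hl, hl'⟩
          have hl2 := (mem_resolve_sing.1 hl).2
          rw [hg.resolve_eq_line_iff hr J hl2, hd] at hl'
          exact hl2 (by rw [line_injective hl'])
      · rw [seen_of_mem ((hg.resolve_eq_line_iff hr J hji d).2 hd)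
          (mem_resolve_sing.2 ⟨hj, hji⟩), hg.shifted_resolve hr J hji hd]
        exact shifted_congr (onBeta_congr hX.perm.symm (hX.mem_iff _ hji).symm
          fun _ => afterPeak_congr hX.perm.symm resolve_coord_other)
    · rw [seen_of_not_mem hd, seen_of_not_mem, resolve_coord_far]
      · exact fun _ h => hd ⟨i, hr, h⟩
      · rintro ⟨l, hl, hl'⟩
        rw [hg.resolve_eq_line_iff hr J (mem_resolve_sing.1 hl).2] at hl'
        exact hd ⟨l, (mem_resolve_sing.1 hl).1, hl'⟩
  rw [h1]
  refine and_congr_right fun hb => ?_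
  -- In the other direction, it is the same as soon as the decoration is in the range of the
  -- polygon.
  suffices h2 : (G.resolve {(κ, i)} J).seen W P x π κ.other d = G.seen W P X π κ.other d by rw [h2]
  by_cases hd : ∃ j, (κ.other, j) ∈ G.sing ∧ G.coord κ.other d = line j
  swap
  · rw [seen_of_not_mem hd, seen_of_not_mem, resolve_coord_other]
    rintro ⟨l, hl, hl'⟩
    rw [resolve_coord_other] at hl'
    exact hd ⟨l, (mem_resolve_sing.1 hl).1, hl'⟩
  obtain ⟨j, hj, hd⟩ := hd
  have hji : (κ.other, j) ≠ (κ, i) := fun h => Dir.other_ne κ (Prod.mk.inj h).1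
  rw [seen_of_mem hd hj, seen_of_mem (resolve_coord_other.trans hd)
    (mem_resolve_sing.2 ⟨hj, hji⟩), hg.shifted_resolve hr J hji hd]
  refine shifted_congr (onBeta_congr hX.perm.symm (hX.mem_iff _ hji).symm fun hp => ?_)
  by_cases hdi : G.coord κ d = line i
  swap
  · exact afterPeak_congr hX.perm.symm (by simpa using resolve_coord_far fun _ => hdi)
  have hH : (G.resolve {(κ, i)} J).coord κ d = G.seen W P X π κ d := by
    rw [← h1, seen_of_not_mem]
    rintro ⟨l, hl, hl'⟩
    rw [hg.resolve_eq_line_iff hr J (mem_resolve_sing.1 hl).2, hdi] at hl'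
    exact (mem_resolve_sing.1 hl).2 (by rw [line_injective hl'])
  obtain ⟨e1, e2⟩ := hG.peak_eq_iff hr hj hdi hd
  have hc := hg.resolve_coord_cases hr J d
  rw [← hH] at hb
  have c1 := hg.resolve_coord_bounds hr J κ d
  have c2 := hg.sing_pos _ _ hr
  unfold AfterPeak
  simp only [Dir.other_other, ← hX.perm]
  generalize (G.resolve {(κ, i)} J).coord κ d = c at *
  have hl : ∃ a b : Fin n, π.lower X.2 κ.other = line a ∧ π.upper X.2 κ.other = line b := by
    cases κ <;> exact ⟨_, _, rfl, rfl⟩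
  obtain ⟨a, b, ha, hb'⟩ := hl
  rw [ha, hb', btw_iff (line_nonneg a) (line_lt a) c1.1.le c1.2 (line_nonneg b) (line_lt b)] at hb
  rw [ha, hdi, offset_eq (line_nonneg a) (line_lt a) (strip_nonneg _) (strip_lt _),
    offset_eq (line_nonneg a) (line_lt a) c1.1.le c1.2,
    offset_eq (line_nonneg a) (line_lt a) (line_nonneg i) (line_lt i)]
  have b1 := strip_lt (W κ.other (P (κ.other, j)))
  have b2 := strip_nonneg (W κ.other (P (κ.other, j)))
  by_cases hdP : d = P (κ.other, j)
  · simp only [← hdP, ne_eq, not_true_eq_false, and_false, or_false, imp_false] at e2 b1 b2 ⊢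
    clear e1
    unfold strip line at *
    split_ifs <;> omega
  · simp only [ne_eq, hdP, not_false_eq_true, and_true, imp_false] at e1 e2 ⊢
    unfold strip line at *
    split_ifs <;> omega

theorem IsLift.isPolygon_iff {r : Circ n}
    {J : Finset (Circ n)} {x y : (G.resolve {r} J).Gen} {X Y : G.Gen} (hX : IsLift r J x X)
    (hY : IsLift r J y Y) {π : Polygon n} (hπ : r ∉ π.peaks) :
    (G.resolve {r} J).IsPolygon W P x y π ↔ G.IsPolygon W P X Y π := by
  have hne : ∀ s ∈ π.peaks, s ≠ r := fun s hs h => hπ (h ▸ hs)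
  have hres : y.1.1 = x.1.1 ∪ π.peaks ↔ Y.1.1 = X.1.1 ∪ π.peaks := by
    have hrx : r ∉ x.1.1 := fun h => (mem_resolve_sing.1 (x.1.2 h)).2 rfl
    have hry : r ∉ y.1.1 := fun h => (mem_resolve_sing.1 (y.1.2 h)).2 rfl
    simp only [Finset.ext_iff, Finset.mem_union]
    refine forall_congr' fun s => ?_
    by_cases hs : s = r
    · subst hs
      simp [hrx, hry, hπ, hX.mem_self, hY.mem_self]
    · rw [hX.mem_iff s hs, hY.mem_iff s hs]
  constructor
  · rintro ⟨h1, h2, h3, h4, h5, h6, h7, h8⟩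
    refine ⟨h1, hX.perm ▸ h2, fun s hs => (mem_resolve_sing.1 (h3 hs)).1, hX.perm ▸ h4, ?_,
      hX.perm ▸ h6, hres.1 h7, by rw [hX.perm, hY.perm, h8]⟩
    exact fun s hs => (hX.mem_iff s (hne s hs)).not.2 (h5 s hs)
  · rintro ⟨h1, h2, h3, h4, h5, h6, h7, h8⟩
    refine ⟨h1, hX.perm ▸ h2, fun s hs => mem_resolve_sing.2 ⟨h3 hs, hne s hs⟩, hX.perm ▸ h4, ?_,
      hX.perm ▸ h6, hres.2 h7, by rw [← hX.perm, ← hY.perm, h8]⟩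
    exact fun s hs => (hX.mem_iff s (hne s hs)).not.1 (h5 s hs)

theorem IsPolygon.not_mem_peaks {r : Circ n} {J : Finset (Circ n)}
    {x y : (G.resolve {r} J).Gen} {π : Polygon n}
    (h : (G.resolve {r} J).IsPolygon W P x y π) : r ∉ π.peaks :=
  fun hr => (mem_resolve_sing.1 (h.peak_sing hr)).2 rfl

theorem IsLift.weight_eq (hG : G.IsEnhanced W P C) {r : Circ n} (hr : r ∈ G.sing)
    {J : Finset (Circ n)} {x : (G.resolve {r} J).Gen} {X : G.Gen} (hX : IsLift r J x X)
    (ε : Equiv.Perm (Fin n) → Fin n → Fin n → ℤˣ) {π : Polygon n} (hπ : r ∉ π.peaks) :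
    (G.resolve {r} J).weight ε W P C x π = G.weight ε W P C X π := by
  unfold weight mu
  classical
  rw [hX.perm]
  congr 1
  exact Finset.prod_congr (Finset.filter_congr fun k _ => hX.contains_iff hG hr hπ _) fun _ _ => rfl

end Grid

/-! ### The position of a decoration relative to a peak and to a dot -/

/-- The comparison of three points of a circle `ℤ / 2n`: two grid lines `l`, `u`, a decoration with
coordinate `c` and a peak in the strip with coordinate `w`. The cyclic order is measured on the four
times finer circle `ℤ / 8n`, where a decoration on a line (that is, in a crossing of singular rows
and columns) is at `4 * c ± 1` and the peak is at `4 * w ± 1`. -/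
theorem btw_peak_iff {n : ℕ} {l u c S w δl δu η : ℤ} {dP : Prop} (hl : Even l) (hu : Even u)
    (hl0 : 0 ≤ l) (hln : l < 2 * n) (hu0 : 0 ≤ u) (hun : u < 2 * n) (hlu : l ≠ u)
    (hc0 : 0 < c) (hcn : c < 2 * n) (hw : Odd w) (hw0 : 0 ≤ w) (hwn : w < 2 * n)
    (hS : Odd c ∧ S = c ∨ Even c ∧ (S = c - 1 ∨ S = c + 1))
    (hδl : Odd c ∧ δl = 0 ∨ Even c ∧ (δl = -1 ∨ δl = 1))
    (hδu : Odd c ∧ δu = 0 ∨ Even c ∧ (δu = -1 ∨ δu = 1))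
    (hSl : c = l → S = c + δl) (hSu : c = u → S = c + δu)
    (hη : (c = w ∧ dP) ∧ η = 1 ∨ ¬ (c = w ∧ dP) ∧ η = -1) :
    (¬ Btw n l w u →
      (Btw (4 * n) (4 * w + η) (4 * c + δu) (4 * u) ↔
        Btw (4 * n) (4 * w + η) (4 * c + δl) (4 * l) ∨ Btw n l S u) ∧
      ¬ (Btw (4 * n) (4 * w + η) (4 * c + δl) (4 * l) ∧ Btw n l S u)) ∧
    (Btw n l w u →
      (Btw (4 * n) (4 * w + η) (4 * c + δu) (4 * u) ↔
        Btw (4 * n) (4 * w + η) (4 * c + δl) (4 * l) ∧ Btw n l S u) ∧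
      (Btw (4 * n) (4 * w + η) (4 * c + δl) (4 * l) ∨ Btw n l S u) ∧
      (Btw n l S u → ((offset n l w < offset n l c ∨ (c = w ∧ ¬ dP)) ↔
        Btw (4 * n) (4 * w + η) (4 * c + δu) (4 * u)))) := by
  obtain ⟨l, rfl⟩ := hl
  obtain ⟨u, rfl⟩ := hu
  obtain ⟨w, rfl⟩ := hw
  rw [Int.odd_iff, Int.even_iff] at hS hδl hδu
  -- All comparisons are expressed by the relative order of the two lines, of the peak and of the
  -- decoration.
  have hS0 : 0 ≤ S ∧ S < 2 * n := by clear * - hS hc0 hcn; omega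
  obtain ⟨Q, hQ⟩ : ∃ Q : Prop, Q ↔ (2 * w + 1 < c ∨ (c = 2 * w + 1 ∧ ¬ dP)) := ⟨_, Iff.rfl⟩
  obtain ⟨A, hA⟩ : ∃ A : Prop, A ↔ (offset n (l + l) (2 * w + 1) < offset n (l + l) c ∨
    (c = 2 * w + 1 ∧ ¬ dP)) := ⟨_, Iff.rfl⟩
  have hη1 : Q → 2 * w + 1 < c ∧ (η = 1 ∨ η = -1) ∨ c = 2 * w + 1 ∧ η = -1 := by
    by_cases hd : dP
    · simp only [hd, and_true, not_true_eq_false, and_false, or_false] at hη hQ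
      rw [hQ]; clear * - hη; omega
    · simp only [hd, and_false, not_false_eq_true, and_true, false_and, false_or, true_and] at hη hQ
      rw [hQ]; clear * - hη; omega
  have hη2 : ¬ Q → c < 2 * w + 1 ∧ (η = 1 ∨ η = -1) ∨ c = 2 * w + 1 ∧ η = 1 := by
    by_cases hd : dP
    · simp only [hd, and_true, not_true_eq_false, and_false, or_false] at hη hQ
      rw [hQ]; clear * - hη; omega
    · simp only [hd, and_false, not_false_eq_true, and_true, false_and, false_or, true_and] at hη hQ
      rw [hQ]; clear * - hη; omega
  have hAQ : A ↔ (offset n (l + l) (2 * w + 1) < offset n (l + l) c ∨ (c = 2 * w + 1 ∧ Q)) := by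
    rw [hA, hQ]
    refine or_congr_right (and_congr_right fun h => ?_)
    simp [h]
  have hηb : η = 1 ∨ η = -1 := hη.imp And.right And.right
  rw [← hA]
  clear hQ hA hη
  have hSo : S % 2 = 1 := by clear * - hS; omega
  have a3 : 4 * c + δu < 4 * (u + u) ↔ ¬ u + u < S := by clear * - hδu hSu hS; omega
  have a4 : 4 * c + δl < 4 * (l + l) ↔ ¬ l + l < S := by clear * - hδl hSl hS; omega
  have a5 : 4 * (u + u) < 4 * (2 * w + 1) + η ↔ ¬ 2 * w + 1 < u + u := by clear * - hηb; omega
  have a6 : 4 * (l + l) < 4 * (2 * w + 1) + η ↔ ¬ 2 * w + 1 < l + l := by clear * - hηb; omega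
  have a7 : u + u < l + l ↔ ¬ l + l < u + u := by clear * - hlu; omega
  have a8 : S < u + u ↔ ¬ u + u < S := by clear * - hSo; omega
  have a9 : l + l < 2 * w + 1 ↔ ¬ 2 * w + 1 < l + l := by clear * -; omega
  have t1 : l + l < u + u → u + u < S → l + l < S := by clear * -; omega
  have t2 : ¬ l + l < u + u → l + l < S → u + u < S := by clear * - hlu; omega
  have t7 : l + l < u + u → 2 * w + 1 < l + l → 2 * w + 1 < u + u := by clear * -; omega
  have t8 : ¬ l + l < u + u → 2 * w + 1 < u + u → 2 * w + 1 < l + l := by clear * - hlu; omega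
  have hfl : 0 ≤ 4 * c + δl ∧ 4 * c + δl < 2 * (4 * n) := by clear * - hc0 hcn hδl; omega
  have hfu : 0 ≤ 4 * c + δu ∧ 4 * c + δu < 2 * (4 * n) := by clear * - hc0 hcn hδu; omega
  have hfw : 0 ≤ 4 * (2 * w + 1) + η ∧ 4 * (2 * w + 1) + η < 2 * (4 * n) := by
    clear * - hw0 hwn hηb; omega
  have hll : 4 * (l + l) < 2 * (4 * n) := by clear * - hln; omega
  have huu : 4 * (u + u) < 2 * (4 * n) := by clear * - hun; omega
  have hl4 : 0 ≤ 4 * (l + l) := by clear * - hl0; omega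
  have hu4 : 0 ≤ 4 * (u + u) := by clear * - hu0; omega
  have hw2 : 0 ≤ 2 * w + 1 ∧ 2 * w + 1 < 2 * n := ⟨hw0, hwn⟩
  -- The decoration is after the peak, for a decoration in the range of the edge.
  have a10 : (l + l < S ∧ ¬ u + u < S ∨ ¬ u + u < S ∧ ¬ l + l < u + u ∨
      ¬ l + l < u + u ∧ l + l < S) → (A ↔ (¬ 2 * w + 1 < l + l ∧ l + l < S ∧ Q) ∨
        (¬ 2 * w + 1 < l + l ∧ ¬ l + l < S) ∨ (2 * w + 1 < l + l ∧ ¬ l + l < S ∧ Q)) := by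
    rw [hAQ, offset_eq hl0 hln hw2.1 hw2.2, offset_eq hl0 hln hc0.le hcn]
    by_cases hq : Q
    · have hη := hη1 hq
      simp only [hq, and_true]
      clear * - hl0 hu0 hln hun hc0 hcn hη hw2 hS hδl hSl hlu
      split_ifs <;> omega
    · have hη := hη2 hq
      simp only [hq, and_false, or_false, false_or]
      clear * - hl0 hu0 hln hun hc0 hcn hη hw2 hS hδl hSl hlu
      split_ifs <;> omega
  have t3 : 2 * w + 1 < l + l → l + l < S → Q := by
    intro h1 h2; by_contra hq; have := hη2 hq; clear * - this h1 h2 hS; omega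
  have t4 : ¬ 2 * w + 1 < l + l → ¬ l + l < S → ¬ Q := by
    intro h1 h2 hq; have := hη1 hq; clear * - this h1 h2 hS; omega
  have t5 : 2 * w + 1 < u + u → u + u < S → Q := by
    intro h1 h2; by_contra hq; have := hη2 hq; clear * - this h1 h2 hS; omega
  have t6 : ¬ 2 * w + 1 < u + u → ¬ u + u < S → ¬ Q := by
    intro h1 h2 hq; have := hη1 hq; clear * - this h1 h2 hS; omega
  have a1 : 4 * (2 * w + 1) + η < 4 * c + δu ↔ Q := by
    by_cases hq : Q
    · have := hη1 hq; simp only [hq, iff_true]; clear * - this hδu; omega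
    · have := hη2 hq; simp only [hq, iff_false]; clear * - this hδu; omega
  have a2 : 4 * (2 * w + 1) + η < 4 * c + δl ↔ Q := by
    by_cases hq : Q
    · have := hη1 hq; simp only [hq, iff_true]; clear * - this hδl; omega
    · have := hη2 hq; simp only [hq, iff_false]; clear * - this hδl; omega
  rw [btw_iff (n := 4 * n) hfw.1 (by push_cast; exact hfw.2) hfu.1 (by push_cast; exact hfu.2)
      hu4 (by push_cast; exact huu),
    btw_iff (n := 4 * n) hfw.1 (by push_cast; exact hfw.2) hfl.1 (by push_cast; exact hfl.2)
      hl4 (by push_cast; exact hll),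
    btw_iff hl0 hln hw2.1 hw2.2 hu0 hun, btw_iff hl0 hln hS0.1 hS0.2 hu0 hun,
    a1, a2, a3, a4, a5, a6, a7, a8, a9]
  clear * - a10 t1 t2 t3 t4 t5 t6 t7 t8
  generalize (2 * w + 1 < l + l) = x1 at *
  generalize (2 * w + 1 < u + u) = x2 at *
  generalize (l + l < u + u) = x3 at *
  generalize (l + l < S) = x4 at *
  generalize (u + u < S) = x5 at *
  by_cases x1 <;> by_cases x2 <;> by_cases x3 <;> by_cases x4 <;> by_cases x5 <;> by_cases Q <;>
    simp_all

/-! ### Edges of a polygon on a given circle -/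

variable {n : ℕ}

/-- The place, on the circle `r`, of the dot of the generator given by `σ`. -/
def dotPlace (σ : Equiv.Perm (Fin n)) : Circ n → Fin n
  | (.col, i) => σ i
  | (.row, j) => σ.symm j

namespace Polygon

/-- The west or the south edge of the polygon is on the circle `r`. -/
def OnLow (π : Polygon n) (σ : Equiv.Perm (Fin n)) (r : Circ n) : Prop :=
  π.side σ .west = r ∨ π.side σ .south = r

/-- The east or the north edge of the polygon is on the circle `r`. -/
def OnHigh (π : Polygon n) (σ : Equiv.Perm (Fin n)) (r : Circ n) : Prop :=
  π.side σ .east = r ∨ π.side σ .north = r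

variable {π : Polygon n} {σ : Equiv.Perm (Fin n)} {κ : Dir} {i : Fin n}

theorem onLow_iff : π.OnLow σ (κ, i) ↔ π.lower σ κ.other = line i := by
  unfold OnLow
  cases κ <;> simp [side, lower, Dir.other, line_injective.eq_iff]

theorem onHigh_iff : π.OnHigh σ (κ, i) ↔ π.upper σ κ.other = line i := by
  unfold OnHigh
  cases κ <;> simp [side, upper, Dir.other, line_injective.eq_iff]

theorem exists_lower (π : Polygon n) (σ : Equiv.Perm (Fin n)) (κ : Dir) :
    ∃ a : Fin n, π.lower σ κ = line a := by
  cases κ <;> exact ⟨_, rfl⟩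

theorem exists_upper (π : Polygon n) (σ : Equiv.Perm (Fin n)) (κ : Dir) :
    ∃ a : Fin n, π.upper σ κ = line a := by
  cases κ <;> exact ⟨_, rfl⟩

theorem lower_ne_upper (h : π.west ≠ π.east) (κ : Dir) : π.lower σ κ ≠ π.upper σ κ := by
  cases κ <;> simp [lower, upper, line_injective.eq_iff, h]

theorem OnLow.not_onHigh {r : Circ n} (h : π.west ≠ π.east) (hl : π.OnLow σ r) :
    ¬ π.OnHigh σ r := by
  obtain ⟨κ, i⟩ := r
  rw [onLow_iff] at hl
  rw [onHigh_iff, ← hl]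
  exact (lower_ne_upper h _).symm

theorem exists_side_iff {r : Circ n} :
    (∃ c, π.side σ c = r) ↔ π.OnLow σ r ∨ π.OnHigh σ r := by
  unfold OnLow OnHigh
  constructor
  · rintro ⟨c, hc⟩
    cases c <;> simp [hc]
  · rintro ((h | h) | (h | h)) <;> exact ⟨_, h⟩

/-- On its west and south edges, a polygon starts at the dot of its first generator. -/
theorem OnLow.dotPlace_eq (hl : π.OnLow σ (κ, i)) :
    π.lower σ κ = line (dotPlace σ (κ, i)) ∧
      π.upper σ κ = line (dotPlace (σ * Equiv.swap π.west π.east) (κ, i)) := by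
  unfold OnLow at hl
  cases κ
  · obtain rfl : π.west = i := by simpa [side] using hl
    simp [lower, upper, dotPlace]
  · obtain rfl : σ π.west = i := by simpa [side] using hl
    simp [lower, upper, dotPlace, Equiv.Perm.mul_def]

/-- On its east and north edges, a polygon starts at the dot of its second generator. -/
theorem OnHigh.dotPlace_eq (hl : π.OnHigh σ (κ, i)) :
    π.upper σ κ = line (dotPlace σ (κ, i)) ∧
      π.lower σ κ = line (dotPlace (σ * Equiv.swap π.west π.east) (κ, i)) := by
  unfold OnHigh at hl
  cases κ
  · obtain rfl : π.east = i := by simpa [side] using hl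
    simp [lower, upper, dotPlace]
  · obtain rfl : σ π.east = i := by simpa [side] using hl
    simp [lower, upper, dotPlace, Equiv.Perm.mul_def]

theorem dotPlace_eq_of_not {r : Circ n} (hl : ¬ π.OnLow σ r) (hh : ¬ π.OnHigh σ r) :
    dotPlace (σ * Equiv.swap π.west π.east) r = dotPlace σ r := by
  obtain ⟨κ, i⟩ := r
  unfold OnLow at hl
  unfold OnHigh at hh
  cases κ
  · simp only [side, Prod.mk.injEq, true_and, reduceCtorEq, false_and, or_false] at hl hh
    simp [dotPlace, Equiv.swap_apply_of_ne_of_ne (Ne.symm hl) (Ne.symm hh)]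
  · simp only [side, Prod.mk.injEq, true_and, reduceCtorEq, false_and, false_or] at hl hh
    simp only [dotPlace, Equiv.Perm.mul_def, Equiv.symm_trans_apply, Equiv.symm_swap]
    refine Equiv.swap_apply_of_ne_of_ne ?_ ?_
    · exact fun h => hl (by rw [← h]; simp)
    · exact fun h => hh (by rw [← h]; simp)

/-- The ends of an edge on a circle lie on edges of the transverse family. -/
theorem OnLow.onLow_dot {j : Fin n} (hl : π.OnLow σ (κ, i)) (hj : dotPlace σ (κ, i) = j) :
    π.OnLow σ (κ.other, j) := by
  rw [onLow_iff, Dir.other_other, hl.dotPlace_eq.1, hj]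

theorem OnLow.onHigh_dot {j : Fin n} (hl : π.OnLow σ (κ, i))
    (hj : dotPlace (σ * Equiv.swap π.west π.east) (κ, i) = j) :
    π.OnHigh σ (κ.other, j) := by
  rw [onHigh_iff, Dir.other_other, hl.dotPlace_eq.2, hj]

theorem OnHigh.onHigh_dot {j : Fin n} (hl : π.OnHigh σ (κ, i)) (hj : dotPlace σ (κ, i) = j) :
    π.OnHigh σ (κ.other, j) := by
  rw [onHigh_iff, Dir.other_other, hl.dotPlace_eq.1, hj]

theorem OnHigh.onLow_dot {j : Fin n} (hl : π.OnHigh σ (κ, i))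
    (hj : dotPlace (σ * Equiv.swap π.west π.east) (κ, i) = j) :
    π.OnLow σ (κ.other, j) := by
  rw [onLow_iff, Dir.other_other, hl.dotPlace_eq.2, hj]

end Polygon

namespace Grid

variable {G : Grid n} {W : Dir → Deco n → Fin n} {P : Circ n → Deco n} {C : Circ n → Compass}

/-! ### Which decorations lie between the peak and the dot -/

/-- The coordinate of the decoration `d` on the four times finer circle: on a circle of a singular
row or column, it is displaced to the side that the generator `x` leaves it on. -/
noncomputable def finePos (x : G.Gen) (κ : Dir) (d : Deco n) : ℤ :=
  4 * G.coord κ d + ((G.resolve G.sing x.1.1).coord κ d - G.coord κ d)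

variable (W P) in
open Classical in
/-- The coordinate of the peak of `r` on the four times finer circle. The peak is just after the
decoration it is named after and before any other decoration of the same strip. -/
noncomputable def finePeak (G : Grid n) (r : Circ n) (d : Deco n) : ℤ :=
  4 * strip (W r.1 (P r)) +
    if G.coord r.1.other d = strip (W r.1 (P r)) ∧ d = P r then 1 else -1

variable (W P) in
/-- Going from the peak of `r` in the positive direction, the decoration `d` of `r` comes before
the dot of `x` on `r`. -/
def BeforeDot (x : G.Gen) (r : Circ n) (d : Deco n) : Prop :=
  Btw (4 * n) (G.finePeak W P r d) (finePos x r.1.other d) (4 * line (dotPlace x.2 r))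

theorem IsSingularGrid.resolve_sub_cases (hG : G.IsSingularGrid) (I : Finset (Circ n)) (κ : Dir)
    (d : Deco n) :
    (Odd (G.coord κ d) ∧ (G.resolve G.sing I).coord κ d - G.coord κ d = 0) ∨
    (Even (G.coord κ d) ∧ ((G.resolve G.sing I).coord κ d - G.coord κ d = -1 ∨
      (G.resolve G.sing I).coord κ d - G.coord κ d = 1)) := by
  by_cases hd : ∃ i, (κ, i) ∈ G.sing ∧ G.coord κ d = line i
  · obtain ⟨i, hi, hd⟩ := hd
    right
    rw [resolve_coord_of_mem hd hi]
    refine ⟨hd ▸ even_line i, ?_⟩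
    rcases shifted_eq_or (G := G) κ d ((κ, i) ∈ I) with h | h <;> rw [h] <;> omega
  · left
    rw [resolve_coord_of_odd hd]
    refine ⟨?_, by omega⟩
    rw [← Int.not_even_iff_odd]
    exact fun h => hd (hG.coord_even h)

theorem onBeta_iff {x : G.Gen} {π : Polygon n} {r : Circ n} {d : Deco n} :
    G.OnBeta W P x π r d ↔ (r ∉ π.peaks ∧ r ∈ x.1.1) ∨
      (r ∈ π.peaks ∧ π.OnLow x.2 r ∧ G.AfterPeak W P x π r d) ∨
      (r ∈ π.peaks ∧ π.OnHigh x.2 r ∧ ¬ G.AfterPeak W P x π r d) := Iff.rfl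

/-- The conditions under which a grid polygon starts at `x` and ends at a generator given by the
places `z`, as far as the winding arcs are concerned. -/
theorem IsPolygon.mem_target {x y : G.Gen} {π : Polygon n} (h : G.IsPolygon W P x y π) (s : Circ n) :
    s ∈ y.1.1 ↔ s ∈ x.1.1 ∨ s ∈ π.peaks := by
  rw [h.target_res, Finset.mem_union]

/-- Near the dot of `x` on an edge, a decoration in a crossing lies where the arcs of `x` leave
it. -/
theorem IsPolygon.seen_start (hG : G.IsSingularGrid) {x y : G.Gen} {π : Polygon n}
    (h : G.IsPolygon W P x y π) {κ : Dir} {i : Fin n}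
    (hs : π.OnLow x.2 (κ, i) ∨ π.OnHigh x.2 (κ, i)) {d : Deco n} (hd : G.coord κ d = line i)
    (hd' : G.coord κ.other d = line (dotPlace x.2 (κ, i))) :
    G.seen W P x π κ.other d = (G.resolve G.sing x.1.1).coord κ.other d := by
  obtain ⟨j, hj, hdj⟩ := hG.coord_even (hd' ▸ even_line _)
  obtain hij := line_injective (hd'.symm.trans hdj)
  rw [seen_of_mem hdj hj, resolve_coord_of_mem hdj hj]
  refine shifted_congr ?_
  rw [onBeta_iff]
  by_cases hp : (κ.other, j) ∈ π.peaks
  swap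
  · simp [hp]
  simp only [hp, not_true_eq_false, false_and, true_and, false_or]
  simp only [h.peak_alpha _ hp, iff_false]
  have hm := h.peak_mem _ hp
  unfold AfterPeak
  simp only [Dir.other_other] at hm ⊢
  rcases hs with hl | hl
  · have h1 := hl.onLow_dot hij
    have h2 := h1.not_onHigh h.ne
    have h3 := Polygon.onLow_iff.1 hl
    simp only [h1, h2, true_and, false_and, or_false]
    rw [h3, hd, offset_eq (line_nonneg i) (line_lt i) (line_nonneg i) (line_lt i),
      offset_eq (line_nonneg i) (line_lt i) (strip_nonneg _) (strip_lt _)]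
    have h4 := line_ne_strip i (W κ.other (P (κ.other, j)))
    have h5 := line_lt i
    have h6 := strip_nonneg (W κ.other (P (κ.other, j)))
    simp only [h4, false_and, or_false]
    split_ifs <;> omega
  · have h1 := hl.onHigh_dot hij
    have h2 : ¬ π.OnLow x.2 (κ.other, j) := fun h' => h'.not_onHigh h.ne h1
    have h3 := Polygon.onHigh_iff.1 hl
    simp only [h1, h2, true_and, false_and, false_or, not_not]
    rw [h3] at hm
    left
    rw [hd]
    exact hm.2

/-- Near the dot of `y` on an edge, a decoration in a crossing lies where the arcs of `y` leave
it. -/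
theorem IsPolygon.seen_end (hG : G.IsSingularGrid) {x y : G.Gen} {π : Polygon n}
    (h : G.IsPolygon W P x y π) {κ : Dir} {i : Fin n}
    (hs : π.OnLow x.2 (κ, i) ∨ π.OnHigh x.2 (κ, i)) {d : Deco n} (hd : G.coord κ d = line i)
    (hd' : G.coord κ.other d = line (dotPlace y.2 (κ, i))) :
    G.seen W P x π κ.other d = (G.resolve G.sing y.1.1).coord κ.other d := by
  obtain ⟨j, hj, hdj⟩ := hG.coord_even (hd' ▸ even_line _)
  have hij := line_injective (hd'.symm.trans hdj)
  rw [h.target_perm] at hij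
  rw [seen_of_mem hdj hj, resolve_coord_of_mem hdj hj]
  refine shifted_congr ?_
  rw [onBeta_iff, h.mem_target]
  by_cases hp : (κ.other, j) ∈ π.peaks
  swap
  · simp [hp]
  simp only [hp, not_true_eq_false, false_and, true_and, false_or]
  simp only [or_true, iff_true]
  have hm := h.peak_mem _ hp
  unfold AfterPeak
  simp only [Dir.other_other] at hm ⊢
  rcases hs with hl | hl
  · have h1 := hl.onHigh_dot hij
    have h2 : ¬ π.OnLow x.2 (κ.other, j) := fun h' => h'.not_onHigh h.ne h1
    have h3 := Polygon.onLow_iff.1 hl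
    simp only [h1, h2, true_and, false_and, false_or]
    rw [h3, hd, offset_eq (line_nonneg i) (line_lt i) (line_nonneg i) (line_lt i),
      offset_eq (line_nonneg i) (line_lt i) (strip_nonneg _) (strip_lt _)]
    have h4 := line_ne_strip i (W κ.other (P (κ.other, j)))
    have h5 := line_lt i
    have h6 := strip_nonneg (W κ.other (P (κ.other, j)))
    simp only [h4, false_and, or_false]
    split_ifs <;> omega
  · have h1 := hl.onLow_dot hij
    have h2 := h1.not_onHigh h.ne
    have h3 := Polygon.onHigh_iff.1 hl
    simp only [h1, h2, true_and, false_and, or_false]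
    rw [h3] at hm
    left
    rw [hd]
    exact hm.2

end Grid

namespace Grid

variable {G : Grid n} {W : Dir → Deco n → Fin n} {P : Circ n → Deco n}
  {C : Circ n → Compass}

/-! ### How the content of a polygon depends on the arcs of one singular row or column -/

/-- Two polygons with the same rectangle, which follow the same winding arcs and have the same
peaks, except possibly on `r`. -/
structure AgreeOff (r : Circ n) (x : G.Gen) (π : Polygon n) (x' : G.Gen) (π' : Polygon n) :
    Prop where
  perm : x'.2 = x.2
  west : π'.west = π.west
  east : π'.east = π.east
  mem_iff : ∀ s ≠ r, (s ∈ x'.1.1 ↔ s ∈ x.1.1)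
  peaks_iff : ∀ s ≠ r, (s ∈ π'.peaks ↔ s ∈ π.peaks)

namespace AgreeOff

variable {r : Circ n} {x x' : G.Gen} {π π' : Polygon n} {κ : Dir} {i : Fin n}

theorem lower_eq (h : AgreeOff r x π x' π') (κ : Dir) : π'.lower x'.2 κ = π.lower x.2 κ := by
  cases κ <;> simp [Polygon.lower, h.perm, h.west]

theorem upper_eq (h : AgreeOff r x π x' π') (κ : Dir) : π'.upper x'.2 κ = π.upper x.2 κ := by
  cases κ <;> simp [Polygon.upper, h.perm, h.east]

theorem onLow_iff (h : AgreeOff r x π x' π') (s : Circ n) : π'.OnLow x'.2 s ↔ π.OnLow x.2 s := by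
  rw [Polygon.onLow_iff, Polygon.onLow_iff, h.lower_eq]

theorem onHigh_iff (h : AgreeOff r x π x' π') (s : Circ n) :
    π'.OnHigh x'.2 s ↔ π.OnHigh x.2 s := by
  rw [Polygon.onHigh_iff, Polygon.onHigh_iff, h.upper_eq]

theorem afterPeak_iff (h : AgreeOff r x π x' π') (s : Circ n) (d : Deco n) :
    G.AfterPeak W P x' π' s d ↔ G.AfterPeak W P x π s d := by
  unfold AfterPeak
  rw [h.lower_eq]

theorem seen_eq (h : AgreeOff (κ, i) x π x' π') {κ' : Dir} {d : Deco n}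
    (hd : κ' = κ → G.coord κ' d ≠ line i) : G.seen W P x' π' κ' d = G.seen W P x π κ' d := by
  by_cases hs : ∃ j, (κ', j) ∈ G.sing ∧ G.coord κ' d = line j
  · obtain ⟨j, hj, hdj⟩ := hs
    have hne : (κ', j) ≠ (κ, i) := fun he => by
      simp only [Prod.mk.injEq] at he
      exact hd he.1 (by rw [hdj, he.2])
    rw [seen_of_mem hdj hj, seen_of_mem hdj hj]
    refine shifted_congr ?_
    rw [onBeta_iff, onBeta_iff, h.peaks_iff _ hne, h.mem_iff _ hne, h.onLow_iff, h.onHigh_iff,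
      h.afterPeak_iff]
  · rw [seen_of_not_mem hs, seen_of_not_mem hs]

theorem contains_iff_of_ne (h : AgreeOff (κ, i) x π x' π') {d : Deco n}
    (hd : G.coord κ d ≠ line i) : G.Contains W P x' π' d ↔ G.Contains W P x π d := by
  unfold Contains
  refine forall_congr' fun κ' => ?_
  rw [h.lower_eq, h.upper_eq, h.seen_eq fun hκ => by rwa [hκ]]

/-- The decoration `d` of the row or column of the circle `(κ, i)` is in the range of the edges of
the polygon that are parallel to that circle. -/
def _root_.SingularGridHomology.Grid.InRange (W : Dir → Deco n → Fin n) (P : Circ n → Deco n)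
    (x : G.Gen) (π : Polygon n) (κ : Dir) (d : Deco n) : Prop :=
  Btw n (π.lower x.2 κ) (G.seen W P x π κ.other d) (π.upper x.2 κ)

theorem contains_iff (hi : (κ, i) ∈ G.sing)
    (h : AgreeOff (κ, i) x π x' π') {d : Deco n} (hd : G.coord κ d = line i) :
    G.Contains W P x' π' d ↔ InRange W P x π κ d ∧
      Btw n (π.lower x.2 κ.other) (G.shifted κ d (G.OnBeta W P x' π' (κ, i) d))
        (π.upper x.2 κ.other) := by
  unfold Contains
  rw [Dir.forall_iff κ, h.lower_eq, h.lower_eq, h.upper_eq, h.upper_eq, Dir.other_other, and_comm,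
    h.seen_eq fun hκ => absurd hκ (Dir.other_ne κ), seen_of_mem hd hi]
  rfl

theorem contains_iff_of_onLow (hG : G.IsSingularGrid) (hi : (κ, i) ∈ G.sing)
    (h : AgreeOff (κ, i) x π x' π') (hπ : π.west ≠ π.east) (hl : π.OnLow x.2 (κ, i)) {d : Deco n}
    (hd : G.coord κ d = line i) :
    G.Contains W P x' π' d ↔ InRange W P x π κ d ∧
      ¬ (G.IsLow κ d ↔ ¬ G.OnBeta W P x' π' (κ, i) d) := by
  rw [h.contains_iff hi hd, Polygon.onLow_iff.1 hl]
  refine and_congr_right fun _ => ?_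
  have h0 := Polygon.lower_ne_upper (σ := x.2) hπ κ.other
  obtain ⟨u, hu⟩ := π.exists_upper x.2 κ.other
  rw [Polygon.onLow_iff.1 hl, hu] at h0
  rw [hu]
  have h1 := hG.sing_pos κ i hi
  by_cases hb : G.IsLow κ d ↔ ¬ G.OnBeta W P x' π' (κ, i) d
  · rw [shifted_of_low hb, hd]
    simp only [hb, not_true_eq_false, iff_false]
    rw [btw_iff (line_nonneg i) (line_lt i) (by unfold line; omega) (by unfold line; omega)
      (line_nonneg u) (line_lt u)]
    unfold line at *
    omega
  · rw [shifted_of_high hb, hd]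
    simp only [hb, not_false_eq_true, iff_true]
    rw [btw_iff (line_nonneg i) (line_lt i) (by unfold line; omega) (by unfold line; omega)
      (line_nonneg u) (line_lt u)]
    unfold line at *
    omega

theorem contains_iff_of_onHigh (hG : G.IsSingularGrid) (hi : (κ, i) ∈ G.sing)
    (h : AgreeOff (κ, i) x π x' π') (hπ : π.west ≠ π.east) (hl : π.OnHigh x.2 (κ, i)) {d : Deco n}
    (hd : G.coord κ d = line i) :
    G.Contains W P x' π' d ↔ InRange W P x π κ d ∧
      (G.IsLow κ d ↔ ¬ G.OnBeta W P x' π' (κ, i) d) := by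
  rw [h.contains_iff hi hd, Polygon.onHigh_iff.1 hl]
  refine and_congr_right fun _ => ?_
  have h0 := Polygon.lower_ne_upper (σ := x.2) hπ κ.other
  obtain ⟨u, hu⟩ := π.exists_lower x.2 κ.other
  rw [Polygon.onHigh_iff.1 hl, hu] at h0
  rw [hu]
  have h1 := hG.sing_pos κ i hi
  by_cases hb : G.IsLow κ d ↔ ¬ G.OnBeta W P x' π' (κ, i) d
  · rw [shifted_of_low hb, hd]
    simp only [hb, iff_true]
    rw [btw_iff (line_nonneg u) (line_lt u) (by unfold line; omega) (by unfold line; omega)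
      (line_nonneg i) (line_lt i)]
    unfold line at *
    omega
  · rw [shifted_of_high hb, hd]
    simp only [hb, iff_false]
    rw [btw_iff (line_nonneg u) (line_lt u) (by unfold line; omega) (by unfold line; omega)
      (line_nonneg i) (line_lt i)]
    unfold line at *
    omega

/-- If no edge of the polygon is on the circle, both halves of the circle are in range or neither
is, so that the choice of the arc does not matter. -/
theorem contains_iff_of_not (hG : G.IsSingularGrid) (hi : (κ, i) ∈ G.sing)
    (h : AgreeOff (κ, i) x π x' π') (hl : ¬ π.OnLow x.2 (κ, i)) (hh : ¬ π.OnHigh x.2 (κ, i))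
    (d : Deco n) : G.Contains W P x' π' d ↔ G.Contains W P x π d := by
  by_cases hd : G.coord κ d = line i
  swap
  · exact h.contains_iff_of_ne hd
  have h0 : AgreeOff (κ, i) x π x π := ⟨rfl, rfl, rfl, fun _ _ => Iff.rfl, fun _ _ => Iff.rfl⟩
  rw [h.contains_iff hi hd, h0.contains_iff hi hd]
  refine and_congr_right fun _ => ?_
  rw [Polygon.onLow_iff] at hl
  rw [Polygon.onHigh_iff] at hh
  obtain ⟨l, hl'⟩ := π.exists_lower x.2 κ.other
  obtain ⟨u, hu'⟩ := π.exists_upper x.2 κ.other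
  rw [hl'] at hl
  rw [hu'] at hh
  rw [hl', hu']
  have h1 := hG.sing_pos κ i hi
  have h2 : Btw n (line l) (line i - 1) (line u) ↔ Btw n (line l) (line i + 1) (line u) := by
    rw [btw_iff (line_nonneg l) (line_lt l) (by unfold line; omega) (by unfold line; omega)
        (line_nonneg u) (line_lt u),
      btw_iff (line_nonneg l) (line_lt l) (by unfold line; omega) (by unfold line; omega)
        (line_nonneg u) (line_lt u)]
    unfold line at *
    omega
  rcases shifted_eq_or (G := G) κ d (G.OnBeta W P x' π' (κ, i) d) with e1 | e1 <;>
    rcases shifted_eq_or (G := G) κ d (G.OnBeta W P x π (κ, i) d) with e2 | e2 <;>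
    rw [e1, e2, hd] <;> simp [h2]

end AgreeOff

/-! ### The exchange of arcs, decoration by decoration -/

/-- The peak of the circle `r` is on the edges of `π` parallel to it. -/
def PeakInRange (W : Dir → Deco n → Fin n) (P : Circ n → Deco n) (x : G.Gen) (π : Polygon n)
    (r : Circ n) : Prop :=
  Btw n (π.lower x.2 r.1) (strip (W r.1 (P r))) (π.upper x.2 r.1)

/-- Along an edge of the polygon on the circle, the part between the peak and the dot is changed by
the range of the polygon: if the edge avoids the peak, the part for one of its ends is that for the
other end enlarged by the range; if it passes the peak, the range and one of these parts cover the
circle and meet in the other part, which consists of the decorations in range that are after the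
peak. -/
theorem IsPolygon.btw_peak (hG : G.IsSingularGrid) {x y : G.Gen} {π : Polygon n}
    (h : G.IsPolygon W P x y π) {κ : Dir} {i : Fin n} {d : Deco n} (hd : G.coord κ d = line i) :
    (π.OnLow x.2 (κ, i) →
      (¬ PeakInRange W P x π (κ, i) →
        (BeforeDot W P y (κ, i) d ↔ BeforeDot W P x (κ, i) d ∨ InRange W P x π κ d) ∧
        ¬ (BeforeDot W P x (κ, i) d ∧ InRange W P x π κ d)) ∧
      (PeakInRange W P x π (κ, i) →
        (BeforeDot W P y (κ, i) d ↔ BeforeDot W P x (κ, i) d ∧ InRange W P x π κ d) ∧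
        (BeforeDot W P x (κ, i) d ∨ InRange W P x π κ d) ∧
        (InRange W P x π κ d →
          (G.AfterPeak W P x π (κ, i) d ↔ BeforeDot W P y (κ, i) d)))) ∧
    (π.OnHigh x.2 (κ, i) →
      (¬ PeakInRange W P x π (κ, i) →
        (BeforeDot W P x (κ, i) d ↔ BeforeDot W P y (κ, i) d ∨ InRange W P x π κ d) ∧
        ¬ (BeforeDot W P y (κ, i) d ∧ InRange W P x π κ d)) ∧
      (PeakInRange W P x π (κ, i) →
        (BeforeDot W P x (κ, i) d ↔ BeforeDot W P y (κ, i) d ∧ InRange W P x π κ d) ∧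
        (BeforeDot W P y (κ, i) d ∨ InRange W P x π κ d) ∧
        (InRange W P x π κ d →
          (G.AfterPeak W P x π (κ, i) d ↔ BeforeDot W P x (κ, i) d)))) := by
  have b1 := hG.coord_bounds κ.other d
  have hη' : ∃ η, G.finePeak W P (κ, i) d = 4 * strip (W κ (P (κ, i))) + η ∧
      ((G.coord κ.other d = strip (W κ (P (κ, i))) ∧ d = P (κ, i)) ∧ η = 1 ∨
      ¬ (G.coord κ.other d = strip (W κ (P (κ, i))) ∧ d = P (κ, i)) ∧ η = -1) := by
    unfold finePeak
    by_cases hp : G.coord κ.other d = strip (W κ (P (κ, i))) ∧ d = P (κ, i)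
    · exact ⟨1, by rw [if_pos hp], Or.inl ⟨hp, rfl⟩⟩
    · exact ⟨-1, by rw [if_neg hp], Or.inr ⟨hp, rfl⟩⟩
  obtain ⟨η, hf, hη⟩ := hη'
  have hne := Polygon.lower_ne_upper (σ := x.2) h.ne κ
  have hx := hG.resolve_sub_cases x.1.1 κ.other d
  have hy := hG.resolve_sub_cases y.1.1 κ.other d
  have hs := hG.seen_cases (W := W) (P := P) x π κ.other d
  unfold BeforeDot PeakInRange InRange AfterPeak finePos
  simp only [hf]
  constructor
  · intro hl
    obtain ⟨e1, e2⟩ := hl.dotPlace_eq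
    rw [← h.target_perm] at e2
    rw [e1, e2] at hne
    rw [e1, e2]
    refine btw_peak_iff (even_line _) (even_line _) (line_nonneg _) (line_lt _) (line_nonneg _)
      (line_lt _) hne b1.1 b1.2 (odd_strip _) (strip_nonneg _) (strip_lt _) hs hx hy ?_ ?_ hη
    · intro h'
      rw [h.seen_start hG (Or.inl hl) hd h']; ring
    · intro h'
      rw [h.seen_end hG (Or.inl hl) hd h']; ring
  · intro hl
    obtain ⟨e1, e2⟩ := hl.dotPlace_eq
    rw [← h.target_perm] at e2
    rw [e1, e2] at hne
    rw [e1, e2]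
    refine btw_peak_iff (even_line _) (even_line _) (line_nonneg _) (line_lt _) (line_nonneg _)
      (line_lt _) hne b1.1 b1.2 (odd_strip _) (strip_nonneg _) (strip_lt _) hs hy hx ?_ ?_ hη
    · intro h'
      rw [h.seen_end hG (Or.inr hl) hd h']; ring
    · intro h'
      rw [h.seen_start hG (Or.inr hl) hd h']; ring

end Grid

namespace Polygon

variable {π : Polygon n} {σ : Equiv.Perm (Fin n)} {κ : Dir} {i : Fin n}

theorem onLow_of_dotPlace (h : π.OnLow σ (κ.other, dotPlace σ (κ, i))) : π.OnLow σ (κ, i) := by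
  rw [onLow_iff] at h ⊢
  cases κ
  · simpa [lower, Dir.other, dotPlace, line_injective.eq_iff] using h
  · have := line_injective (h : line π.west = line (σ.symm i))
    simp [lower, Dir.other, this, dotPlace]

theorem onHigh_of_dotPlace (h : π.OnHigh σ (κ.other, dotPlace σ (κ, i))) : π.OnHigh σ (κ, i) := by
  rw [onHigh_iff] at h ⊢
  cases κ
  · simpa [upper, Dir.other, dotPlace, line_injective.eq_iff] using h
  · have := line_injective (h : line π.east = line (σ.symm i))
    simp [upper, Dir.other, this, dotPlace]

end Polygon

namespace Grid

variable {G : Grid n} {W : Dir → Deco n → Fin n} {P : Circ n → Deco n}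
  {C : Circ n → Compass}

/-! ### The exchange of arcs for a whole polygon -/

/-- Two pairs of sets of indices have the same sum, as multisets. -/
def Balanced (p q p' q' : Fin n → Prop) : Prop :=
  ∀ k, (p k ∧ q k ↔ p' k ∧ q' k) ∧ (p k ∨ q k ↔ p' k ∨ q' k)

/-- The decorations of kind `t` of the circle `r` which are on the low side in the
`0`-resolution. -/
def LowAt (G : Grid n) (t : Kind) (r : Circ n) (k : Fin n) : Prop :=
  G.coord r.1 (t, k) = line r.2 ∧ G.IsLow r.1 (t, k)

/-- The decorations of kind `t` of the circle `r` which are on the high side in the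
`0`-resolution. -/
def HighAt (G : Grid n) (t : Kind) (r : Circ n) (k : Fin n) : Prop :=
  G.coord r.1 (t, k) = line r.2 ∧ ¬ G.IsLow r.1 (t, k)

/-- The decorations of kind `t` of the circle `r` that make up the gauge factor of the generator
`x`: the low ones between the peak and the dot, and the high ones between the dot and the peak. -/
def GaugeAt (W : Dir → Deco n → Fin n) (P : Circ n → Deco n) (x : G.Gen) (t : Kind) (r : Circ n)
    (k : Fin n) : Prop :=
  G.coord r.1 (t, k) = line r.2 ∧ (G.IsLow r.1 (t, k) ↔ BeforeDot W P x r (t, k))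

/-- The decorations of kind `t` in a polygon. -/
def In (W : Dir → Deco n → Fin n) (P : Circ n → Deco n) (x : G.Gen) (π : Polygon n) (t : Kind)
    (k : Fin n) : Prop :=
  G.Contains W P x π (t, k)

/-- A polygon `π` from `x` to `y` away from the peak of `r`, along the arc `α` of `r`; the
generator `x'` is obtained from `x` by moving its dot to the arc `β`, and `π'` from `π`
by adding the peak of `r`. -/
structure Exchange (W : Dir → Deco n → Fin n) (P : Circ n → Deco n) (r : Circ n)
    (x y x' : G.Gen) (π π' : Polygon n) : Prop where
  mem_sing : r ∈ G.sing
  poly : G.IsPolygon W P x y π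
  not_mem : r ∉ x.1.1
  not_mem_peaks : r ∉ π.peaks
  perm : x'.2 = x.2
  insert_eq : x'.1.1 = insert r x.1.1
  west : π'.west = π.west
  east : π'.east = π.east
  peaks_eq : π'.peaks = insert r π.peaks

/-- If no edge of the polygon is on the circle, its dot does not move. A peak of the polygon on a
transverse circle may change the resolution of this circle, hence the position of a decoration in a
crossing, but not across the dot. -/
theorem IsPolygon.beforeDot_iff (hG : G.IsSingularGrid) {x y : G.Gen} {π : Polygon n}
    (h : G.IsPolygon W P x y π) {r : Circ n} (hl : ¬ π.OnLow x.2 r) (hh : ¬ π.OnHigh x.2 r)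
    (d : Deco n) : BeforeDot W P y r d ↔ BeforeDot W P x r d := by
  obtain ⟨κ, i⟩ := r
  unfold BeforeDot finePos
  rw [h.target_perm, Polygon.dotPlace_eq_of_not hl hh]
  have hw : ∃ η, G.finePeak W P (κ, i) d = 4 * strip (W κ (P (κ, i))) + η ∧ (η = 1 ∨ η = -1) := by
    unfold finePeak
    split_ifs
    · exact ⟨1, rfl, Or.inl rfl⟩
    · exact ⟨-1, rfl, Or.inr rfl⟩
  obtain ⟨η, hw, hη⟩ := hw
  simp only [hw]
  have hx := hG.resolve_sub_cases x.1.1 κ.other d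
  have hy := hG.resolve_sub_cases y.1.1 κ.other d
  have b1 := hG.coord_bounds κ.other d
  have e : G.coord κ.other d = line (dotPlace x.2 (κ, i)) →
      (G.resolve G.sing y.1.1).coord κ.other d = (G.resolve G.sing x.1.1).coord κ.other d := by
    intro hd
    obtain ⟨j, hj, hdj⟩ := hG.coord_even (hd ▸ even_line _)
    rw [resolve_coord_of_mem hdj hj, resolve_coord_of_mem hdj hj]
    refine shifted_congr ?_
    rw [h.mem_target]
    simp only [or_iff_left_iff_imp]
    intro hp
    exfalso
    have hij := line_injective (hdj.symm.trans hd)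
    subst hij
    rcases Polygon.exists_side_iff.1 (h.peak_side _ hp) with h1 | h1
    · exact hl (Polygon.onLow_of_dotPlace h1)
    · exact hh (Polygon.onHigh_of_dotPlace h1)
  generalize dotPlace x.2 (κ, i) = j at *
  have b2 := line_lt j
  have b3 := line_nonneg j
  have b4 := strip_lt (W κ (P (κ, i)))
  have b5 := strip_nonneg (W κ (P (κ, i)))
  have b6 := even_line j
  rw [Int.even_iff] at b6 hx hy
  rw [Int.odd_iff] at hx hy
  have b7 := odd_strip (W κ (P (κ, i)))
  rw [Int.odd_iff] at b7
  generalize (G.resolve G.sing y.1.1).coord κ.other d = cy at *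
  generalize (G.resolve G.sing x.1.1).coord κ.other d = cx at *
  generalize G.coord κ.other d = c at *
  generalize strip (W κ (P (κ, i))) = w at *
  generalize line j = l at *
  clear hw
  by_cases hc : cx = cy
  · rw [hc]
  have hcl : c ≠ l := fun h => hc (e h).symm
  clear e
  rw [btw_iff (n := 4 * n) (by omega) (by push_cast; omega) (by omega) (by push_cast; omega)
      (by omega) (by push_cast; omega),
    btw_iff (n := 4 * n) (by omega) (by push_cast; omega) (by omega) (by push_cast; omega)
      (by omega) (by push_cast; omega)]
  have e1 : 4 * w + η < 4 * c + (cx - c) ↔ 4 * w + η < 4 * c + (cy - c) := by omega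
  have e2 : 4 * c + (cx - c) < 4 * l ↔ 4 * c + (cy - c) < 4 * l := by omega
  rw [e1, e2]

namespace Exchange

theorem balanced_aux_of_not {L X Y Z : Prop} (h : (Y ↔ X ∨ Z) ∧ ¬ (X ∧ Z)) :
    (((L ↔ X) ∧ Z ∧ L ↔ (L ↔ Y) ∧ Z ∧ ¬ L) ∧ ((L ↔ X) ∨ Z ∧ L ↔ (L ↔ Y) ∨ Z ∧ ¬ L)) := by
  by_cases L <;> by_cases X <;> by_cases Y <;> by_cases Z <;> simp_all

theorem balanced_aux_low {L X Y Z A : Prop} (h : (Y ↔ X ∧ Z) ∧ (X ∨ Z) ∧ (Z → (A ↔ Y))) :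
    (((L ↔ X) ∧ Z ∧ L ↔ L ∧ Z ∧ ¬ (L ↔ ¬ A)) ∧ ((L ↔ X) ∨ Z ∧ L ↔ L ∨ Z ∧ ¬ (L ↔ ¬ A))) ∧
      (((L ↔ Y) ∧ Z ∧ ¬ L ↔ ¬ L ∧ Z ∧ ¬ (L ↔ ¬ A)) ∧
        ((L ↔ Y) ∨ Z ∧ ¬ L ↔ ¬ L ∨ Z ∧ ¬ (L ↔ ¬ A))) := by
  by_cases L <;> by_cases X <;> by_cases Y <;> by_cases Z <;> by_cases A <;> simp_all

variable {r : Circ n} {x y x' : G.Gen} {π π' : Polygon n}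

theorem balanced_aux_high {L X Y Z A : Prop} (h : (X ↔ Y ∧ Z) ∧ (Y ∨ Z) ∧ (Z → (A ↔ X))) :
    (((L ↔ X) ∧ Z ∧ ¬ L ↔ ¬ L ∧ Z ∧ (L ↔ A)) ∧ ((L ↔ X) ∨ Z ∧ ¬ L ↔ ¬ L ∨ Z ∧ (L ↔ A))) ∧
      (((L ↔ Y) ∧ Z ∧ L ↔ L ∧ Z ∧ (L ↔ A)) ∧ ((L ↔ Y) ∨ Z ∧ L ↔ L ∨ Z ∧ (L ↔ A))) := by
  by_cases L <;> by_cases X <;> by_cases Y <;> by_cases Z <;> by_cases A <;> simp_all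

theorem agree_beta (h : Exchange W P r x y x' π π') : AgreeOff r x π x' π :=
  ⟨h.perm, rfl, rfl, fun s hs => by rw [h.insert_eq]; simp [hs], fun _ _ => Iff.rfl⟩

theorem agree_peak (h : Exchange W P r x y x' π π') : AgreeOff r x π x π' :=
  ⟨rfl, h.west, h.east, fun _ _ => Iff.rfl, fun s hs => by rw [h.peaks_eq]; simp [hs]⟩

theorem agree_refl (r : Circ n) (x : G.Gen) (π : Polygon n) : AgreeOff r x π x π :=
  ⟨rfl, rfl, rfl, fun _ _ => Iff.rfl, fun _ _ => Iff.rfl⟩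

theorem onBeta_alpha (h : Exchange W P r x y x' π π') (d : Deco n) :
    ¬ G.OnBeta W P x π r d := by
  rw [onBeta_iff]; simp [h.not_mem, h.not_mem_peaks]

theorem onBeta_beta (h : Exchange W P r x y x' π π') (d : Deco n) :
    G.OnBeta W P x' π r d := by
  rw [onBeta_iff]; simp [h.insert_eq, h.not_mem_peaks]

theorem onBeta_low (h : Exchange W P r x y x' π π') (hl : π.OnLow x.2 r) (d : Deco n) :
    G.OnBeta W P x π' r d ↔ G.AfterPeak W P x π r d := by
  rw [onBeta_iff, h.agree_peak.onLow_iff, h.agree_peak.onHigh_iff, h.agree_peak.afterPeak_iff]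
  simp [h.peaks_eq, hl, hl.not_onHigh h.poly.ne]

theorem onBeta_high (h : Exchange W P r x y x' π π') (hl : π.OnHigh x.2 r) (d : Deco n) :
    G.OnBeta W P x π' r d ↔ ¬ G.AfterPeak W P x π r d := by
  have h0 : ¬ π.OnLow x.2 r := fun h' => h'.not_onHigh h.poly.ne hl
  rw [onBeta_iff, h.agree_peak.onLow_iff, h.agree_peak.onHigh_iff, h.agree_peak.afterPeak_iff]
  simp [h.peaks_eq, hl, h0]

/-- When the polygon has no edge on `r` or the peak is not on it, passing from `α` to `β`
multiplies the contents by the quotient of the gauge factors of the ends. -/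
theorem balanced_of_not (hG : G.IsSingularGrid) (h : Exchange W P r x y x' π π') (t : Kind)
    (hr : (π.OnLow x.2 r ∨ π.OnHigh x.2 r) → ¬ PeakInRange W P x π r) :
    Balanced (GaugeAt W P x t r) (In W P x' π t) (GaugeAt W P y t r) (In W P x π t) := by
  obtain ⟨κ, i⟩ := r
  intro k
  unfold In GaugeAt
  by_cases hd : G.coord κ (t, k) = line i
  swap
  · rw [h.agree_beta.contains_iff_of_ne hd]
    simp [hd]
  simp only [hd, true_and]
  have hb := h.poly.btw_peak hG hd
  by_cases hl : π.OnLow x.2 (κ, i)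
  · rw [h.agree_beta.contains_iff_of_onLow hG h.mem_sing h.poly.ne hl hd,
      (agree_refl _ x π).contains_iff_of_onLow hG h.mem_sing h.poly.ne hl hd]
    have h1 := (hb.1 hl).1 (hr (Or.inl hl))
    simp only [h.onBeta_alpha (t, k), h.onBeta_beta (t, k), not_true_eq_false, not_false_eq_true,
      iff_true, iff_false, not_not]
    exact balanced_aux_of_not h1
  by_cases hh : π.OnHigh x.2 (κ, i)
  · rw [h.agree_beta.contains_iff_of_onHigh hG h.mem_sing h.poly.ne hh hd,
      (agree_refl _ x π).contains_iff_of_onHigh hG h.mem_sing h.poly.ne hh hd]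
    have h1 := (hb.2 hh).1 (hr (Or.inr hh))
    simp only [h.onBeta_alpha (t, k), h.onBeta_beta (t, k), not_true_eq_false, not_false_eq_true,
      iff_true, iff_false]
    have h2 := balanced_aux_of_not (L := G.IsLow κ (t, k)) h1
    exact ⟨h2.1.symm, h2.2.symm⟩
  · rw [h.agree_beta.contains_iff_of_not hG h.mem_sing hl hh]
    rw [h.poly.beforeDot_iff hG hl hh]
    simp

theorem balanced_low (hG : G.IsSingularGrid) (h : Exchange W P r x y x' π π') (t : Kind)
    (hl : π.OnLow x.2 r) (hr : PeakInRange W P x π r) :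
    Balanced (GaugeAt W P x t r) (In W P x' π t) (G.LowAt t r) (In W P x π' t) ∧
      Balanced (GaugeAt W P y t r) (In W P x π t) (G.HighAt t r) (In W P x π' t) := by
  obtain ⟨κ, i⟩ := r
  unfold Balanced In GaugeAt LowAt HighAt
  rw [← forall_and]
  intro k
  by_cases hd : G.coord κ (t, k) = line i
  swap
  · rw [h.agree_beta.contains_iff_of_ne hd, h.agree_peak.contains_iff_of_ne hd]
    simp [hd]
  simp only [hd, true_and]
  rw [h.agree_beta.contains_iff_of_onLow hG h.mem_sing h.poly.ne hl hd,
    h.agree_peak.contains_iff_of_onLow hG h.mem_sing h.poly.ne hl hd,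
    (agree_refl _ x π).contains_iff_of_onLow hG h.mem_sing h.poly.ne hl hd]
  have h1 := ((h.poly.btw_peak hG hd).1 hl).2 hr
  simp only [h.onBeta_alpha (t, k), h.onBeta_beta (t, k), h.onBeta_low hl (t, k),
    not_true_eq_false, not_false_eq_true, iff_true, iff_false, not_not]
  exact balanced_aux_low h1

theorem balanced_high (hG : G.IsSingularGrid) (h : Exchange W P r x y x' π π') (t : Kind)
    (hl : π.OnHigh x.2 r) (hr : PeakInRange W P x π r) :
    Balanced (GaugeAt W P x t r) (In W P x' π t) (G.HighAt t r) (In W P x π' t) ∧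
      Balanced (GaugeAt W P y t r) (In W P x π t) (G.LowAt t r) (In W P x π' t) := by
  obtain ⟨κ, i⟩ := r
  unfold Balanced In GaugeAt LowAt HighAt
  rw [← forall_and]
  intro k
  by_cases hd : G.coord κ (t, k) = line i
  swap
  · rw [h.agree_beta.contains_iff_of_ne hd, h.agree_peak.contains_iff_of_ne hd]
    simp [hd]
  simp only [hd, true_and]
  rw [h.agree_beta.contains_iff_of_onHigh hG h.mem_sing h.poly.ne hl hd,
    h.agree_peak.contains_iff_of_onHigh hG h.mem_sing h.poly.ne hl hd,
    (agree_refl _ x π).contains_iff_of_onHigh hG h.mem_sing h.poly.ne hl hd]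
  have h1 := ((h.poly.btw_peak hG hd).2 hl).2 hr
  simp only [h.onBeta_alpha (t, k), h.onBeta_beta (t, k), h.onBeta_high hl (t, k),
    not_true_eq_false, not_false_eq_true, iff_true, iff_false, not_not]
  exact balanced_aux_high h1

end Exchange

end Grid

namespace Grid

variable {G : Grid n} {W : Dir → Deco n → Fin n} {P : Circ n → Deco n}
  {C : Circ n → Compass}

/-! ### The gauge transformation from the `0`-resolution to the `1`-resolution -/

open Classical in
/-- The product of the variables whose index satisfies `p`. -/
noncomputable def mon (p : Fin n → Prop) : GroundRing n :=
  ∏ k ∈ Finset.univ.filter p, MvPolynomial.X k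

theorem Balanced.mon_mul_mon {p q p' q' : Fin n → Prop} (h : Balanced p q p' q') :
    mon p * mon q = mon p' * mon q' := by
  classical
  unfold mon
  simp only [Finset.prod_filter]
  rw [← Finset.prod_mul_distrib, ← Finset.prod_mul_distrib]
  refine Finset.prod_congr rfl fun k _ => ?_
  have := h k
  by_cases h1 : p k <;> by_cases h2 : q k <;> by_cases h3 : p' k <;> by_cases h4 : q' k <;>
    simp_all

theorem weight_eq (ε : Equiv.Perm (Fin n) → Fin n → Fin n → ℤˣ) (x : G.Gen) (π : Polygon n) :
    G.weight ε W P C x π =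
      MvPolynomial.C ((-1) ^ G.mu C x π * ((ε x.2 π.west π.east : ℤˣ) : ℤ)) *
        mon (In W P x π .O) := by
  unfold weight mon In
  congr

/-- The sign of the change of basis attached to the peak of `r`: it is negative if the compass
convention picks the west or the south edge. -/
def compassSign (C : Circ n → Compass) (r : Circ n) : ℤ :=
  if C r = .west ∨ C r = .south then -1 else 1

theorem compassSign_mul_self (C : Circ n → Compass) (r : Circ n) :
    compassSign C r * compassSign C r = 1 := by
  unfold compassSign; split_ifs <;> rfl

namespace Exchange

variable {r : Circ n} {x y x' : G.Gen} {π π' : Polygon n}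

theorem mu_beta (h : Exchange W P r x y x' π π') (C : Circ n → Compass) :
    G.mu C x' π = G.mu C x π := by
  unfold mu; rw [h.perm]

theorem side_eq (h : Exchange W P r x y x' π π') (c : Compass) :
    π'.side x.2 c = π.side x.2 c := by
  cases c <;> simp [Polygon.side, h.west, h.east]

theorem mu_peak (h : Exchange W P r x y x' π π') (C : Circ n → Compass) :
    (π.side x.2 (C r) = r → G.mu C x π' = G.mu C x π + 1) ∧
      (π.side x.2 (C r) ≠ r → G.mu C x π' = G.mu C x π) := by
  unfold mu
  simp only [h.side_eq, h.peaks_eq, Finset.filter_insert]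
  constructor
  · intro hs
    rw [if_pos hs, Finset.card_insert_of_notMem]
    simp [h.not_mem_peaks]
  · intro hs
    rw [if_neg hs]

theorem side_compass_low (h : Exchange W P r x y x' π π') (hC : G.IsCompass C)
    (hl : π.OnLow x.2 r) : π.side x.2 (C r) = r ↔ C r = .west ∨ C r = .south := by
  have hh := hl.not_onHigh h.poly.ne
  obtain ⟨κ, i⟩ := r
  unfold Polygon.OnLow at hl
  unfold Polygon.OnHigh at hh
  cases κ
  · rcases (hC i).2 h.mem_sing with hc | hc <;> rw [hc] <;> simp_all [Polygon.side]
  · rcases (hC i).1 h.mem_sing with hc | hc <;> rw [hc] <;> simp_all [Polygon.side]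

theorem side_compass_high (h : Exchange W P r x y x' π π') (hC : G.IsCompass C)
    (hh : π.OnHigh x.2 r) : π.side x.2 (C r) = r ↔ ¬ (C r = .west ∨ C r = .south) := by
  have hl : ¬ π.OnLow x.2 r := fun h' => h'.not_onHigh h.poly.ne hh
  obtain ⟨κ, i⟩ := r
  unfold Polygon.OnLow at hl
  unfold Polygon.OnHigh at hh
  cases κ
  · rcases (hC i).2 h.mem_sing with hc | hc <;> rw [hc] <;> simp_all [Polygon.side]
  · rcases (hC i).1 h.mem_sing with hc | hc <;> rw [hc] <;> simp_all [Polygon.side]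

theorem neg_one_pow_low (h : Exchange W P r x y x' π π') (hC : G.IsCompass C)
    (hl : π.OnLow x.2 r) :
    (-1 : ℤ) ^ G.mu C x π = compassSign C r * (-1) ^ G.mu C x π' := by
  have h1 := h.side_compass_low hC hl
  unfold compassSign
  by_cases hs : π.side x.2 (C r) = r
  · rw [if_pos (h1.1 hs), (h.mu_peak C).1 hs]; ring
  · rw [if_neg (h1.not.1 hs), (h.mu_peak C).2 hs]; ring

theorem neg_one_pow_high (h : Exchange W P r x y x' π π') (hC : G.IsCompass C)
    (hl : π.OnHigh x.2 r) :
    (-1 : ℤ) ^ G.mu C x π = -(compassSign C r * (-1) ^ G.mu C x π') := by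
  have h1 := h.side_compass_high hC hl
  unfold compassSign
  by_cases hs : π.side x.2 (C r) = r
  · rw [if_neg (h1.1 hs), (h.mu_peak C).1 hs]; ring
  · rw [if_pos (not_not.1 (h1.not.1 hs)), (h.mu_peak C).2 hs]; ring

variable {ε : Equiv.Perm (Fin n) → Fin n → Fin n → ℤˣ}

theorem weight_of_not (hG : G.IsSingularGrid) (h : Exchange W P r x y x' π π')
    (hr : (π.OnLow x.2 r ∨ π.OnHigh x.2 r) → ¬ PeakInRange W P x π r) :
    mon (GaugeAt W P x .O r) * G.weight ε W P C x' π =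
      mon (GaugeAt W P y .O r) * G.weight ε W P C x π := by
  rw [weight_eq, weight_eq, h.mu_beta, h.perm, mul_left_comm, mul_left_comm (mon _),
    (h.balanced_of_not hG .O hr).mon_mul_mon]

theorem weight_peak (hG : G.IsSingularGrid) (hC : G.IsCompass C)
    (h : Exchange W P r x y x' π π')
    (hl : π.OnLow x.2 r ∨ π.OnHigh x.2 r) (hr : PeakInRange W P x π r) :
    mon (GaugeAt W P x .O r) * G.weight ε W P C x' π -
        mon (GaugeAt W P y .O r) * G.weight ε W P C x π =
      (MvPolynomial.C (compassSign C r) * (mon (G.LowAt .O r) - mon (G.HighAt .O r))) *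
        G.weight ε W P C x π' := by
  rw [weight_eq, weight_eq, weight_eq, h.mu_beta, h.perm, mul_left_comm, mul_left_comm (mon _),
    h.west, h.east]
  rcases hl with hl | hl
  · obtain ⟨h1, h2⟩ := h.balanced_low hG .O hl hr
    rw [h1.mon_mul_mon, h2.mon_mul_mon, h.neg_one_pow_low hC hl, mul_assoc, map_mul]
    ring
  · obtain ⟨h1, h2⟩ := h.balanced_high hG .O hl hr
    rw [h1.mon_mul_mon, h2.mon_mul_mon, h.neg_one_pow_high hC hl, neg_mul, mul_assoc, map_neg,
      map_mul]
    ring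

end Exchange

theorem IsSingularGrid.mon_lowAt_ne (hG : G.IsSingularGrid) {r : Circ n} (hr : r ∈ G.sing) :
    mon (G.LowAt .O r) ≠ mon (G.HighAt .O r) := by
  classical
  obtain ⟨κ, i⟩ := r
  obtain ⟨k, l, -, -, hl, -, hl', -⟩ := hG.exists_pair hr .O
  intro h
  have h1 := congrArg (MvPolynomial.eval fun j => if G.LowAt .O (κ, i) j then (0 : ℤ) else 1) h
  unfold mon at h1
  simp only [map_prod, MvPolynomial.eval_X] at h1
  have hmem : l ∈ Finset.univ.filter (G.LowAt .O (κ, i)) := by simpa using ⟨hl, hl'⟩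
  have h2 : (∏ j with G.LowAt .O (κ, i) j, if G.LowAt .O (κ, i) j then (0 : ℤ) else 1) = 0 :=
    Finset.prod_eq_zero hmem (if_pos (show G.LowAt .O (κ, i) l from ⟨hl, hl'⟩))
  rw [h2, Finset.prod_eq_one] at h1
  · exact zero_ne_one h1
  · intro j hj
    simp only [Finset.mem_filter, Finset.mem_univ, true_and] at hj
    exact if_neg fun h' => hj.2 h'.2

/-! ### The anticommutation relation -/

/-- A generator of the module of `G_+` seen as a generator of the module of `G_-`. -/
def toNeg (r : Circ n) (x : (G.pos r).Gen) : (G.neg r).Gen := ⟨⟨x.1.1, x.1.2⟩, x.2⟩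

theorem isPolygon_toNeg {r : Circ n} {x y : (G.pos r).Gen} {π : Polygon n} :
    (G.neg r).IsPolygon W P (toNeg r x) (toNeg r y) π ↔ (G.pos r).IsPolygon W P x y π :=
  ⟨fun ⟨h1, h2, h3, h4, h5, h6, h7, h8⟩ => ⟨h1, h2, h3, h4, h5, h6, h7, h8⟩,
    fun ⟨h1, h2, h3, h4, h5, h6, h7, h8⟩ => ⟨h1, h2, h3, h4, h5, h6, h7, h8⟩⟩

theorem not_mem_pos {r : Circ n} (x : (G.pos r).Gen) : r ∉ x.1.1 :=
  fun h => (mem_resolve_sing.1 (x.1.2 h)).2 rfl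

/-- Adding the peak of `r` to a polygon of `G_+`. -/
def addPeak (r : Circ n) (π : Polygon n) : Polygon n := ⟨π.west, π.east, insert r π.peaks⟩

/-- The polygons with a peak at the peak of `r` are those of `G_+` that have an edge on `r` through
this peak. -/
theorem isPolygon_addPeak {r : Circ n} (hr : r ∈ G.sing) {x y : (G.pos r).Gen} {π : Polygon n}
    (hπ : r ∉ π.peaks) :
    G.IsPolygon W P (G.inclPos r x) (G.inclNeg hr (toNeg r y)) (addPeak r π) ↔
      G.IsPolygon W P (G.inclPos r x) (G.inclPos r y) π ∧
        (π.OnLow x.2 r ∨ π.OnHigh x.2 r) ∧ PeakInRange W P (G.inclPos r x) π r := by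
  have hx : r ∉ x.1.1 := not_mem_pos x
  have hy : r ∉ y.1.1 := not_mem_pos y
  have hside : ∀ c, (addPeak r π).side x.2 c = π.side x.2 c := by intro c; cases c <;> rfl
  have hlow : ∀ κ, (addPeak r π).lower x.2 κ = π.lower x.2 κ := by intro κ; cases κ <;> rfl
  have hupp : ∀ κ, (addPeak r π).upper x.2 κ = π.upper x.2 κ := by intro κ; cases κ <;> rfl
  have hres : insert r y.1.1 = x.1.1 ∪ insert r π.peaks ↔ y.1.1 = x.1.1 ∪ π.peaks := by
    rw [Finset.union_insert]
    constructor
    · intro h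
      have := congrArg (Finset.erase · r) h
      simpa [Finset.erase_insert, hx, hy, hπ] using this
    · rintro h; rw [h]
  constructor
  · rintro ⟨h1, h2, h3, h4, h5, h6, h7, h8⟩
    have hm : r ∈ (addPeak r π).peaks := Finset.mem_insert_self _ _
    have hsub : π.peaks ⊆ (addPeak r π).peaks := Finset.subset_insert _ _
    refine ⟨⟨h1, h2, hsub.trans h3, ?_, fun s hs => h5 s (hsub hs), ?_, hres.1 h7, h8⟩, ?_, ?_⟩
    · intro s hs
      obtain ⟨c, hc⟩ := h4 s (hsub hs)
      exact ⟨c, (hside c).symm.trans hc⟩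
    · intro s hs
      have := h6 s (hsub hs)
      simp only [inclPos, hlow, hupp] at this
      exact this
    · obtain ⟨c, hc⟩ := h4 r hm
      exact Polygon.exists_side_iff.1 ⟨c, (hside c).symm.trans hc⟩
    · have := h6 r hm
      simp only [inclPos, hlow, hupp] at this
      exact this
  · rintro ⟨⟨h1, h2, h3, h4, h5, h6, h7, h8⟩, h9, h10⟩
    refine ⟨h1, h2, ?_, ?_, ?_, ?_, hres.2 h7, h8⟩
    · exact Finset.insert_subset hr h3
    · intro s hs
      rcases Finset.mem_insert.1 hs with rfl | hs
      · obtain ⟨c, hc⟩ := Polygon.exists_side_iff.2 h9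
        exact ⟨c, (hside c).trans hc⟩
      · obtain ⟨c, hc⟩ := h4 s hs
        exact ⟨c, (hside c).trans hc⟩
    · intro s hs
      rcases Finset.mem_insert.1 hs with rfl | hs
      · exact hx
      · exact h5 s hs
    · intro s hs
      simp only [inclPos, hlow, hupp]
      rcases Finset.mem_insert.1 hs with rfl | hs
      · exact h10
      · exact h6 s hs

theorem exchange_of_isPolygon {r : Circ n} (hr : r ∈ G.sing) {x y : (G.pos r).Gen} {π : Polygon n}
    (h : (G.pos r).IsPolygon W P x y π) :
    Exchange W P r (G.inclPos r x) (G.inclPos r y) (G.inclNeg hr (toNeg r x)) π (addPeak r π) where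
  mem_sing := hr
  poly := ((isLift_inclPos r x).isPolygon_iff (isLift_inclPos r y) h.not_mem_peaks).1 h
  not_mem := not_mem_pos x
  not_mem_peaks := h.not_mem_peaks
  perm := rfl
  insert_eq := rfl
  west := rfl
  east := rfl
  peaks_eq := rfl

variable (W P) in
/-- The change of basis that compares the modules of `G_+` and `G_-`: it multiplies each generator
by its gauge factor. -/
noncomputable def gaugeMap (G : Grid n) (r : Circ n) :
    ((G.pos r).Gen →₀ GroundRing n) →ₗ[GroundRing n] ((G.neg r).Gen →₀ GroundRing n) :=
  Finsupp.linearCombination (GroundRing n) fun x : (G.pos r).Gen =>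
    Finsupp.single (toNeg r x) (mon (GaugeAt W P (G.inclPos r x) .O r))

theorem differential_single (ε : Equiv.Perm (Fin n) → Fin n → Fin n → ℤˣ) (x : G.Gen)
    (a : GroundRing n) : G.differential ε W P C (Finsupp.single x a) =
      ∑ y : G.Gen, ∑ π ∈ G.polygons W P x y, Finsupp.single y (a * G.weight ε W P C x π) := by
  simp [differential, Finsupp.linearCombination_single, Finset.smul_sum, Finsupp.smul_single]

theorem peakMap_single (ε : Equiv.Perm (Fin n) → Fin n → Fin n → ℤˣ) {r : Circ n}
    (hr : r ∈ G.sing) (x : (G.pos r).Gen)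
    (a : GroundRing n) : G.peakMap ε W P C hr (Finsupp.single x a) =
      ∑ y : (G.neg r).Gen,
        ∑ π ∈ (G.polygons W P (G.inclPos r x) (G.inclNeg hr y)).filter (fun π => r ∈ π.peaks),
          Finsupp.single y (a * G.weight ε W P C (G.inclPos r x) π) := by
  simp [peakMap, Finsupp.linearCombination_single, Finset.smul_sum, Finsupp.smul_single]

theorem mem_polygons {x y : G.Gen} {π : Polygon n} :
    π ∈ G.polygons W P x y ↔ G.IsPolygon W P x y π := by
  simp [polygons]

/-- The polygons with a peak at the peak of `r` measure the defect of the gauge transformation to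
be a chain map. -/
theorem IsEnhanced.gauge_relation (hG : G.IsEnhanced W P C) {r : Circ n} (hr : r ∈ G.sing)
    (ε : Equiv.Perm (Fin n) → Fin n → Fin n → ℤˣ) :
    (G.neg r).differential ε W P C ∘ₗ gaugeMap W P G r -
        gaugeMap W P G r ∘ₗ (G.pos r).differential ε W P C =
      (MvPolynomial.C (compassSign C r) * (mon (G.LowAt .O r) - mon (G.HighAt .O r))) •
        G.peakMap ε W P C hr := by
  classical
  refine Finsupp.lhom_ext' fun x => LinearMap.ext_ring ?_
  simp only [LinearMap.coe_comp, Function.comp_apply, Finsupp.lsingle_apply, LinearMap.sub_apply,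
    LinearMap.smul_apply]
  rw [differential_single, peakMap_single]
  have hΓ : ∀ (z : (G.pos r).Gen) (a : GroundRing n), gaugeMap W P G r (Finsupp.single z a) =
      Finsupp.single (toNeg r z) (a * mon (GaugeAt W P (G.inclPos r z) .O r)) := by
    intro z a
    simp [gaugeMap, Finsupp.linearCombination_single, Finsupp.smul_single]
  rw [hΓ, differential_single, map_sum, Finset.smul_sum]
  let e : (G.pos r).Gen ≃ (G.neg r).Gen :=
    ⟨toNeg r, fun y => ⟨⟨y.1.1, y.1.2⟩, y.2⟩, fun _ => rfl, fun _ => rfl⟩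
  rw [← e.sum_comp, ← e.sum_comp, ← Finset.sum_sub_distrib]
  refine Finset.sum_congr rfl fun y _ => ?_
  have he : e y = toNeg r y := rfl
  rw [he, map_sum]
  have hpol : (G.neg r).polygons W P (toNeg r x) (toNeg r y) = (G.pos r).polygons W P x y := by
    ext π
    rw [mem_polygons, mem_polygons, isPolygon_toNeg]
  rw [hpol, ← Finset.sum_sub_distrib, Finset.smul_sum]
  simp only [hΓ, one_mul, ← Finsupp.single_sub, Finsupp.smul_single, smul_eq_mul]
  -- A polygon of `G_+` contributes to the left-hand side if and only if it has an edge on `r` that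
  -- passes the peak; adding the peak turns it into a polygon counted by `f_p`.
  rw [← Finset.sum_filter_add_sum_filter_not _ (fun π : Polygon n =>
    (π.OnLow x.2 r ∨ π.OnHigh x.2 r) ∧ PeakInRange W P (G.inclPos r x) π r)]
  rw [Finset.sum_eq_zero (s := Finset.filter (fun π => ¬ _) _), add_zero]
  · refine Finset.sum_bij (fun π _ => addPeak r π) ?_ ?_ ?_ ?_
    · intro π hπ
      rw [Finset.mem_filter, mem_polygons] at hπ ⊢
      refine ⟨?_, Finset.mem_insert_self _ _⟩
      rw [isPolygon_addPeak hr hπ.1.not_mem_peaks]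
      exact ⟨(exchange_of_isPolygon hr hπ.1).poly, hπ.2⟩
    · intro π hπ π' hπ' h
      rw [Finset.mem_filter, mem_polygons] at hπ hπ'
      have h1 := hπ.1.not_mem_peaks
      have h2 := hπ'.1.not_mem_peaks
      obtain ⟨w, e, p⟩ := π
      obtain ⟨w', e', p'⟩ := π'
      simp only [addPeak, Polygon.mk.injEq] at h h1 h2 ⊢
      refine ⟨h.1, h.2.1, ?_⟩
      have := congrArg (Finset.erase · r) h.2.2
      simpa [Finset.erase_insert, h1, h2] using this
    · intro π hπ
      rw [Finset.mem_filter, mem_polygons] at hπ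
      have h1 : addPeak r ⟨π.west, π.east, π.peaks.erase r⟩ = π := by
        simp [addPeak, Finset.insert_erase hπ.2]
      have h2 : r ∉ (⟨π.west, π.east, π.peaks.erase r⟩ : Polygon n).peaks := by simp
      have h3 := hπ.1
      rw [← h1, isPolygon_addPeak hr h2] at h3
      refine ⟨⟨π.west, π.east, π.peaks.erase r⟩, ?_, h1⟩
      rw [Finset.mem_filter, mem_polygons]
      exact ⟨((isLift_inclPos r x).isPolygon_iff (isLift_inclPos r y) h2).2 h3.1, h3.2⟩
    · intro π hπ
      rw [Finset.mem_filter, mem_polygons] at hπ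
      have hex := exchange_of_isPolygon hr hπ.1
      have h1 := hex.weight_peak (ε := ε) hG.grid hG.compass hπ.2.1 hπ.2.2
      have h2 := (isLift_inclPos r x).weight_eq hG hr ε hex.not_mem_peaks
      have h3 := (isLift_inclNeg hr (toNeg r x)).weight_eq hG hr ε hex.not_mem_peaks
      rw [← h1, ← h2, ← h3, mul_comm (mon (GaugeAt W P (G.inclPos r y) Kind.O r))]
      rfl
  · intro π hπ
    rw [Finset.mem_filter, mem_polygons] at hπ
    have hex := exchange_of_isPolygon hr hπ.1
    have h1 := hex.weight_of_not (ε := ε) (C := C) hG.grid (fun h h' => hπ.2 ⟨h, h'⟩)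
    have h2 := (isLift_inclPos r x).weight_eq hG hr ε hex.not_mem_peaks
    have h3 := (isLift_inclNeg hr (toNeg r x)).weight_eq hG hr ε hex.not_mem_peaks
    rw [← h2, ← h3] at h1
    refine (congrArg _ ?_).trans (Finsupp.single_zero _)
    rw [sub_eq_zero]
    refine Eq.trans ?_ (h1.trans (mul_comm _ _))
    rfl

/-- The anticommutation relation, once the differentials of the two resolutions have square
zero. -/
theorem IsEnhanced.anticomm (hG : G.IsEnhanced W P C) {r : Circ n} (hr : r ∈ G.sing)
    (ε : Equiv.Perm (Fin n) → Fin n → Fin n → ℤˣ)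
    (hp : (G.pos r).differential ε W P C ∘ₗ (G.pos r).differential ε W P C = 0)
    (hn : (G.neg r).differential ε W P C ∘ₗ (G.neg r).differential ε W P C = 0) :
    (G.neg r).differential ε W P C ∘ₗ G.peakMap ε W P C hr =
      -(G.peakMap ε W P C hr ∘ₗ (G.pos r).differential ε W P C) := by
  have h := hG.gauge_relation hr ε
  set c := MvPolynomial.C (compassSign C r) * (mon (G.LowAt .O r) - mon (G.HighAt .O r)) with hc
  have hc0 : c ≠ 0 := by
    refine mul_ne_zero ?_ (sub_ne_zero.2 (hG.grid.mon_lowAt_ne hr))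
    rw [MvPolynomial.C_ne_zero]
    intro h0
    have := compassSign_mul_self C r
    rw [h0] at this
    simp at this
  set Dp := (G.pos r).differential ε W P C
  set Dn := (G.neg r).differential ε W P C
  set f := G.peakMap ε W P C hr
  set Γ := gaugeMap W P G r
  have h1 : c • (Dn ∘ₗ f + f ∘ₗ Dp) = 0 := by
    rw [smul_add, ← LinearMap.comp_smul, ← LinearMap.smul_comp, ← h, LinearMap.comp_sub,
      LinearMap.sub_comp, ← LinearMap.comp_assoc, hn, LinearMap.zero_comp, LinearMap.comp_assoc Dp Dp,
      hp, LinearMap.comp_zero, LinearMap.comp_assoc Dp]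
    abel
  refine LinearMap.ext fun z => Finsupp.ext fun y => ?_
  have h2 := DFunLike.congr_fun (DFunLike.congr_fun h1 z) y
  simp only [LinearMap.smul_apply, Finsupp.smul_apply, smul_eq_mul, LinearMap.zero_apply,
    Finsupp.zero_apply, mul_eq_zero, hc0, false_or] at h2
  exact eq_neg_of_add_eq_zero_left h2

end Grid

/-! ### The cyclic order on the places -/

/-- Going from `a` in the positive direction, one meets `z` strictly before `b`. -/
def Cyc (a z b : Fin n) : Prop :=
  ((a : ℕ) < z ∧ (z : ℕ) < b) ∨ ((z : ℕ) < b ∧ (b : ℕ) < a) ∨ ((b : ℕ) < a ∧ (a : ℕ) < z)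

/-- The indicator function of the unit strips `u` between the places `a` and `b`. -/
def stripCount (a b u : Fin n) : ℕ :=
  if ((a : ℕ) ≤ u ∧ (u : ℕ) < b) ∨ ((u : ℕ) < b ∧ (b : ℕ) < a) ∨ ((b : ℕ) < a ∧ (a : ℕ) ≤ u)
  then 1 else 0

theorem btw_line_iff {a z b : Fin n} : Btw n (line a) (line z) (line b) ↔ Cyc a z b := by
  rw [btw_iff (line_nonneg a) (line_lt a) (line_nonneg z) (line_lt z) (line_nonneg b) (line_lt b)]
  unfold Cyc line
  omega

theorem btw_strip_iff {a u b : Fin n} :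
    Btw n (line a) (strip u) (line b) ↔ stripCount a b u = 1 := by
  rw [btw_iff (line_nonneg a) (line_lt a) (strip_nonneg u) (strip_lt u) (line_nonneg b) (line_lt b)]
  unfold stripCount line strip
  split_ifs <;> simp only [iff_false, iff_true] <;> omega

theorem stripCount_eq_zero_or_one (a b u : Fin n) : stripCount a b u = 0 ∨ stripCount a b u = 1 := by
  unfold stripCount; split_ifs <;> simp

theorem rectEmpty_iff {σ : Equiv.Perm (Fin n)} {a b : Fin n} :
    RectEmpty σ a b ↔ ∀ e, ¬ (Cyc a e b ∧ Cyc (σ a) (σ e) (σ b)) := by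
  unfold RectEmpty
  simp only [btw_line_iff]

theorem rectDomain_eq (σ : Equiv.Perm (Fin n)) (a b : Fin n) (c : Fin n × Fin n) :
    rectDomain σ a b c = stripCount a b c.1 * stripCount (σ a) (σ b) c.2 := by
  unfold rectDomain
  rw [btw_strip_iff, btw_strip_iff]
  rcases stripCount_eq_zero_or_one a b c.1 with h | h <;>
    rcases stripCount_eq_zero_or_one (σ a) (σ b) c.2 with h' | h' <;> simp [h, h']

theorem Cyc.stripCount_eq {a z b : Fin n} (h : Cyc a z b) (u : Fin n) :
    stripCount a b u = stripCount a z u + stripCount z b u := by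
  unfold Cyc at h
  unfold stripCount
  split_ifs <;> omega

theorem Cyc.stripCount_self {a z b : Fin n} (h : Cyc a z b) : stripCount a b z = 1 := by
  unfold Cyc at h
  unfold stripCount
  split_ifs <;> omega

theorem cyc_of_stripCount {a z b : Fin n} (h : stripCount a b z = 1) (hz : z ≠ a) : Cyc a z b := by
  have : (z : ℕ) ≠ a := fun h => hz (Fin.ext h)
  unfold stripCount at h
  unfold Cyc
  split_ifs at h
  omega

theorem Cyc.rotate {a z b : Fin n} (h : Cyc a z b) : Cyc z b a := by
  unfold Cyc at *; omega

theorem not_cyc_left (a b : Fin n) : ¬ Cyc a a b := by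
  unfold Cyc; omega

theorem not_cyc_right (a b : Fin n) : ¬ Cyc a b b := by
  unfold Cyc; omega

theorem cyc_or {a z b : Fin n} (h1 : a ≠ z) (h2 : z ≠ b) (h3 : a ≠ b) : Cyc a z b ∨ Cyc a b z := by
  have h1 : (a : ℕ) ≠ z := fun h => h1 (Fin.ext h)
  have h2 : (z : ℕ) ≠ b := fun h => h2 (Fin.ext h)
  have h3 : (a : ℕ) ≠ b := fun h => h3 (Fin.ext h)
  unfold Cyc; omega

theorem Cyc.of_not {a z b : Fin n} (h : ¬ Cyc a z b) (h1 : a ≠ z) (h2 : z ≠ b) (h3 : a ≠ b) :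
    Cyc a b z := (cyc_or h1 h2 h3).resolve_left h

theorem Cyc.right_between {a b c d : Fin n} (h : Cyc c a d) (h' : ¬ Cyc c b d) (h1 : b ≠ c)
    (h2 : b ≠ d) : Cyc a d b := by
  have h1 : (b : ℕ) ≠ c := fun h => h1 (Fin.ext h)
  have h2 : (b : ℕ) ≠ d := fun h => h2 (Fin.ext h)
  unfold Cyc at *; omega

theorem Cyc.left_between {a b c d : Fin n} (h : Cyc c b d) (h' : ¬ Cyc c a d) (h1 : a ≠ c)
    (h2 : a ≠ d) : Cyc a c b := by
  have h1 : (a : ℕ) ≠ c := fun h => h1 (Fin.ext h)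
  have h2 : (a : ℕ) ≠ d := fun h => h2 (Fin.ext h)
  unfold Cyc at *; omega

/-! ### Juxtapositions of two empty rectangles -/

/-- The rectangles given by the places `a, b` and `c, d` can be juxtaposed, starting from `σ`, and
lead to `τ`. -/
structure IsJuxt (σ τ : Equiv.Perm (Fin n)) (q : Fin n × Fin n × Fin n × Fin n) : Prop where
  ne : q.1 ≠ q.2.1
  ne' : q.2.2.1 ≠ q.2.2.2
  empty : RectEmpty σ q.1 q.2.1
  empty' : RectEmpty (σ * Equiv.swap q.1 q.2.1) q.2.2.1 q.2.2.2
  target : σ * Equiv.swap q.1 q.2.1 * Equiv.swap q.2.2.1 q.2.2.2 = τ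

/-- The domain of a juxtaposition of two rectangles. -/
noncomputable def juxtDomain (σ : Equiv.Perm (Fin n)) (q : Fin n × Fin n × Fin n × Fin n) :
    Fin n × Fin n → ℕ :=
  rectDomain σ q.1 q.2.1 + rectDomain (σ * Equiv.swap q.1 q.2.1) q.2.2.1 q.2.2.2

/-- If two pairs of rectangles have the same domain and their corners are on the same three
circles of each family, then the second pair is empty as soon as it contains none of the dots on
these circles. -/
theorem rectEmpty_of_domain {σ : Equiv.Perm (Fin n)} {x y z a b c d a' b' c' d' : Fin n}
    (ha : a = x ∨ a = y ∨ a = z) (hb : b = x ∨ b = y ∨ b = z)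
    (hc : c = x ∨ c = y ∨ c = z) (ha' : a' = x ∨ a' = y ∨ a' = z) (hb' : b' = x ∨ b' = y ∨ b' = z)
    (h1 : RectEmpty σ a b) (h2 : RectEmpty (σ * Equiv.swap a b) c d)
    (hdom : juxtDomain σ (a', b', c', d') = juxtDomain σ (a, b, c, d))
    (h3 : ∀ e, e = x ∨ e = y ∨ e = z → ¬ (Cyc a' e b' ∧ Cyc (σ a') (σ e) (σ b')) ∧
      ¬ (Cyc c' e d' ∧ Cyc ((σ * Equiv.swap a' b') c') ((σ * Equiv.swap a' b') e)
        ((σ * Equiv.swap a' b') d'))) :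
    RectEmpty σ a' b' ∧ RectEmpty (σ * Equiv.swap a' b') c' d' := by
  rw [rectEmpty_iff] at h1 h2
  rw [rectEmpty_iff, rectEmpty_iff, ← forall_and]
  intro e
  by_cases he : e = x ∨ e = y ∨ e = z
  · exact h3 e he
  have hea : ∀ f, f = x ∨ f = y ∨ f = z → e ≠ f := fun f hf h => he (h ▸ hf)
  have e1 : (σ * Equiv.swap a' b') e = σ e := by
    rw [Equiv.Perm.mul_apply, Equiv.swap_apply_of_ne_of_ne (hea _ ha') (hea _ hb')]
  have e2 : (σ * Equiv.swap a b) e = σ e := by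
    rw [Equiv.Perm.mul_apply, Equiv.swap_apply_of_ne_of_ne (hea _ ha) (hea _ hb)]
  have hd := congrFun hdom (e, σ e)
  have hold : juxtDomain σ (a, b, c, d) (e, σ e) = 0 := by
    unfold juxtDomain
    simp only [Pi.add_apply, rectDomain_eq, Nat.add_eq_zero_iff, mul_eq_zero]
    constructor
    · by_contra hn
      push Not at hn
      have k1 := (stripCount_eq_zero_or_one a b e).resolve_left hn.1
      have k2 := (stripCount_eq_zero_or_one (σ a) (σ b) (σ e)).resolve_left hn.2
      exact h1 e ⟨cyc_of_stripCount k1 (hea _ ha),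
        cyc_of_stripCount k2 (σ.injective.ne (hea _ ha))⟩
    · by_contra hn
      push Not at hn
      rw [← e2] at hn
      have k1 := (stripCount_eq_zero_or_one _ _ _).resolve_left hn.1
      have k2 := (stripCount_eq_zero_or_one _ _ _).resolve_left hn.2
      exact h2 e ⟨cyc_of_stripCount k1 (hea _ hc),
        cyc_of_stripCount k2 ((σ * Equiv.swap a b).injective.ne (hea _ hc))⟩
  rw [hold] at hd
  unfold juxtDomain at hd
  simp only [Pi.add_apply, rectDomain_eq, Nat.add_eq_zero_iff, mul_eq_zero] at hd
  constructor
  · rintro ⟨k1, k2⟩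
    have := k1.stripCount_self
    have := k2.stripCount_self
    omega
  · rw [e1]
    rintro ⟨k1, k2⟩
    have := k1.stripCount_self
    have := k2.stripCount_self
    omega

/-- Two rectangles with no common side can be exchanged. -/
theorem IsJuxt.exchange {σ τ : Equiv.Perm (Fin n)} {a b c d : Fin n}
    (h : IsJuxt σ τ (a, b, c, d)) (hac : a ≠ c) (had : a ≠ d) (hbc : b ≠ c) (hbd : b ≠ d) :
    IsJuxt σ τ (c, d, a, b) ∧ juxtDomain σ (c, d, a, b) = juxtDomain σ (a, b, c, d) := by
  obtain ⟨hab, hcd, h1, h2, h3⟩ := h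
  simp only at hab hcd h1 h2 h3
  have sc : (σ * Equiv.swap a b) c = σ c := by
    simp [Equiv.swap_apply_of_ne_of_ne hac.symm hbc.symm]
  have sd : (σ * Equiv.swap a b) d = σ d := by
    simp [Equiv.swap_apply_of_ne_of_ne had.symm hbd.symm]
  have sa : (σ * Equiv.swap a b) a = σ b := by simp
  have sb : (σ * Equiv.swap a b) b = σ a := by simp
  have ta : (σ * Equiv.swap c d) a = σ a := by
    simp [Equiv.swap_apply_of_ne_of_ne hac had]
  have tb : (σ * Equiv.swap c d) b = σ b := by
    simp [Equiv.swap_apply_of_ne_of_ne hbc hbd]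
  have tc : (σ * Equiv.swap c d) c = σ d := by simp
  have td : (σ * Equiv.swap c d) d = σ c := by simp
  have iac := σ.injective.ne hac
  have iad := σ.injective.ne had
  have ibc := σ.injective.ne hbc
  have ibd := σ.injective.ne hbd
  rw [rectEmpty_iff] at h1 h2
  rw [sc, sd] at h2
  have k1 := h1 c
  have k2 := h1 d
  have k3 := h2 a
  have k4 := h2 b
  rw [sa] at k3
  rw [sb] at k4
  refine ⟨⟨hcd, hab, ?_, ?_, ?_⟩, ?_⟩
  · simp only [rectEmpty_iff]
    rintro e ⟨e1, e2⟩
    by_cases hea : e = a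
    · subst hea
      have l1 : ¬ Cyc (σ c) (σ b) (σ d) := fun h => k3 ⟨e1, h⟩
      have l2 : ¬ Cyc c b d := fun h => k4 ⟨h, e2⟩
      exact k2 ⟨e1.right_between l2 hbc hbd, e2.right_between l1 ibc ibd⟩
    by_cases heb : e = b
    · subst heb
      have l1 : ¬ Cyc (σ c) (σ a) (σ d) := fun h => k4 ⟨e1, h⟩
      have l2 : ¬ Cyc c a d := fun h => k3 ⟨h, e2⟩
      exact k1 ⟨e1.left_between l2 hac had, e2.left_between l1 iac iad⟩
    refine h2 e ⟨e1, ?_⟩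
    rw [Equiv.Perm.mul_apply, Equiv.swap_apply_of_ne_of_ne hea heb]
    exact e2
  · simp only [rectEmpty_iff]
    rw [ta, tb]
    rintro e ⟨e1, e2⟩
    by_cases hec : e = c
    · subst hec
      rw [tc] at e2
      have l1 : ¬ Cyc (σ a) (σ e) (σ b) := fun h => k1 ⟨e1, h⟩
      have l2 : ¬ Cyc a d b := fun h => k2 ⟨h, e2⟩
      exact k4 ⟨e1.right_between l2 had.symm hbd.symm, e2.left_between l1 iac.symm ibc.symm⟩
    by_cases hed : e = d
    · subst hed
      rw [td] at e2
      have l1 : ¬ Cyc (σ a) (σ e) (σ b) := fun h => k2 ⟨e1, h⟩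
      have l2 : ¬ Cyc a c b := fun h => k1 ⟨h, e2⟩
      exact k3 ⟨e1.left_between l2 hac.symm hbc.symm, e2.right_between l1 iad.symm ibd.symm⟩
    refine h1 e ⟨e1, ?_⟩
    rw [Equiv.Perm.mul_apply, Equiv.swap_apply_of_ne_of_ne hec hed] at e2
    exact e2
  · rw [← h3]
    simp only [mul_assoc]
    congr 1
    refine (Equiv.Perm.Disjoint.commute ?_).eq
    intro e
    by_cases he : e = c ∨ e = d
    · right
      rcases he with rfl | rfl
      · exact Equiv.swap_apply_of_ne_of_ne hac.symm hbc.symm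
      · exact Equiv.swap_apply_of_ne_of_ne had.symm hbd.symm
    · left
      push Not at he
      exact Equiv.swap_apply_of_ne_of_ne he.1 he.2
  · funext u
    unfold juxtDomain
    simp only [Pi.add_apply, rectDomain_eq, sc, sd, ta, tb]
    ring

/-- A juxtaposition whose corners are on three circles of each family is replaced by another one
with the same domain. -/
theorem IsJuxt.recut {σ τ : Equiv.Perm (Fin n)} {x y z : Fin n}
    {q q' : Fin n × Fin n × Fin n × Fin n} (h : IsJuxt σ τ q)
    (ha : q.1 = x ∨ q.1 = y ∨ q.1 = z) (hb : q.2.1 = x ∨ q.2.1 = y ∨ q.2.1 = z)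
    (hc : q.2.2.1 = x ∨ q.2.2.1 = y ∨ q.2.2.1 = z)
    (ha' : q'.1 = x ∨ q'.1 = y ∨ q'.1 = z) (hb' : q'.2.1 = x ∨ q'.2.1 = y ∨ q'.2.1 = z)
    (hne : q'.1 ≠ q'.2.1) (hne' : q'.2.2.1 ≠ q'.2.2.2) (hq : q' ≠ q)
    (ht : Equiv.swap q'.1 q'.2.1 * Equiv.swap q'.2.2.1 q'.2.2.2 =
      Equiv.swap q.1 q.2.1 * Equiv.swap q.2.2.1 q.2.2.2)
    (hdom : juxtDomain σ q' = juxtDomain σ q)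
    (h3 : ∀ e, e = x ∨ e = y ∨ e = z → ¬ (Cyc q'.1 e q'.2.1 ∧ Cyc (σ q'.1) (σ e) (σ q'.2.1)) ∧
      ¬ (Cyc q'.2.2.1 e q'.2.2.2 ∧ Cyc ((σ * Equiv.swap q'.1 q'.2.1) q'.2.2.1)
        ((σ * Equiv.swap q'.1 q'.2.1) e) ((σ * Equiv.swap q'.1 q'.2.1) q'.2.2.2))) :
    ∃ q', q' ≠ q ∧ IsJuxt σ τ q' ∧ juxtDomain σ q' = juxtDomain σ q := by
  obtain ⟨e1, e2⟩ := rectEmpty_of_domain ha hb hc ha' hb' h.empty h.empty' hdom h3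
  exact ⟨q', hq, ⟨hne, hne', e1, e2, by rw [mul_assoc, ht, ← mul_assoc, h.target]⟩, hdom⟩

/-- The two rectangles have a common west side: their domain is L-shaped, with one reflex corner,
and it can also be cut along the other line through that corner. -/
theorem IsJuxt.recut_west {σ τ : Equiv.Perm (Fin n)} {a b d : Fin n}
    (h : IsJuxt σ τ (a, b, a, d)) (hbd : b ≠ d) :
    ∃ q, q ≠ (a, b, a, d) ∧ IsJuxt σ τ q ∧ juxtDomain σ q = juxtDomain σ (a, b, a, d) := by
  have hab : a ≠ b := h.ne
  have had : a ≠ d := h.ne'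
  have iab := σ.injective.ne hab
  have iad := σ.injective.ne had
  have ibd := σ.injective.ne hbd
  have sa : (σ * Equiv.swap a b) a = σ b := by simp
  have sb : (σ * Equiv.swap a b) b = σ a := by simp
  have sd : (σ * Equiv.swap a b) d = σ d := by
    simp [Equiv.swap_apply_of_ne_of_ne had.symm hbd.symm]
  have k1 := rectEmpty_iff.1 h.empty d
  have k2 := rectEmpty_iff.1 h.empty' b
  simp only [sa, sb, sd] at k1 k2
  rcases cyc_or had hbd.symm hab with hc | hc
  -- The emptiness of the two rectangles determines the cyclic order of the heights `σ a`, `σ b`,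
  -- `σ d`; the reflex corner is on the line of `d` or of `b`, according to which one comes first.
  · have hr : Cyc (σ a) (σ b) (σ d) := Cyc.of_not (fun h => k1 ⟨hc, h⟩) iad ibd.symm iab
    have ta : (σ * Equiv.swap a d) a = σ d := by simp
    have td : (σ * Equiv.swap a d) d = σ a := by simp
    have tb : (σ * Equiv.swap a d) b = σ b := by
      simp [Equiv.swap_apply_of_ne_of_ne hab.symm hbd]
    refine h.recut (x := a) (y := b) (z := d) (q' := (a, d, d, b)) (by simp) (by simp)
      (by simp) (by simp) (by simp) had hbd.symm ?_ ?_ ?_ ?_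
    · simp [Prod.ext_iff, hbd.symm, had.symm, hbd]
    · ext e
      simp only [Equiv.Perm.mul_apply, Equiv.swap_apply_def]
      split_ifs <;> simp_all
    · funext u
      unfold juxtDomain
      simp only [Pi.add_apply, rectDomain_eq, sa, sd, tb, td, hc.stripCount_eq,
        hr.stripCount_eq]
      ring
    · clear k1 k2
      unfold Cyc at hc hr
      rintro e (rfl | rfl | rfl) <;> simp only [ta, tb, td] <;> unfold Cyc <;> omega
  · have hr : Cyc (σ a) (σ b) (σ d) :=
      (Cyc.of_not (fun h => k2 ⟨hc, h⟩) iab.symm iad ibd).rotate.rotate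
    have tb : (σ * Equiv.swap b d) b = σ d := by simp
    have td : (σ * Equiv.swap b d) d = σ b := by simp
    have ta : (σ * Equiv.swap b d) a = σ a := by
      simp [Equiv.swap_apply_of_ne_of_ne hab had]
    refine h.recut (x := a) (y := b) (z := d) (q' := (b, d, a, b)) (by simp) (by simp)
      (by simp) (by simp) (by simp) hbd hab ?_ ?_ ?_ ?_
    · simp [Prod.ext_iff, hab.symm, hbd.symm, hbd]
    · ext e
      simp only [Equiv.Perm.mul_apply, Equiv.swap_apply_def]
      split_ifs <;> simp_all
    · funext u
      unfold juxtDomain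
      simp only [Pi.add_apply, rectDomain_eq, sa, sd, ta, tb, hc.stripCount_eq,
        hr.stripCount_eq]
      ring
    · clear k1 k2
      unfold Cyc at hc hr
      rintro e (rfl | rfl | rfl) <;> simp only [ta, tb, td] <;> unfold Cyc <;> omega

/-- The second rectangle starts on the east side of the first one. -/
theorem IsJuxt.recut_south {σ τ : Equiv.Perm (Fin n)} {a b d : Fin n}
    (h : IsJuxt σ τ (a, b, b, d)) (had : a ≠ d) :
    ∃ q, q ≠ (a, b, b, d) ∧ IsJuxt σ τ q ∧ juxtDomain σ q = juxtDomain σ (a, b, b, d) := by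
  have hab : a ≠ b := h.ne
  have hbd : b ≠ d := h.ne'
  have iab := σ.injective.ne hab
  have iad := σ.injective.ne had
  have ibd := σ.injective.ne hbd
  have sa : (σ * Equiv.swap a b) a = σ b := by simp
  have sb : (σ * Equiv.swap a b) b = σ a := by simp
  have sd : (σ * Equiv.swap a b) d = σ d := by
    simp [Equiv.swap_apply_of_ne_of_ne had.symm hbd.symm]
  have k1 := rectEmpty_iff.1 h.empty d
  have k2 := rectEmpty_iff.1 h.empty' a
  simp only [sa, sb, sd] at k1 k2
  rcases cyc_or iad ibd.symm iab with hc | hc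
  · have hr : Cyc a b d := Cyc.of_not (fun h => k1 ⟨h, hc⟩) had hbd.symm hab
    have ta : (σ * Equiv.swap a d) a = σ d := by simp
    have td : (σ * Equiv.swap a d) d = σ a := by simp
    have tb : (σ * Equiv.swap a d) b = σ b := by
      simp [Equiv.swap_apply_of_ne_of_ne hab.symm hbd]
    refine h.recut (x := a) (y := b) (z := d) (q' := (a, d, a, b)) (by simp) (by simp)
      (by simp) (by simp) (by simp) had hab ?_ ?_ ?_ ?_
    · simp [Prod.ext_iff, hbd.symm, hab, hbd]
    · ext e
      simp only [Equiv.Perm.mul_apply, Equiv.swap_apply_def]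
      split_ifs <;> simp_all
    · funext u
      unfold juxtDomain
      simp only [Pi.add_apply, rectDomain_eq, sb, sd, ta, tb, hc.stripCount_eq,
        hr.stripCount_eq]
      ring
    · clear k1 k2
      unfold Cyc at hc hr
      rintro e (rfl | rfl | rfl) <;> simp only [ta, tb, td] <;> unfold Cyc <;> omega
  · have hr : Cyc a b d := (Cyc.of_not (fun h => k2 ⟨h, hc⟩) hab.symm had hbd).rotate.rotate
    have tb : (σ * Equiv.swap b d) b = σ d := by simp
    have td : (σ * Equiv.swap b d) d = σ b := by simp
    have ta : (σ * Equiv.swap b d) a = σ a := by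
      simp [Equiv.swap_apply_of_ne_of_ne hab had]
    refine h.recut (x := a) (y := b) (z := d) (q' := (b, d, a, d)) (by simp) (by simp)
      (by simp) (by simp) (by simp) hbd had ?_ ?_ ?_ ?_
    · simp [Prod.ext_iff, hab.symm, hbd.symm, hab]
    · ext e
      simp only [Equiv.Perm.mul_apply, Equiv.swap_apply_def]
      split_ifs <;> simp_all
    · funext u
      unfold juxtDomain
      simp only [Pi.add_apply, rectDomain_eq, sb, sd, ta, td, hc.stripCount_eq,
        hr.stripCount_eq]
      ring
    · clear k1 k2
      unfold Cyc at hc hr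
      rintro e (rfl | rfl | rfl) <;> simp only [ta, tb, td] <;> unfold Cyc <;> omega

/-- The second rectangle ends on the west side of the first one. -/
theorem IsJuxt.recut_north {σ τ : Equiv.Perm (Fin n)} {a b c : Fin n}
    (h : IsJuxt σ τ (a, b, c, a)) (hbc : b ≠ c) :
    ∃ q, q ≠ (a, b, c, a) ∧ IsJuxt σ τ q ∧ juxtDomain σ q = juxtDomain σ (a, b, c, a) := by
  have hab : a ≠ b := h.ne
  have hac : a ≠ c := h.ne'.symm
  have iab := σ.injective.ne hab
  have iac := σ.injective.ne hac
  have ibc := σ.injective.ne hbc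
  have sa : (σ * Equiv.swap a b) a = σ b := by simp
  have sb : (σ * Equiv.swap a b) b = σ a := by simp
  have sc : (σ * Equiv.swap a b) c = σ c := by
    simp [Equiv.swap_apply_of_ne_of_ne hac.symm hbc.symm]
  have k1 := rectEmpty_iff.1 h.empty c
  have k2 := rectEmpty_iff.1 h.empty' b
  simp only [sa, sb, sc] at k1 k2
  rcases (cyc_or iac ibc.symm iab).imp_right (·.rotate.rotate) with hc | hc
  · have hr : Cyc c a b := (Cyc.of_not (fun h => k1 ⟨h, hc⟩) hac hbc.symm hab).rotate.rotate
    have tc : (σ * Equiv.swap c b) c = σ b := by simp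
    have tb : (σ * Equiv.swap c b) b = σ c := by simp
    have ta : (σ * Equiv.swap c b) a = σ a := by
      simp [Equiv.swap_apply_of_ne_of_ne hac hab]
    refine h.recut (x := a) (y := b) (z := c) (q' := (c, b, a, b)) (by simp) (by simp)
      (by simp) (by simp) (by simp) hbc.symm hab ?_ ?_ ?_ ?_
    · simp [Prod.ext_iff, hac.symm, hac, hab.symm]
    · ext e
      simp only [Equiv.Perm.mul_apply, Equiv.swap_apply_def]
      split_ifs <;> simp_all
    · funext u
      unfold juxtDomain
      simp only [Pi.add_apply, rectDomain_eq, sa, sc, ta, tb, hc.stripCount_eq,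
        hr.stripCount_eq]
      ring
    · clear k1 k2
      unfold Cyc at hc hr
      rintro e (rfl | rfl | rfl) <;> simp only [ta, tb, tc] <;> unfold Cyc <;> omega
  · have hr : Cyc c a b := Cyc.of_not (fun h => k2 ⟨h, hc⟩) hbc.symm hab.symm hac.symm
    have tc : (σ * Equiv.swap c a) c = σ a := by simp
    have ta : (σ * Equiv.swap c a) a = σ c := by simp
    have tb : (σ * Equiv.swap c a) b = σ b := by
      simp [Equiv.swap_apply_of_ne_of_ne hbc hab.symm]
    refine h.recut (x := a) (y := b) (z := c) (q' := (c, a, c, b)) (by simp) (by simp)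
      (by simp) (by simp) (by simp) hac.symm hbc.symm ?_ ?_ ?_ ?_
    · simp [Prod.ext_iff, hac.symm, hab, hab.symm]
    · ext e
      simp only [Equiv.Perm.mul_apply, Equiv.swap_apply_def]
      split_ifs <;> simp_all
    · funext u
      unfold juxtDomain
      simp only [Pi.add_apply, rectDomain_eq, sa, sc, tb, tc, hc.stripCount_eq,
        hr.stripCount_eq]
      ring
    · clear k1 k2
      unfold Cyc at hc hr
      rintro e (rfl | rfl | rfl) <;> simp only [ta, tb, tc] <;> unfold Cyc <;> omega

/-- The two rectangles have a common east side. -/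
theorem IsJuxt.recut_east {σ τ : Equiv.Perm (Fin n)} {a b c : Fin n}
    (h : IsJuxt σ τ (a, b, c, b)) (hac : a ≠ c) :
    ∃ q, q ≠ (a, b, c, b) ∧ IsJuxt σ τ q ∧ juxtDomain σ q = juxtDomain σ (a, b, c, b) := by
  have hab : a ≠ b := h.ne
  have hbc : b ≠ c := h.ne'.symm
  have iab := σ.injective.ne hab
  have iac := σ.injective.ne hac
  have ibc := σ.injective.ne hbc
  have sa : (σ * Equiv.swap a b) a = σ b := by simp
  have sb : (σ * Equiv.swap a b) b = σ a := by simp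
  have sc : (σ * Equiv.swap a b) c = σ c := by
    simp [Equiv.swap_apply_of_ne_of_ne hac.symm hbc.symm]
  have k1 := rectEmpty_iff.1 h.empty c
  have k2 := rectEmpty_iff.1 h.empty' a
  simp only [sa, sb, sc] at k1 k2
  rcases (cyc_or hac hbc.symm hab).imp_right (·.rotate.rotate) with hc | hc
  · have hr : Cyc (σ c) (σ a) (σ b) :=
      (Cyc.of_not (fun h => k1 ⟨hc, h⟩) iac ibc.symm iab).rotate.rotate
    have tc : (σ * Equiv.swap c b) c = σ b := by simp
    have tb : (σ * Equiv.swap c b) b = σ c := by simp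
    have ta : (σ * Equiv.swap c b) a = σ a := by
      simp [Equiv.swap_apply_of_ne_of_ne hac hab]
    refine h.recut (x := a) (y := b) (z := c) (q' := (c, b, a, c)) (by simp) (by simp)
      (by simp) (by simp) (by simp) hbc.symm hac ?_ ?_ ?_ ?_
    · simp [Prod.ext_iff, hac.symm, hac, hbc.symm]
    · ext e
      simp only [Equiv.Perm.mul_apply, Equiv.swap_apply_def]
      split_ifs <;> simp_all
    · funext u
      unfold juxtDomain
      simp only [Pi.add_apply, rectDomain_eq, sb, sc, ta, tc, hc.stripCount_eq,
        hr.stripCount_eq]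
      ring
    · clear k1 k2
      unfold Cyc at hc hr
      rintro e (rfl | rfl | rfl) <;> simp only [ta, tb, tc] <;> unfold Cyc <;> omega
  · have hr : Cyc (σ c) (σ a) (σ b) := Cyc.of_not (fun h => k2 ⟨hc, h⟩) ibc.symm iab.symm iac.symm
    have tc : (σ * Equiv.swap c a) c = σ a := by simp
    have ta : (σ * Equiv.swap c a) a = σ c := by simp
    have tb : (σ * Equiv.swap c a) b = σ b := by
      simp [Equiv.swap_apply_of_ne_of_ne hbc hab.symm]
    refine h.recut (x := a) (y := b) (z := c) (q' := (c, a, a, b)) (by simp) (by simp)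
      (by simp) (by simp) (by simp) hac.symm hab ?_ ?_ ?_ ?_
    · simp [Prod.ext_iff, hac.symm, hab, hac]
    · ext e
      simp only [Equiv.Perm.mul_apply, Equiv.swap_apply_def]
      split_ifs <;> simp_all
    · funext u
      unfold juxtDomain
      simp only [Pi.add_apply, rectDomain_eq, sb, sc, ta, tb, hc.stripCount_eq,
        hr.stripCount_eq]
      ring
    · clear k1 k2
      unfold Cyc at hc hr
      rintro e (rfl | rfl | rfl) <;> simp only [ta, tb, tc] <;> unfold Cyc <;> omega

/-- Every juxtaposition of two empty rectangles that does not return to `σ` has a domain that can be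
cut in another way: the cases are those of the sides that the two rectangles have in common. -/
theorem IsJuxt.exists_partner {σ τ : Equiv.Perm (Fin n)} {q : Fin n × Fin n × Fin n × Fin n}
    (h : IsJuxt σ τ q) (hτ : τ ≠ σ) :
    ∃ q', q' ≠ q ∧ IsJuxt σ τ q' ∧ juxtDomain σ q' = juxtDomain σ q := by
  obtain ⟨a, b, c, d⟩ := q
  have ht := h.target
  simp only at ht
  by_cases h1 : a = c
  · subst h1
    refine h.recut_west fun e => hτ ?_
    rw [← ht, ← e, mul_assoc, Equiv.swap_mul_self, mul_one]
  by_cases h2 : b = c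
  · subst h2
    refine h.recut_south fun e => hτ ?_
    rw [← ht, ← e, mul_assoc, Equiv.swap_comm b, Equiv.swap_mul_self, mul_one]
  by_cases h3 : a = d
  · subst h3
    refine h.recut_north fun e => hτ ?_
    rw [← ht, ← e, mul_assoc, Equiv.swap_comm b, Equiv.swap_mul_self, mul_one]
  by_cases h4 : b = d
  · subst h4
    refine h.recut_east fun e => hτ ?_
    rw [← ht, ← e, mul_assoc, Equiv.swap_mul_self, mul_one]
  · obtain ⟨e1, e2⟩ := h.exchange h1 h3 h2 h4
    exact ⟨(c, d, a, b), by simp [Prod.ext_iff, Ne.symm h1], e1, e2⟩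

/-! ### The square of the differential of a regular grid -/

/-- The sign of a juxtaposition of two rectangles. -/
def juxtSign (ε : Equiv.Perm (Fin n) → Fin n → Fin n → ℤˣ) (σ : Equiv.Perm (Fin n))
    (q : Fin n × Fin n × Fin n × Fin n) : ℤˣ :=
  ε σ q.1 q.2.1 * ε (σ * Equiv.swap q.1 q.2.1) q.2.2.1 q.2.2.2

/-- The contribution of a juxtaposition of two rectangles to the square of the differential, when
the `k`-th decoration of kind `O` is in the cell `cell k`. -/
noncomputable def juxtTerm (ε : Equiv.Perm (Fin n) → Fin n → Fin n → ℤˣ)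
    (cell : Fin n → Fin n × Fin n) (σ : Equiv.Perm (Fin n)) (q : Fin n × Fin n × Fin n × Fin n) :
    GroundRing n :=
  MvPolynomial.C ((juxtSign ε σ q : ℤˣ) : ℤ) *
    ∏ k, MvPolynomial.X k ^ juxtDomain σ q (cell k)

theorem IsSignAssignment.juxtSign_eq {ε : Equiv.Perm (Fin n) → Fin n → Fin n → ℤˣ}
    (hε : IsSignAssignment ε) {σ τ : Equiv.Perm (Fin n)} {q q' : Fin n × Fin n × Fin n × Fin n}
    (h : IsJuxt σ τ q) (h' : IsJuxt σ τ q') (hdom : juxtDomain σ q' = juxtDomain σ q)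
    (hne : q' ≠ q) : juxtSign ε σ q' = -juxtSign ε σ q :=
  hε.square σ _ _ _ _ _ _ _ _ h'.ne h'.ne' h.ne h.ne' h'.empty h'.empty' h.empty h.empty'
    (h'.target.trans h.target.symm) hdom hne

/-- The juxtapositions with a given domain cancel in pairs. There are never three of them, since
their signs would be pairwise opposite. -/
theorem IsSignAssignment.sum_juxtTerm_eq_zero {ε : Equiv.Perm (Fin n) → Fin n → Fin n → ℤˣ}
    (hε : IsSignAssignment ε) (cell : Fin n → Fin n × Fin n) {σ τ : Equiv.Perm (Fin n)}
    (hτ : τ ≠ σ) [DecidablePred (IsJuxt σ τ)] :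
    ∑ q ∈ Finset.univ.filter (IsJuxt σ τ), juxtTerm ε cell σ q = 0 := by
  classical
  have hex : ∀ q ∈ Finset.univ.filter (IsJuxt σ τ),
      ∃ q', q' ≠ q ∧ IsJuxt σ τ q' ∧ juxtDomain σ q' = juxtDomain σ q := fun q hq =>
    IsJuxt.exists_partner (Finset.mem_filter.1 hq).2 hτ
  choose! g hg using hex
  have hm : ∀ q ∈ Finset.univ.filter (IsJuxt σ τ), g q ∈ Finset.univ.filter (IsJuxt σ τ) :=
    fun q hq => Finset.mem_filter.2 ⟨Finset.mem_univ _, (hg q hq).2.1⟩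
  have hs : ∀ q ∈ Finset.univ.filter (IsJuxt σ τ), juxtSign ε σ (g q) = -juxtSign ε σ q :=
    fun q hq => hε.juxtSign_eq (Finset.mem_filter.1 hq).2 (hg q hq).2.1 (hg q hq).2.2 (hg q hq).1
  refine Finset.sum_involution (fun q _ => g q) ?_ (fun q hq _ => (hg q hq).1) hm ?_
  · intro q hq
    unfold juxtTerm
    rw [(hg q hq).2.2, hs q hq, ← add_mul, ← map_add]
    simp
  · intro q hq
    by_contra hne
    have h1 := hε.juxtSign_eq (Finset.mem_filter.1 hq).2 (hg _ (hm q hq)).2.1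
      ((hg _ (hm q hq)).2.2.trans (hg q hq).2.2) hne
    rw [hs _ (hm q hq), hs q hq, neg_neg] at h1
    rcases Int.units_eq_one_or (juxtSign ε σ q) with h | h <;> rw [h] at h1 <;>
      exact absurd h1 (by decide)

/-- The next place in the positive direction. -/
def nextPlace (a : Fin n) : Fin n :=
  if h : (a : ℕ) + 1 < n then ⟨a + 1, h⟩ else ⟨0, a.pos⟩

theorem nextPlace_val (a : Fin n) :
    ((nextPlace a : Fin n) : ℕ) = if (a : ℕ) + 1 < n then (a : ℕ) + 1 else 0 := by
  unfold nextPlace; split_ifs <;> rfl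

theorem nextPlace_ne (hn : 2 ≤ n) (a : Fin n) : a ≠ nextPlace a := by
  intro h
  have := congrArg Fin.val h
  rw [nextPlace_val] at this
  split_ifs at this <;> omega

theorem not_cyc_nextPlace (a e : Fin n) : ¬ Cyc a e (nextPlace a) := by
  unfold Cyc
  rw [nextPlace_val]
  split_ifs <;> omega

theorem eq_nextPlace {a b : Fin n} (hab : a ≠ b) (h : ∀ e, ¬ Cyc a e b) : b = nextPlace a := by
  by_contra hne
  apply h (nextPlace a)
  have h1 : (b : ℕ) ≠ nextPlace a := fun h => hne (Fin.ext h)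
  have h2 : (a : ℕ) ≠ b := fun h => hab (Fin.ext h)
  unfold Cyc
  rw [nextPlace_val] at *
  split_ifs at * <;> omega

theorem stripCount_nextPlace (hn : 2 ≤ n) (a u : Fin n) :
    stripCount a (nextPlace a) u = if u = a then 1 else 0 := by
  unfold stripCount
  rw [nextPlace_val]
  simp only [Fin.ext_iff]
  split_ifs <;> omega

theorem stripCount_add_swap {a b : Fin n} (h : a ≠ b) (u : Fin n) :
    stripCount a b u + stripCount b a u = 1 := by
  have h : (a : ℕ) ≠ b := fun h' => h (Fin.ext h')
  unfold stripCount
  split_ifs <;> omega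

/-- Juxtapositions from a generator to itself are annuli of width one. -/
theorem isJuxt_self_iff (hn : 2 ≤ n) {σ : Equiv.Perm (Fin n)}
    {q : Fin n × Fin n × Fin n × Fin n} :
    IsJuxt σ σ q ↔ (∃ a, (a, nextPlace a, a, nextPlace a) = q) ∨
      ∃ a, (a, σ.symm (nextPlace (σ a)), σ.symm (nextPlace (σ a)), a) = q := by
  constructor
  · intro h
    obtain ⟨a, b, c, d⟩ := q
    obtain ⟨hab, hcd, h1, h2, h3⟩ := h
    simp only at hab hcd h1 h2 h3
    rw [mul_assoc, mul_eq_left] at h3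
    have h4 : Equiv.swap a b d = c := by
      have := DFunLike.congr_fun h3 c
      simpa using this
    rw [rectEmpty_iff] at h1 h2
    have sa : (σ * Equiv.swap a b) a = σ b := by simp
    have sb : (σ * Equiv.swap a b) b = σ a := by simp
    by_cases hd : d = a
    -- A horizontal annulus: its two rectangles cover all columns, so that no dot can be at a height
    -- between those of its sides.
    · subst hd
      obtain rfl : b = c := by simpa using h4
      rw [sa, sb] at h2
      have hn : σ b = nextPlace (σ d) := by
        refine eq_nextPlace (σ.injective.ne hab) fun r hr => ?_
        obtain ⟨e, rfl⟩ := σ.surjective r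
        have hed : e ≠ d := fun h => not_cyc_left _ _ (h ▸ hr)
        have heb : e ≠ b := fun h => not_cyc_right _ _ (h ▸ hr)
        rcases cyc_or hed.symm heb hab with h | h
        · exact h1 e ⟨h, hr⟩
        · refine h2 e ⟨h.rotate, ?_⟩
          rwa [Equiv.Perm.mul_apply, Equiv.swap_apply_of_ne_of_ne hed heb]
      right
      refine ⟨d, ?_⟩
      rw [← hn, Equiv.symm_apply_apply]
    · by_cases hd' : d = b
      -- A vertical annulus, with no dot in a column between its sides.
      · subst hd'
        obtain rfl : a = c := by simpa using h4
        rw [sa, sb] at h2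
        have hn : d = nextPlace a := by
          refine eq_nextPlace hab fun e he => ?_
          have hea : e ≠ a := fun h => not_cyc_left _ _ (h ▸ he)
          have hed : e ≠ d := fun h => not_cyc_right _ _ (h ▸ he)
          rcases cyc_or (σ.injective.ne hea).symm (σ.injective.ne hed) (σ.injective.ne hab) with
            h | h
          · exact h1 e ⟨he, h⟩
          · refine h2 e ⟨he, ?_⟩
            rw [Equiv.Perm.mul_apply, Equiv.swap_apply_of_ne_of_ne hea hed]
            exact h.rotate
        left
        exact ⟨a, by rw [← hn]⟩
      · rw [Equiv.swap_apply_of_ne_of_ne hd hd'] at h4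
        exact absurd h4.symm hcd
  · rintro (⟨a, rfl⟩ | ⟨a, rfl⟩)
    · refine ⟨nextPlace_ne hn a, nextPlace_ne hn a, ?_, ?_, ?_⟩
      · exact rectEmpty_iff.2 fun e h => not_cyc_nextPlace _ _ h.1
      · exact rectEmpty_iff.2 fun e h => not_cyc_nextPlace _ _ h.1
      · simp [mul_assoc]
    · have hne : a ≠ σ.symm (nextPlace (σ a)) := fun h => nextPlace_ne hn (σ a) (by
        conv_rhs => rw [← Equiv.apply_symm_apply σ (nextPlace (σ a)), ← h])
      refine ⟨hne, hne.symm, ?_, ?_, ?_⟩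
      · exact rectEmpty_iff.2 fun e h => not_cyc_nextPlace (σ a) (σ e) (by simpa using h.2)
      · refine rectEmpty_iff.2 fun e h => not_cyc_nextPlace (σ a)
          ((σ * Equiv.swap a (σ.symm (nextPlace (σ a)))) e) ?_
        have h := h.2
        rwa [Equiv.Perm.mul_apply σ _ (σ.symm _), Equiv.swap_apply_right,
          Equiv.Perm.mul_apply σ _ a, Equiv.swap_apply_left, Equiv.apply_symm_apply] at h
      · simp [mul_assoc, Equiv.swap_comm]

/-- The annuli cancel: each variable comes once from a vertical annulus, with sign `-1`, and
once from a horizontal one, with sign `1`. -/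
theorem IsSignAssignment.sum_juxtTerm_self {ε : Equiv.Perm (Fin n) → Fin n → Fin n → ℤˣ}
    (hε : IsSignAssignment ε) (hn : 2 ≤ n) {cell : Fin n → Fin n × Fin n}
    (h1 : Function.Bijective fun k => (cell k).1) (h2 : Function.Bijective fun k => (cell k).2)
    (σ : Equiv.Perm (Fin n)) [DecidablePred (IsJuxt σ σ)] :
    ∑ q ∈ Finset.univ.filter (IsJuxt σ σ), juxtTerm ε cell σ q = 0 := by
  classical
  set f₁ : Fin n → Fin n × Fin n × Fin n × Fin n := fun a => (a, nextPlace a, a, nextPlace a)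
    with hf₁
  set f₂ : Fin n → Fin n × Fin n × Fin n × Fin n :=
    fun a => (a, σ.symm (nextPlace (σ a)), σ.symm (nextPlace (σ a)), a) with hf₂
  have hs : Finset.univ.filter (IsJuxt σ σ) = Finset.univ.image f₁ ∪ Finset.univ.image f₂ := by
    ext q
    simp [isJuxt_self_iff hn, hf₁, hf₂]
  have i₁ : Function.Injective f₁ := fun a b h => (Prod.mk.inj h).1
  have i₂ : Function.Injective f₂ := fun a b h => (Prod.mk.inj h).1
  have hd : Disjoint (Finset.univ.image f₁) (Finset.univ.image f₂) := by
    rw [Finset.disjoint_left]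
    intro q hq hq'
    obtain ⟨a, -, rfl⟩ := Finset.mem_image.1 hq
    obtain ⟨b, -, hb⟩ := Finset.mem_image.1 hq'
    simp only [hf₁, hf₂, Prod.mk.injEq] at hb
    exact nextPlace_ne hn a (hb.1.symm.trans hb.2.2.2)
  have j₁ : ∀ a, IsJuxt σ σ (f₁ a) := fun a => (isJuxt_self_iff hn).2 (Or.inl ⟨a, rfl⟩)
  have j₂ : ∀ a, IsJuxt σ σ (f₂ a) := fun a => (isJuxt_self_iff hn).2 (Or.inr ⟨a, rfl⟩)
  have hprod : ∀ (e : Fin n ≃ Fin n) (a : Fin n),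
      (∏ k, (MvPolynomial.X k : GroundRing n) ^ (if e k = a then 1 else 0)) =
        MvPolynomial.X (e.symm a) := by
    intro e a
    rw [Finset.prod_eq_single (e.symm a)]
    · simp
    · intro k _ hk
      rw [if_neg, pow_zero]
      rintro rfl
      simp at hk
    · simp
  have t₁ : ∀ a, juxtTerm ε cell σ (f₁ a) = -MvPolynomial.X ((Equiv.ofBijective _ h1).symm a) := by
    intro a
    have hsg : juxtSign ε σ (f₁ a) = -1 := hε.vertical σ _ _ (j₁ a).ne (j₁ a).empty (j₁ a).empty'
    unfold juxtTerm
    rw [hsg, ← hprod (Equiv.ofBijective _ h1) a]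
    have hdom : ∀ u, juxtDomain σ (f₁ a) u = if u.1 = a then 1 else 0 := by
      intro u
      unfold juxtDomain
      simp only [hf₁, Pi.add_apply, rectDomain_eq, Equiv.Perm.mul_apply, Equiv.swap_apply_left,
        Equiv.swap_apply_right]
      rw [← mul_add, stripCount_add_swap (σ.injective.ne (nextPlace_ne hn a)),
        stripCount_nextPlace hn, mul_one]
    simp [hdom]
  have t₂ : ∀ a, juxtTerm ε cell σ (f₂ a) = MvPolynomial.X ((Equiv.ofBijective _ h2).symm (σ a)) := by
    intro a
    have hsg : juxtSign ε σ (f₂ a) = 1 := hε.horizontal σ _ _ (j₂ a).ne (j₂ a).empty (j₂ a).empty'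
    unfold juxtTerm
    rw [hsg, ← hprod (Equiv.ofBijective _ h2) (σ a)]
    have hdom : ∀ u, juxtDomain σ (f₂ a) u = if u.2 = σ a then 1 else 0 := by
      intro u
      unfold juxtDomain
      simp only [hf₂, Pi.add_apply, rectDomain_eq, Equiv.Perm.mul_apply, Equiv.swap_apply_left,
        Equiv.swap_apply_right, Equiv.apply_symm_apply]
      rw [← add_mul, stripCount_add_swap (j₂ a).ne, stripCount_nextPlace hn, one_mul]
    simp [hdom]
  rw [hs, Finset.sum_union hd, Finset.sum_image i₁.injOn, Finset.sum_image i₂.injOn]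
  simp only [t₁, t₂, Finset.sum_neg_distrib]
  rw [(Equiv.ofBijective _ h1).symm.sum_comp (fun k => (MvPolynomial.X k : GroundRing n)),
    Equiv.sum_comp σ (fun j => (MvPolynomial.X ((Equiv.ofBijective _ h2).symm j) : GroundRing n)),
    (Equiv.ofBijective _ h2).symm.sum_comp (fun k => (MvPolynomial.X k : GroundRing n))]
  simp

namespace Grid

variable {G : Grid n} {W : Dir → Deco n → Fin n} {P : Circ n → Deco n} {C : Circ n → Compass}

/-- The unit strips of the decorations of a kind in a regular grid. -/
theorem IsSingularGrid.exists_strip (hG : G.IsSingularGrid) (hs : G.sing = ∅) (κ : Dir)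
    (t : Kind) : ∃ f : Fin n → Fin n, f.Bijective ∧ ∀ k, G.coord κ (t, k) = strip (f k) := by
  have h : ∀ k, ∃ j : Fin n, G.coord κ (t, k) = strip j := by
    intro k
    rcases hG.center κ (t, k) with ⟨i, hi, -⟩ | ⟨j, hj, -⟩
    · simp [hs] at hi
    · exact ⟨j, hj⟩
  choose f hf using h
  refine ⟨f, Finite.injective_iff_bijective.1 fun k l hkl => ?_, hf⟩
  have hc := hG.regular κ t (strip (f k)) (Or.inr ⟨f k, rfl, by simp [hs], by simp [hs]⟩)
    (odd_strip _)
  rw [Finset.card_eq_one] at hc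
  obtain ⟨m, hm⟩ := hc
  have hk : k ∈ ({m} : Finset (Fin n)) := by rw [← hm]; simp [hf]
  have hl : l ∈ ({m} : Finset (Fin n)) := by rw [← hm]; simp [hf, hkl]
  rw [Finset.mem_singleton] at hk hl
  rw [hk, hl]

theorem contains_of_regular (hs : G.sing = ∅) {x : G.Gen} {π : Polygon n} {d : Deco n}
    {u v : Fin n} (hu : G.coord .col d = strip u) (hv : G.coord .row d = strip v) :
    G.Contains W P x π d ↔ rectDomain x.2 π.west π.east (u, v) = 1 := by
  unfold Contains
  rw [Dir.forall_iff .col, seen_of_not_mem (by simp [hs]), seen_of_not_mem (by simp [hs])]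
  simp only [Dir.other, hu, hv, Polygon.lower, Polygon.upper]
  rw [btw_strip_iff, btw_strip_iff, rectDomain_eq]
  simp

theorem weight_of_regular (hs : G.sing = ∅) {u v : Fin n → Fin n}
    (hu : ∀ k, G.coord .col (.O, k) = strip (u k)) (hv : ∀ k, G.coord .row (.O, k) = strip (v k))
    (ε : Equiv.Perm (Fin n) → Fin n → Fin n → ℤˣ) (x : G.Gen) {π : Polygon n}
    (hπ : π.peaks = ∅) :
    G.weight ε W P C x π = MvPolynomial.C ((ε x.2 π.west π.east : ℤˣ) : ℤ) *
      ∏ k, MvPolynomial.X k ^ rectDomain x.2 π.west π.east (u k, v k) := by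
  classical
  rw [weight_eq]
  have hmu : G.mu C x π = 0 := by unfold mu; simp [hπ]
  rw [hmu, pow_zero, one_mul]
  congr 1
  unfold mon In
  rw [Finset.prod_filter]
  refine Finset.prod_congr rfl fun k _ => ?_
  rw [contains_of_regular hs (hu k) (hv k)]
  have h01 : rectDomain x.2 π.west π.east (u k, v k) = 0 ∨
      rectDomain x.2 π.west π.east (u k, v k) = 1 := by
    unfold rectDomain; split_ifs <;> simp
  rcases h01 with h | h <;> rw [h] <;> simp

theorem isPolygon_of_regular (hs : G.sing = ∅) {x y : G.Gen} {π : Polygon n} :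
    G.IsPolygon W P x y π ↔ π.west ≠ π.east ∧ RectEmpty x.2 π.west π.east ∧ π.peaks = ∅ ∧
      y = (x.1, x.2 * Equiv.swap π.west π.east) := by
  constructor
  · intro h
    have hp : π.peaks = ∅ := Finset.subset_empty.1 (hs ▸ h.peak_sing)
    refine ⟨h.ne, h.empty, hp, Prod.ext (Subtype.ext ?_) h.target_perm⟩
    rw [h.target_res, hp, Finset.union_empty]
  · rintro ⟨h1, h2, h3, rfl⟩
    exact ⟨h1, h2, by simp [h3], by simp [h3], by simp [h3], by simp [h3], by simp [h3], rfl⟩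

/-- In a regular grid, the polygons starting at a generator are the empty rectangles. -/
theorem differential_single_of_regular (hs : G.sing = ∅)
    (ε : Equiv.Perm (Fin n) → Fin n → Fin n → ℤˣ) (x : G.Gen) (a : GroundRing n)
    [DecidablePred fun p : Fin n × Fin n => p.1 ≠ p.2 ∧ RectEmpty x.2 p.1 p.2] :
    G.differential ε W P C (Finsupp.single x a) =
      ∑ p ∈ Finset.univ.filter (fun p : Fin n × Fin n => p.1 ≠ p.2 ∧ RectEmpty x.2 p.1 p.2),
        Finsupp.single (x.1, x.2 * Equiv.swap p.1 p.2) (a * G.weight ε W P C x ⟨p.1, p.2, ∅⟩) := by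
  rw [differential_single, Finset.sum_sigma']
  refine Finset.sum_bij (fun q _ => (q.2.west, q.2.east)) ?_ ?_ ?_ ?_
  · rintro ⟨y, π⟩ hq
    rw [Finset.mem_sigma, mem_polygons, isPolygon_of_regular hs] at hq
    exact Finset.mem_filter.2 ⟨Finset.mem_univ _, hq.2.1, hq.2.2.1⟩
  · rintro ⟨y, π⟩ hq ⟨y', π'⟩ hq' h
    rw [Finset.mem_sigma, mem_polygons, isPolygon_of_regular hs] at hq hq'
    obtain ⟨-, -, -, h1, h2⟩ := hq
    obtain ⟨-, -, -, h1', h2'⟩ := hq'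
    obtain ⟨w, e, p⟩ := π
    obtain ⟨w', e', p'⟩ := π'
    simp only [Prod.mk.injEq] at h h1 h1' h2 h2'
    obtain ⟨rfl, rfl⟩ := h
    rw [h2, h2', h1, h1']
  · rintro ⟨a, b⟩ hp
    obtain ⟨-, h1, h2⟩ := Finset.mem_filter.1 hp
    refine ⟨⟨(x.1, x.2 * Equiv.swap a b), ⟨a, b, ∅⟩⟩, ?_, rfl⟩
    rw [Finset.mem_sigma, mem_polygons, isPolygon_of_regular hs]
    exact ⟨Finset.mem_univ _, h1, h2, rfl, rfl⟩
  · rintro ⟨y, π⟩ hq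
    rw [Finset.mem_sigma, mem_polygons, isPolygon_of_regular hs] at hq
    obtain ⟨-, -, -, h1, h2⟩ := hq
    obtain ⟨w, e, p⟩ := π
    simp only at h1 h2
    rw [h2, h1]

theorem IsSingularGrid.differential_comp_of_regular (hG : G.IsSingularGrid) (hs : G.sing = ∅)
    (hn : 2 ≤ n) {ε : Equiv.Perm (Fin n) → Fin n → Fin n → ℤˣ} (hε : IsSignAssignment ε) :
    G.differential ε W P C ∘ₗ G.differential ε W P C = 0 := by
  classical
  obtain ⟨u, hu, hu'⟩ := hG.exists_strip hs .col .O
  obtain ⟨v, hv, hv'⟩ := hG.exists_strip hs .row .O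
  refine Finsupp.lhom_ext' fun x => LinearMap.ext_ring ?_
  simp only [LinearMap.coe_comp, Function.comp_apply, Finsupp.lsingle_apply, LinearMap.zero_apply]
  rw [differential_single_of_regular hs, map_sum]
  simp only [differential_single_of_regular hs, one_mul]
  rw [Finset.sum_sigma']
  -- The terms of the square are grouped by the target `τ` of the juxtaposition.
  have h0 : ∀ τ, ∑ q ∈ Finset.univ.filter (IsJuxt x.2 τ),
      juxtTerm ε (fun k => (u k, v k)) x.2 q = 0 := by
    intro τ
    by_cases hτ : τ = x.2
    · subst hτ
      exact hε.sum_juxtTerm_self hn hu hv _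
    · exact hε.sum_juxtTerm_eq_zero _ hτ
  have h1 : ∑ τ : Equiv.Perm (Fin n), ∑ q ∈ Finset.univ.filter (IsJuxt x.2 τ),
      Finsupp.single ((x.1, τ) : G.Gen) (juxtTerm ε (fun k => (u k, v k)) x.2 q) = 0 := by
    refine Finset.sum_eq_zero fun τ _ => ?_
    rw [← Finsupp.single_finsetSum, h0, Finsupp.single_zero]
  rw [← h1, Finset.sum_sigma']
  symm
  refine Finset.sum_bij (fun s _ => ⟨(s.2.1, s.2.2.1), (s.2.2.2.1, s.2.2.2.2)⟩) ?_ ?_ ?_ ?_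
  · rintro ⟨τ, a, b, c, d⟩ hq
    simp only [Finset.mem_sigma, Finset.mem_filter, Finset.mem_univ, true_and] at hq ⊢
    exact ⟨⟨hq.ne, hq.empty⟩, hq.ne', hq.empty'⟩
  · rintro ⟨τ, a, b, c, d⟩ hq ⟨τ', a', b', c', d'⟩ hq' h
    simp only [Finset.mem_sigma, Finset.mem_filter, Finset.mem_univ, true_and] at hq hq'
    simp only [Sigma.mk.injEq, Prod.mk.injEq, heq_eq_eq] at h
    obtain ⟨⟨rfl, rfl⟩, rfl, rfl⟩ := h
    have h : τ = τ' := hq.target.symm.trans hq'.target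
    rw [h]
  · rintro ⟨⟨a, b⟩, c, d⟩ hq
    simp only [Finset.mem_sigma, Finset.mem_filter, Finset.mem_univ, true_and] at hq
    refine ⟨⟨x.2 * Equiv.swap a b * Equiv.swap c d, a, b, c, d⟩, ?_, rfl⟩
    simp only [Finset.mem_sigma, Finset.mem_filter, Finset.mem_univ, true_and]
    exact ⟨hq.1.1, hq.2.1, hq.1.2, hq.2.2, rfl⟩
  · rintro ⟨τ, a, b, c, d⟩ hq
    simp only [Finset.mem_sigma, Finset.mem_filter, Finset.mem_univ, true_and] at hq
    have ht := hq.target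
    simp only at ht
    subst ht
    refine congrArg _ ?_
    rw [weight_of_regular hs hu' hv' ε x (π := ⟨a, b, ∅⟩) rfl,
      weight_of_regular hs hu' hv' ε _ (π := ⟨c, d, ∅⟩) rfl, mul_mul_mul_comm, ← map_mul,
      ← Finset.prod_mul_distrib]
    simp only [← pow_add]
    unfold juxtTerm juxtSign juxtDomain
    simp

end Grid

namespace Grid

variable {G : Grid n} {W : Dir → Deco n → Fin n} {P : Circ n → Deco n} {C : Circ n → Compass}

/-! ### The Maslov grading and rectangles -/

/-- The indicator that `p` lies in the open south-west quadrant of `q`. -/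
def quadrant (p q : ℤ × ℤ) : ℤ := (if p.1 < q.1 ∧ p.2 < q.2 then 1 else 0)

theorem southWest_eq {ι ι' : Type} [Fintype ι] [Fintype ι'] (A : ι → ℤ × ℤ) (B : ι' → ℤ × ℤ) :
    (southWest A B : ℤ) = ∑ i, ∑ j, quadrant (A i) (B j) := by
  unfold southWest quadrant
  rw [Finset.card_filter, Fintype.sum_prod_type]
  push_cast
  rfl

theorem sum_eq_pair_add {a b : Fin n} (h : a ≠ b) (f : Fin n → ℤ) :
    ∑ i, f i = f a + f b + ∑ i ∈ (Finset.univ.erase a).erase b, f i := by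
  rw [add_assoc, Finset.add_sum_erase _ _ (by simpa using h.symm),
    Finset.add_sum_erase _ _ (Finset.mem_univ _)]

/-- The difference of the positions of a coordinate relative to those of two lines. -/
def side2 (l u c : ℤ) : ℤ := (if l < c then 1 else 0) - (if u < c then 1 else 0)

/-- How the number of pairs that a point makes with the two diagonal corners of a rectangle
differs from the number of pairs that it makes with the other two corners. -/
theorem quadrant_corners {l u l' u' : ℤ} {q : ℤ × ℤ} (h1 : q.1 ≠ l) (h2 : q.1 ≠ u)
    (h3 : q.2 ≠ l') (h4 : q.2 ≠ u') :
    (quadrant (l, u') q + quadrant q (l, u') + quadrant (u, l') q + quadrant q (u, l')) -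
      (quadrant (l, l') q + quadrant q (l, l') + quadrant (u, u') q + quadrant q (u, u')) =
      -2 * (side2 l u q.1 * side2 l' u' q.2) := by
  have key : ∀ {x y : ℤ}, q.1 ≠ x → q.2 ≠ y → quadrant (x, y) q + quadrant q (x, y) =
      1 - (if x < q.1 then 1 else 0) - (if y < q.2 then 1 else 0) +
        2 * ((if x < q.1 then 1 else 0) * (if y < q.2 then 1 else 0)) := by
    intro x y hx hy
    unfold quadrant
    simp only
    split_ifs <;> omega
  have e1 := key h1 h4
  have e2 := key h2 h3
  have e3 := key h1 h3
  have e4 := key h2 h4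
  unfold side2
  linear_combination e1 + e2 - e3 - e4

theorem sum_side2_line (a b : Fin n) : ∑ c : Fin n, side2 (line a) (line b) (line c) = b - a := by
  have h : ∀ a : Fin n, ∑ c : Fin n, (if line a < line c then (1 : ℤ) else 0) = n - 1 - a := by
    intro a
    rw [← Finset.sum_filter, Finset.sum_const]
    have : (Finset.univ.filter fun c : Fin n => line a < line c) = Finset.Ioi a := by
      ext c
      rw [Finset.mem_filter, Finset.mem_Ioi, Fin.lt_def]
      unfold line
      simp
    rw [this, Fin.card_Ioi]
    have := a.2
    simp only [nsmul_eq_mul, mul_one]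
    omega
  unfold side2
  rw [Finset.sum_sub_distrib, h, h]
  ring

theorem sum_side2_strip (a b : Fin n) :
    ∑ c : Fin n, side2 (line a) (line b) (strip c) = b - a := by
  have h : ∀ a : Fin n, ∑ c : Fin n, (if line a < strip c then (1 : ℤ) else 0) = n - a := by
    intro a
    rw [← Finset.sum_filter, Finset.sum_const]
    have : (Finset.univ.filter fun c : Fin n => line a < strip c) = Finset.Ici a := by
      ext c
      rw [Finset.mem_filter, Finset.mem_Ici, Fin.le_def]
      unfold line strip
      simp only [Finset.mem_univ, true_and]
      omega
    rw [this, Fin.card_Ici]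
    have := a.2
    simp only [nsmul_eq_mul, mul_one]
    omega
  unfold side2
  rw [Finset.sum_sub_distrib, h, h]
  ring

/-- `1` if the cyclic interval from `a` to `b` contains the origin and `0` otherwise. -/
def wraps (a b : Fin n) : ℤ := if b < a then 1 else 0

theorem sum_side2_erase {a b : Fin n} (h : a ≠ b) :
    ∑ c ∈ (Finset.univ.erase a).erase b, side2 (line a) (line b) (line c) =
      b - a - (1 - 2 * wraps a b) := by
  have h1 := sum_eq_pair_add h fun c => side2 (line a) (line b) (line c)
  rw [sum_side2_line] at h1
  have h2 : side2 (line a) (line b) (line a) + side2 (line a) (line b) (line b) =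
      1 - 2 * wraps a b := by
    have h : (a : ℕ) ≠ b := fun h' => h (Fin.ext h')
    unfold side2 wraps line
    simp only [Fin.lt_def]
    split_ifs <;> omega
  linarith

open Classical in
theorem side2_line_eq {a b c : Fin n} (h : a ≠ b) (ha : c ≠ a) (hb : c ≠ b) :
    side2 (line a) (line b) (line c) + wraps a b = if Cyc a c b then 1 else 0 := by
  have h : (a : ℕ) ≠ b := fun h' => h (Fin.ext h')
  have ha : (c : ℕ) ≠ a := fun h' => ha (Fin.ext h')
  have hb : (c : ℕ) ≠ b := fun h' => hb (Fin.ext h')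
  unfold side2 wraps line Cyc
  simp only [Fin.lt_def]
  split_ifs <;> omega

theorem side2_strip_eq {a b : Fin n} (h : a ≠ b) (u : Fin n) :
    side2 (line a) (line b) (strip u) + wraps a b = stripCount a b u := by
  have h : (a : ℕ) ≠ b := fun h' => h (Fin.ext h')
  unfold side2 wraps line strip stripCount
  simp only [Fin.lt_def]
  split_ifs <;> omega

/-- The change of the number of pairs of dots in the south-west relation when the corners of a
rectangle are exchanged: the corners themselves contribute a sign that depends on how the rectangle
wraps around the fundamental domain, each of the other dots the product of its positions relative to
the two pairs of sides. -/
theorem southWest_dots_swap {σ : Equiv.Perm (Fin n)} {a b : Fin n} (hab : a ≠ b) :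
    (southWest (dots (σ * Equiv.swap a b)) (dots (σ * Equiv.swap a b)) : ℤ) -
        southWest (dots σ) (dots σ) =
      -((1 - 2 * wraps a b) * (1 - 2 * wraps (σ a) (σ b))) +
        ∑ c ∈ (Finset.univ.erase a).erase b,
          -2 * (side2 (line a) (line b) (line c) * side2 (line (σ a)) (line (σ b)) (line (σ c))) := by
  set R := (Finset.univ.erase a).erase b with hR
  have hsplit : ∀ F : Fin n → Fin n → ℤ, ∑ i, ∑ j, F i j =
      F a a + F a b + F b a + F b b + ∑ c ∈ R, (F a c + F c a + F b c + F c b) +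
        ∑ i ∈ R, ∑ j ∈ R, F i j := by
    intro F
    simp only [sum_eq_pair_add hab, ← hR]
    simp only [Finset.sum_add_distrib]
    ring
  rw [southWest_eq, southWest_eq, hsplit, hsplit]
  have hmem : ∀ c ∈ R, c ≠ a ∧ c ≠ b := by
    intro c hc
    simp only [hR, Finset.mem_erase, Finset.mem_univ, and_true] at hc
    exact hc.symm
  have ha : dots (σ * Equiv.swap a b) a = (line a, line (σ b)) := by simp [dots]
  have hb : dots (σ * Equiv.swap a b) b = (line b, line (σ a)) := by simp [dots]
  have hc : ∀ c ∈ R, dots (σ * Equiv.swap a b) c = dots σ c := by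
    intro c hc
    have := hmem c hc
    simp [dots, Equiv.swap_apply_of_ne_of_ne this.1 this.2]
  have hRR : ∑ i ∈ R, ∑ j ∈ R, quadrant (dots (σ * Equiv.swap a b) i)
      (dots (σ * Equiv.swap a b) j) = ∑ i ∈ R, ∑ j ∈ R, quadrant (dots σ i) (dots σ j) :=
    Finset.sum_congr rfl fun i hi => Finset.sum_congr rfl fun j hj => by rw [hc i hi, hc j hj]
  have hD : ∑ c ∈ R, (quadrant (dots (σ * Equiv.swap a b) a) (dots (σ * Equiv.swap a b) c) +
        quadrant (dots (σ * Equiv.swap a b) c) (dots (σ * Equiv.swap a b) a) +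
        quadrant (dots (σ * Equiv.swap a b) b) (dots (σ * Equiv.swap a b) c) +
        quadrant (dots (σ * Equiv.swap a b) c) (dots (σ * Equiv.swap a b) b)) -
      ∑ c ∈ R, (quadrant (dots σ a) (dots σ c) + quadrant (dots σ c) (dots σ a) +
        quadrant (dots σ b) (dots σ c) + quadrant (dots σ c) (dots σ b)) =
      ∑ c ∈ R, -2 * (side2 (line a) (line b) (line c) *
        side2 (line (σ a)) (line (σ b)) (line (σ c))) := by
    rw [← Finset.sum_sub_distrib]
    refine Finset.sum_congr rfl fun c hcR => ?_
    rw [hc c hcR, ha, hb]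
    have h := hmem c hcR
    exact quadrant_corners (q := dots σ c) (line_injective.ne h.1) (line_injective.ne h.2)
      (line_injective.ne (σ.injective.ne h.1)) (line_injective.ne (σ.injective.ne h.2))
  rw [hRR, ← hD, ha, hb]
  have h3 : quadrant (line a, line (σ b)) (line a, line (σ b)) +
      quadrant (line a, line (σ b)) (line b, line (σ a)) +
      quadrant (line b, line (σ a)) (line a, line (σ b)) +
      quadrant (line b, line (σ a)) (line b, line (σ a)) -
      (quadrant (dots σ a) (dots σ a) + quadrant (dots σ a) (dots σ b) +
        quadrant (dots σ b) (dots σ a) + quadrant (dots σ b) (dots σ b)) =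
      -((1 - 2 * wraps a b) * (1 - 2 * wraps (σ a) (σ b))) := by
    have hl : ∀ c d : Fin n, line c < line d ↔ c < d := fun c d => by
      rw [Fin.lt_def]; unfold line; omega
    simp only [quadrant, dots, wraps, hl, lt_irrefl]
    rcases lt_or_gt_of_ne hab with h1 | h1 <;>
      rcases lt_or_gt_of_ne (σ.injective.ne hab) with h2 | h2 <;>
      simp [h1, h2, h1.asymm, h2.asymm]
  linear_combination h3

/-- The change of the number of pairs of a dot and a decoration in the south-west relation when the
corners of a rectangle are exchanged. -/
theorem southWest_mixed_swap {σ : Equiv.Perm (Fin n)} {a b : Fin n} (hab : a ≠ b)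
    {B : Fin n → ℤ × ℤ} {u v : Fin n → Fin n} (hB : ∀ k, B k = (strip (u k), strip (v k))) :
    ((southWest (dots (σ * Equiv.swap a b)) B + southWest B (dots (σ * Equiv.swap a b)) : ℕ) : ℤ) -
        ((southWest (dots σ) B + southWest B (dots σ) : ℕ) : ℤ) =
      ∑ k, -2 * (side2 (line a) (line b) (strip (u k)) *
        side2 (line (σ a)) (line (σ b)) (strip (v k))) := by
  push_cast
  have e : ∀ τ : Equiv.Perm (Fin n), (southWest (dots τ) B : ℤ) + southWest B (dots τ) =
      ∑ k, ∑ i, (quadrant (dots τ i) (B k) + quadrant (B k) (dots τ i)) := by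
    intro τ
    rw [southWest_eq, southWest_eq, Finset.sum_comm, ← Finset.sum_add_distrib]
    exact Finset.sum_congr rfl fun k _ => Finset.sum_add_distrib.symm
  rw [e, e, ← Finset.sum_sub_distrib]
  refine Finset.sum_congr rfl fun k _ => ?_
  rw [sum_eq_pair_add hab, sum_eq_pair_add hab]
  have ha : dots (σ * Equiv.swap a b) a = (line a, line (σ b)) := by simp [dots]
  have hb : dots (σ * Equiv.swap a b) b = (line b, line (σ a)) := by simp [dots]
  have hc : ∑ i ∈ (Finset.univ.erase a).erase b, (quadrant (dots (σ * Equiv.swap a b) i) (B k) +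
      quadrant (B k) (dots (σ * Equiv.swap a b) i)) =
      ∑ i ∈ (Finset.univ.erase a).erase b, (quadrant (dots σ i) (B k) +
        quadrant (B k) (dots σ i)) := by
    refine Finset.sum_congr rfl fun c hc => ?_
    simp only [Finset.mem_erase, Finset.mem_univ, and_true] at hc
    have : dots (σ * Equiv.swap a b) c = dots σ c := by
      simp [dots, Equiv.swap_apply_of_ne_of_ne hc.2 hc.1]
    rw [this]
  have h := quadrant_corners (q := B k) (l := line a) (u := line b) (l' := line (σ a))
    (u' := line (σ b)) (by rw [hB]; exact (line_ne_strip _ _).symm)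
    (by rw [hB]; exact (line_ne_strip _ _).symm) (by rw [hB]; exact (line_ne_strip _ _).symm)
    (by rw [hB]; exact (line_ne_strip _ _).symm)
  rw [hc, ha, hb]
  have h' : side2 (line a) (line b) (strip (u k)) * side2 (line (σ a)) (line (σ b)) (strip (v k)) =
      side2 (line a) (line b) (B k).1 * side2 (line (σ a)) (line (σ b)) (B k).2 := by
    rw [hB]
  rw [h']
  unfold dots at *
  linear_combination h

/-- An empty rectangle changes the Maslov grading by twice the number of the decorations it
contains, minus one. -/
theorem relMaslov_swap {σ : Equiv.Perm (Fin n)} {a b : Fin n} (hab : a ≠ b)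
    (he : RectEmpty σ a b) {B : Fin n → ℤ × ℤ} {u v : Fin n → Fin n}
    (hB : ∀ k, B k = (strip (u k), strip (v k))) (hu : u.Bijective) (hv : v.Bijective) :
    relMaslov (dots (σ * Equiv.swap a b)) B - 2 * ∑ k, (rectDomain σ a b (u k, v k) : ℤ) =
      relMaslov (dots σ) B - 1 := by
  have h1 := southWest_dots_swap (σ := σ) hab
  have h2 := southWest_mixed_swap (σ := σ) hab hB
  have hσ : σ a ≠ σ b := σ.injective.ne hab
  set w₁ := wraps a b with hw₁
  set w₂ := wraps (σ a) (σ b) with hw₂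
  set R := (Finset.univ.erase a).erase b with hR
  have s1 : ∑ c ∈ R, side2 (line a) (line b) (line c) = b - a - (1 - 2 * w₁) := sum_side2_erase hab
  have s2 : ∑ c ∈ R, side2 (line (σ a)) (line (σ b)) (line (σ c)) =
      (σ b : Fin n) - (σ a : Fin n) - (1 - 2 * w₂) := by
    rw [hw₂, ← sum_side2_erase hσ]
    refine Finset.sum_bij (fun c _ => σ c) ?_ (fun _ _ _ _ h => σ.injective h) ?_ (fun _ _ => rfl)
    · intro c hc
      simpa [hR] using hc
    · intro c hc
      exact ⟨σ.symm c, by simpa [hR, Equiv.symm_apply_eq] using hc, by simp⟩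
  have s3 : ∑ k, side2 (line a) (line b) (strip (u k)) = b - a := by
    rw [← sum_side2_strip]
    exact (Equiv.ofBijective u hu).sum_comp fun c => side2 (line a) (line b) (strip c)
  have s4 : ∑ k, side2 (line (σ a)) (line (σ b)) (strip (v k)) = (σ b : Fin n) - (σ a : Fin n) := by
    rw [← sum_side2_strip]
    exact (Equiv.ofBijective v hv).sum_comp fun c => side2 (line (σ a)) (line (σ b)) (strip c)
  have hcard : (R.card : ℤ) = n - 2 := by
    have : R.card = n - 1 - 1 := by
      rw [hR, Finset.card_erase_of_mem (by simpa using hab.symm),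
        Finset.card_erase_of_mem (Finset.mem_univ _), Finset.card_univ, Fintype.card_fin]
    have h3 : (a : ℕ) ≠ b := fun h' => hab (Fin.ext h')
    have := a.2
    have := b.2
    omega
  -- No other dot is in the rectangle: for each of them, one of the two factors
  -- `side2 + wraps` vanishes.
  have e1 : ∑ c ∈ R, side2 (line a) (line b) (line c) *
        side2 (line (σ a)) (line (σ b)) (line (σ c)) =
      -w₁ * (∑ c ∈ R, side2 (line (σ a)) (line (σ b)) (line (σ c))) -
        w₂ * (∑ c ∈ R, side2 (line a) (line b) (line c)) - R.card * (w₁ * w₂) := by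
    rw [Finset.mul_sum, Finset.mul_sum, ← Finset.sum_sub_distrib, ← nsmul_eq_mul,
      ← Finset.sum_const, ← Finset.sum_sub_distrib]
    refine Finset.sum_congr rfl fun c hc => ?_
    simp only [hR, Finset.mem_erase, Finset.mem_univ, and_true] at hc
    have i1 := side2_line_eq hab hc.2 hc.1
    have i2 := side2_line_eq hσ (σ.injective.ne hc.2) (σ.injective.ne hc.1)
    have hz : (side2 (line a) (line b) (line c) + w₁) *
        (side2 (line (σ a)) (line (σ b)) (line (σ c)) + w₂) = 0 := by
      rw [i1, i2]
      have := rectEmpty_iff.1 he c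
      by_cases h : Cyc a c b
      · rw [if_neg (fun h' => this ⟨h, h'⟩), mul_zero]
      · rw [if_neg h, zero_mul]
    linear_combination hz
  -- For a decoration, the product of these factors tells whether it is in the rectangle.
  have e2 : ∑ k, side2 (line a) (line b) (strip (u k)) *
        side2 (line (σ a)) (line (σ b)) (strip (v k)) =
      ∑ k, (rectDomain σ a b (u k, v k) : ℤ) -
        w₁ * (∑ k, side2 (line (σ a)) (line (σ b)) (strip (v k))) -
        w₂ * (∑ k, side2 (line a) (line b) (strip (u k))) - n * (w₁ * w₂) := by
    have hn : (n : ℤ) * (w₁ * w₂) = ∑ _k : Fin n, w₁ * w₂ := by simp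
    rw [Finset.mul_sum, Finset.mul_sum, hn, ← Finset.sum_sub_distrib, ← Finset.sum_sub_distrib,
      ← Finset.sum_sub_distrib]
    refine Finset.sum_congr rfl fun k _ => ?_
    have i1 := side2_strip_eq hab (u k)
    have i2 := side2_strip_eq hσ (v k)
    rw [rectDomain_eq]
    push_cast
    rw [← i1, ← i2]
    ring
  rw [← Finset.mul_sum, e1, s1, s2, hcard] at h1
  rw [← Finset.mul_sum, e2, s3, s4] at h2
  unfold relMaslov
  push_cast at h2
  linear_combination h1 - h2

open Classical in
theorem IsSingularGrid.relMaslov_of_regular (hG : G.IsSingularGrid) (hs : G.sing = ∅) {x y : G.Gen}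
    {π : Polygon n} (h : G.IsPolygon W P x y π) (t : Kind) :
    relMaslov (dots y.2) (G.decos t) - 2 * ((Finset.univ.filter (In W P x π t)).card : ℤ) =
      relMaslov (dots x.2) (G.decos t) - 1 := by
  obtain ⟨u, hu, hu'⟩ := hG.exists_strip hs .col t
  obtain ⟨v, hv, hv'⟩ := hG.exists_strip hs .row t
  have hB : ∀ k, G.decos t k = (strip (u k), strip (v k)) := fun k => by
    rw [← hu', ← hv']; rfl
  rw [h.target_perm, ← relMaslov_swap h.ne h.empty hB hu hv, Finset.card_filter]
  push_cast
  congr 2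
  refine Finset.sum_congr rfl fun k _ => ?_
  unfold In
  rw [contains_of_regular hs (hu' k) (hv' k)]
  have h01 : rectDomain x.2 π.west π.east (u k, v k) = 0 ∨
      rectDomain x.2 π.west π.east (u k, v k) = 1 := by
    unfold rectDomain; split_ifs <;> simp
  rcases h01 with h | h <;> rw [h] <;> simp

end Grid

namespace Grid

variable {G : Grid n} {W : Dir → Deco n → Fin n} {P : Circ n → Deco n} {C : Circ n → Compass}

/-! ### The Maslov grading and the change of a resolution -/

theorem relMaslov_comp_equiv {ι ι' κ : Type} [Fintype ι] [Fintype ι'] [Fintype κ] (e : ι' ≃ ι)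
    (A : ι → ℤ × ℤ) (B : κ → ℤ × ℤ) : relMaslov (A ∘ e) B = relMaslov A B := by
  have h1 : southWest (A ∘ e) (A ∘ e) = southWest A A := by
    refine Finset.card_equiv (e.prodCongr e) fun p => ?_
    simp
  have h2 : southWest (A ∘ e) B = southWest A B := by
    refine Finset.card_equiv (e.prodCongr (Equiv.refl _)) fun p => ?_
    simp
  have h3 : southWest B (A ∘ e) = southWest B A := by
    refine Finset.card_equiv ((Equiv.refl _).prodCongr e) fun p => ?_
    simp
  unfold relMaslov
  rw [h1, h2, h3]

theorem relMaslov_swap_coord {ι κ : Type} [Fintype ι] [Fintype κ]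
    (A : ι → ℤ × ℤ) (B : κ → ℤ × ℤ) :
    relMaslov (fun i => (A i).swap) (fun k => (B k).swap) = relMaslov A B := by
  unfold relMaslov southWest
  simp only [Prod.fst_swap, Prod.snd_swap, and_comm]

/-- The symmetry of the Maslov grading that exchanges rows and columns. -/
theorem relMaslov_dots_symm (σ : Equiv.Perm (Fin n)) (B : Fin n → ℤ × ℤ) :
    relMaslov (dots σ) B = relMaslov (dots σ.symm) fun k => (B k).swap := by
  rw [← relMaslov_swap_coord, ← relMaslov_comp_equiv σ (dots σ.symm)]
  congr 1
  funext i
  simp [dots]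

/-- The change of the Maslov grading when two decorations on the two sides of the circle `i` change
sides. Only the dot on this circle and the two decorations themselves matter. -/
theorem relMaslov_exchange (τ : Equiv.Perm (Fin n)) {i : Fin n} {B B' : Fin n → ℤ × ℤ}
    {k l : Fin n} (hkl : k ≠ l) (hk : (B k).1 = line i + 1) (hl : (B l).1 = line i - 1)
    (hk' : (B' k).1 = line i - 1) (hl' : (B' l).1 = line i + 1) (hk2 : (B' k).2 = (B k).2)
    (hl2 : (B' l).2 = (B l).2) (hok : Odd (B k).2) (hol : Odd (B l).2) (hne : (B k).2 ≠ (B l).2)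
    (hB : ∀ j, j ≠ k → j ≠ l → B' j = B j ∧ ((B j).1 < line i - 1 ∨ line i + 1 < (B j).1)) :
    relMaslov (dots τ) B' - relMaslov (dots τ) B =
      2 * ((if (B l).2 < line (τ i) then 1 else 0) - (if (B k).2 < line (τ i) then 1 else 0)) + 1 -
        2 * (if (B l).2 < (B k).2 then 1 else 0) := by
  have e1 : B k = (line i + 1, (B k).2) := Prod.ext hk rfl
  have e2 : B l = (line i - 1, (B l).2) := Prod.ext hl rfl
  have e3 : B' k = (line i - 1, (B k).2) := Prod.ext hk' hk2
  have e4 : B' l = (line i + 1, (B l).2) := Prod.ext hl' hl2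
  generalize (B k).2 = v at *
  generalize (B l).2 = w at *
  set R := (Finset.univ.erase k).erase l with hR
  have hmem : ∀ c ∈ R, c ≠ k ∧ c ≠ l := by
    intro c hc
    simp only [hR, Finset.mem_erase, Finset.mem_univ, and_true] at hc
    exact hc.symm
  -- The dots.
  have hdots : ∀ D : Fin n → ℤ × ℤ, (southWest (dots τ) D : ℤ) + southWest D (dots τ) =
      ∑ c, (∑ j ∈ R, (quadrant (D j) (dots τ c) + quadrant (dots τ c) (D j)) +
        (quadrant (D k) (dots τ c) + quadrant (dots τ c) (D k) +
        (quadrant (D l) (dots τ c) + quadrant (dots τ c) (D l)))) := by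
    intro D
    rw [southWest_eq, southWest_eq, Finset.sum_comm (s := Finset.univ) (t := Finset.univ)
      (f := fun i j => quadrant (D i) (dots τ j)), ← Finset.sum_add_distrib]
    refine Finset.sum_congr rfl fun c _ => ?_
    rw [← Finset.sum_add_distrib, sum_eq_pair_add hkl, ← hR, add_comm]
    congr 1
    · exact Finset.sum_congr rfl fun j _ => add_comm _ _
    · ring
  have hmixed : ((southWest (dots τ) B' : ℤ) + southWest B' (dots τ)) -
      (southWest (dots τ) B + southWest B (dots τ)) =
      -2 * ((if w < line (τ i) then 1 else 0) - (if v < line (τ i) then 1 else 0)) := by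
    rw [hdots, hdots, ← Finset.sum_sub_distrib]
    have hc : ∀ c, (∑ j ∈ R, (quadrant (B' j) (dots τ c) + quadrant (dots τ c) (B' j)) +
        (quadrant (B' k) (dots τ c) + quadrant (dots τ c) (B' k) +
        (quadrant (B' l) (dots τ c) + quadrant (dots τ c) (B' l)))) -
        (∑ j ∈ R, (quadrant (B j) (dots τ c) + quadrant (dots τ c) (B j)) +
        (quadrant (B k) (dots τ c) + quadrant (dots τ c) (B k) +
        (quadrant (B l) (dots τ c) + quadrant (dots τ c) (B l)))) =
        -2 * (side2 (line i - 1) (line i + 1) (line c) * side2 w v (line (τ c))) := by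
      intro c
      have hrest : ∑ j ∈ R, (quadrant (B' j) (dots τ c) + quadrant (dots τ c) (B' j)) =
          ∑ j ∈ R, (quadrant (B j) (dots τ c) + quadrant (dots τ c) (B j)) :=
        Finset.sum_congr rfl fun j hj => by rw [(hB j (hmem j hj).1 (hmem j hj).2).1]
      have hp : ∀ (a : ℤ) (b : Fin n), Odd a → line b ≠ a := fun a b ha h =>
        Int.not_even_iff_odd.2 ha (h ▸ even_line b)
      have h := quadrant_corners (q := dots τ c) (l := line i - 1) (u := line i + 1) (l' := w)
        (u' := v) (hp _ _ ((even_line i).sub_odd odd_one)) (hp _ _ ((even_line i).add_odd odd_one))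
        (hp _ _ hol) (hp _ _ hok)
      rw [hrest, e1, e2, e3, e4]
      simp only [dots] at h ⊢
      linear_combination h
    rw [Finset.sum_congr rfl fun c _ => hc c, Finset.sum_eq_single i]
    · unfold side2
      rw [if_pos (by omega), if_neg (by omega)]
      ring
    · intro c _ hci
      have hci : (c : ℕ) ≠ i := fun h => hci (Fin.ext h)
      have : side2 (line i - 1) (line i + 1) (line c) = 0 := by
        unfold side2 line
        split_ifs <;> omega
      rw [this]; ring
    · simp
  -- The decorations.
  have hself : (southWest B' B' : ℤ) - southWest B B = 1 - 2 * (if w < v then 1 else 0) := by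
    have hsplit : ∀ F : Fin n → Fin n → ℤ, ∑ i, ∑ j, F i j =
        F k k + F k l + F l k + F l l + ∑ c ∈ R, (F k c + F c k + (F l c + F c l)) +
          ∑ i ∈ R, ∑ j ∈ R, F i j := by
      intro F
      simp only [sum_eq_pair_add hkl, ← hR]
      simp only [Finset.sum_add_distrib]
      ring
    rw [southWest_eq, southWest_eq, hsplit, hsplit]
    have hRR : ∑ i ∈ R, ∑ j ∈ R, quadrant (B' i) (B' j) = ∑ i ∈ R, ∑ j ∈ R, quadrant (B i) (B j) :=
      Finset.sum_congr rfl fun i hi => Finset.sum_congr rfl fun j hj => by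
        rw [(hB i (hmem i hi).1 (hmem i hi).2).1, (hB j (hmem j hj).1 (hmem j hj).2).1]
    have hone : ∑ c ∈ R, (quadrant (B' k) (B' c) + quadrant (B' c) (B' k) +
        (quadrant (B' l) (B' c) + quadrant (B' c) (B' l))) =
        ∑ c ∈ R, (quadrant (B k) (B c) + quadrant (B c) (B k) +
        (quadrant (B l) (B c) + quadrant (B c) (B l))) := by
      refine Finset.sum_congr rfl fun c hc => ?_
      obtain ⟨h1, h2⟩ := hB c (hmem c hc).1 (hmem c hc).2
      rw [h1, e1, e2, e3, e4]
      unfold quadrant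
      rcases h2 with h2 | h2
      · simp only [show ¬ line i - 1 < (B c).1 by omega, show ¬ line i + 1 < (B c).1 by omega,
          show (B c).1 < line i - 1 by omega, show (B c).1 < line i + 1 by omega]
      · simp only [show line i - 1 < (B c).1 by omega, show line i + 1 < (B c).1 by omega,
          show ¬ (B c).1 < line i - 1 by omega, show ¬ (B c).1 < line i + 1 by omega]
    rw [hRR, hone, e1, e2, e3, e4]
    have h4 : quadrant (line i - 1, v) (line i - 1, v) + quadrant (line i - 1, v) (line i + 1, w) +
        quadrant (line i + 1, w) (line i - 1, v) + quadrant (line i + 1, w) (line i + 1, w) -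
        (quadrant (line i + 1, v) (line i + 1, v) + quadrant (line i + 1, v) (line i - 1, w) +
          quadrant (line i - 1, w) (line i + 1, v) + quadrant (line i - 1, w) (line i - 1, w)) =
        1 - 2 * (if w < v then 1 else 0) := by
      have h5 : line i - 1 < line i + 1 := by omega
      unfold quadrant
      rcases lt_or_gt_of_ne hne with h | h <;> simp [h, h.asymm, h5, h5.asymm]
    linear_combination h4
  unfold relMaslov
  linear_combination hself - hmixed

/-! ### The place of a peak -/

theorem IsSingularGrid.exists_rank (hG : G.IsSingularGrid) {κ : Dir} {i : Fin n}
    (hi : (κ, i) ∈ G.sing) {m : ℕ} (hm : m < 4) :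
    ∃ d : Deco n, G.coord κ d = line i ∧ G.rank κ d = m := by
  classical
  set S := Finset.univ.filter fun d : Deco n => G.coord κ d = line i with hS
  have hc : G.IsCenter κ (line i) := Or.inl ⟨i, hi, rfl⟩
  have hcard : S.card = 4 := by
    rw [hS, card_roc, hG.singular κ .O _ hc (even_line i), hG.singular κ .X _ hc (even_line i)]
  have himg : S.image (G.rank κ) = Finset.range 4 := by
    refine Finset.eq_of_subset_of_card_le ?_ ?_
    · intro m hm
      obtain ⟨d, hd, rfl⟩ := Finset.mem_image.1 hm
      exact Finset.mem_range.2 (hG.rank_lt_four hi (by simpa [hS] using hd))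
    · rw [Finset.card_image_of_injOn, hcard, Finset.card_range]
      intro d hd e he h
      simp only [hS, Finset.coe_filter, Finset.mem_univ, true_and, Set.mem_ofPred_eq] at hd he
      exact hG.rank_injOn (hd.trans he.symm) h
  have : m ∈ S.image (G.rank κ) := by rw [himg]; exact Finset.mem_range.2 hm
  obtain ⟨d, hd, rfl⟩ := Finset.mem_image.1 this
  exact ⟨d, by simpa [hS] using hd, rfl⟩

theorem Kind.eq_of_ne_of_ne {s t u : Kind} (h : s ≠ u) (h' : t ≠ u) : s = t := by
  cases s <;> cases t <;> cases u <;> simp_all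

/-- In the `0`-resolution, the decoration that a peak is named after is on the low side and the next
one on the high side. -/
theorem IsEnhanced.isLow_peak (hG : G.IsEnhanced W P C) {κ : Dir} {i : Fin n}
    (hi : (κ, i) ∈ G.sing) : G.IsLow κ (P (κ, i)) ∧ ∃ e, G.coord κ e = line i ∧
      G.IsNext κ (P (κ, i)) e ∧ (P (κ, i)).1 ≠ e.1 ∧ ¬ G.IsLow κ e := by
  have hg := hG.grid
  obtain ⟨hp, hpe⟩ := hG.peaks κ i hi
  set p := P (κ, i) with hpdef
  obtain ⟨d0, c0, r0⟩ := hg.exists_rank hi (m := 0) (by omega)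
  obtain ⟨d1, c1, r1⟩ := hg.exists_rank hi (m := 1) (by omega)
  obtain ⟨d2, c2, r2⟩ := hg.exists_rank hi (m := 2) (by omega)
  obtain ⟨d3, c3, r3⟩ := hg.exists_rank hi (m := 3) (by omega)
  have hlt := fun {d e : Deco n} (hd : G.coord κ d = line i) (he : G.coord κ e = line i) =>
    hg.rank_lt_rank_iff (hd.trans he.symm)
  have hinj : ∀ {d e : Deco n}, G.coord κ d = line i → G.coord κ e = line i →
      G.rank κ d = G.rank κ e → d = e := fun hd he => hg.rank_injOn (hd.trans he.symm)
  have k02 : d2.1 ≠ d0.1 := hg.pattern κ _ _ (c2.trans c0.symm) (by omega)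
  have k13 : d3.1 ≠ d1.1 := hg.pattern κ _ _ (c3.trans c1.symm) (by omega)
  -- The decorations are `d0`, `d1`, `d2`, `d3` from the top, and those two steps apart are of
  -- different kinds; the low ones have even rank if `d0` and `d1` are of the same kind, odd rank
  -- otherwise.
  have hst : G.SameTop κ (line i) ↔ d0.1 = d1.1 := by
    constructor
    · rintro ⟨d, e, hd, he, hrd, hre, h⟩
      rwa [hinj hd c0 (hrd.trans r0.symm), hinj he c1 (hre.trans r1.symm)] at h
    · exact fun h => ⟨d0, d1, c0, c1, r0, r1, h⟩
  -- The decoration of rank `b` follows the one of rank `a`.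
  have hnext : ∀ {a b : Deco n}, G.coord κ a = line i → G.coord κ b = line i →
      (G.rank κ a = G.rank κ b + 1 ∨ G.rank κ a = 0 ∧ G.rank κ b = 3) → G.IsNext κ a b := by
    intro a b ha hb hab
    refine ⟨?_, ha.trans hb.symm, ?_⟩
    · rintro rfl; omega
    · intro f hf hf'
      have hfi : G.coord κ f = line i := hf'.symm.trans ha
      have hr := hg.rank_lt_four hi hfi
      have hne : G.rank κ f ≠ G.rank κ a := fun h => hf (hinj hfi ha h)
      have x1 := hlt ha hb
      have x2 := hlt ha hfi
      have x3 := hlt hb ha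
      have x4 := hlt hfi ha
      have x5 := hlt hfi hb
      have b1 := hg.coord_bounds κ.other a
      have b2 := hg.coord_bounds κ.other b
      have b3 := hg.coord_bounds κ.other f
      rw [offset_eq b1.1.le b1.2 b2.1.le b2.2, offset_eq b1.1.le b1.2 b3.1.le b3.2]
      split_ifs <;> omega
  have hlow : ∀ {a : Deco n}, G.coord κ a = line i →
      (G.IsLow κ a ↔ (Even (G.rank κ a) ↔ d0.1 = d1.1)) := fun {a} ha => by
    unfold IsLow; rw [ha, hst]
  have hr := hg.rank_lt_four hi hp
  have key : ∀ {a b : Deco n}, G.coord κ a = line i → G.coord κ b = line i →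
      (G.rank κ a = G.rank κ b + 1 ∨ G.rank κ a = 0 ∧ G.rank κ b = 3) →
      (a.1 ≠ b.1 → (Even (G.rank κ a) ↔ d0.1 = d1.1)) → p = a →
      G.IsLow κ p ∧ ∃ e, G.coord κ e = line i ∧ G.IsNext κ p e ∧ p.1 ≠ e.1 ∧ ¬ G.IsLow κ e := by
    intro a b ha hb hab h hpa
    have hn := hnext ha hb hab
    have hne := hpe b (hpa ▸ hn)
    have h1 := h (hpa ▸ hne)
    refine ⟨by rw [hpa, hlow ha]; exact h1, b, hb, hpa ▸ hn, hne, ?_⟩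
    rw [hlow hb, ← h1, Nat.even_iff, Nat.even_iff]
    omega
  have even3 : ¬ Even 3 := by decide
  rcases (show G.rank κ p = 0 ∨ G.rank κ p = 1 ∨ G.rank κ p = 2 ∨ G.rank κ p = 3 by omega) with
    h | h | h | h
  · refine key c0 c3 (by omega) (fun hne => ?_) (hinj hp c0 (h.trans r0.symm))
    simp only [r0, Even.zero, true_iff]
    exact Kind.eq_of_ne_of_ne hne k13.symm
  · refine key c1 c0 (by omega) (fun hne => ?_) (hinj hp c1 (h.trans r1.symm))
    simp [r1, hne.symm]
  · refine key c2 c1 (by omega) (fun hne => ?_) (hinj hp c2 (h.trans r2.symm))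
    simp only [r2, even_two, true_iff]
    exact Kind.eq_of_ne_of_ne k02.symm hne.symm
  · refine key c3 c2 (by omega) (fun hne => ?_) (hinj hp c3 (h.trans r3.symm))
    simp only [r3, even3, false_iff]
    intro h01
    exact k13 (Kind.eq_of_ne_of_ne hne (h01 ▸ k02.symm))

/-- The decoration `d` of the singular row or column `r` is before its peak. -/
def BelowPeak (W : Dir → Deco n → Fin n) (P : Circ n → Deco n) (G : Grid n) (r : Circ n)
    (d : Deco n) : Prop :=
  G.coord r.1.other d < strip (W r.1 (P r)) ∨
    G.coord r.1.other d = strip (W r.1 (P r)) ∧ d = P r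

/-- Going from the low decoration of a given kind to the high one in the positive direction, one
passes the peak. -/
theorem IsEnhanced.belowPeak_iff (hG : G.IsEnhanced W P C) {κ : Dir} {i : Fin n}
    (hi : (κ, i) ∈ G.sing) {t : Kind} {k l : Fin n} (hk : G.coord κ (t, k) = line i)
    (hl : G.coord κ (t, l) = line i) (hk' : ¬ G.IsLow κ (t, k)) (hl' : G.IsLow κ (t, l)) :
    (G.coord κ.other (t, l) < G.coord κ.other (t, k) →
      BelowPeak W P G (κ, i) (t, l) ∧ ¬ BelowPeak W P G (κ, i) (t, k)) ∧
    (G.coord κ.other (t, k) < G.coord κ.other (t, l) →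
      (BelowPeak W P G (κ, i) (t, l) ↔ BelowPeak W P G (κ, i) (t, k))) := by
  have hg := hG.grid
  obtain ⟨hlow, e, he, hnext, hkind, hhigh⟩ := hG.isLow_peak hi
  have hp : G.coord κ (P (κ, i)) = line i := (hG.peaks κ i hi).1
  have hW := hG.arcs κ i hi _ e hp hnext
  have hmin := hnext.2.2
  have uniq : ∀ {f : Deco n} {j : Fin n}, G.coord κ f = line i → G.coord κ (t, j) = line i →
      f.1 = t → (G.IsLow κ f ↔ G.IsLow κ (t, j)) → f = (t, j) := by
    rintro ⟨s, f⟩ j hf hj rfl h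
    by_contra hne
    have hne : f ≠ j := fun h => hne (by rw [h])
    have := hg.isLow_iff_not hi hf hj hne
    tauto
  unfold BelowPeak
  simp only
  set p := P (κ, i)
  have b0 := hg.coord_bounds κ.other p
  have b1 := strip_lt (W κ p)
  have b2 := strip_nonneg (W κ p)
  have b3 := hg.coord_bounds κ.other e
  have b4 := hg.coord_bounds κ.other (t, k)
  have b5 := hg.coord_bounds κ.other (t, l)
  rw [offset_eq b0.1.le b0.2 b2 b1, offset_eq b0.1.le b0.2 b3.1.le b3.2] at hW
  have hkp : (t, k) ≠ p := fun h => hk' (h ▸ hlow)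
  have ik := hmin (t, k) hkp (hp.trans hk.symm)
  rw [offset_eq b0.1.le b0.2 b3.1.le b3.2, offset_eq b0.1.le b0.2 b4.1.le b4.2] at ik
  simp only [hkp, and_false, or_false]
  -- The peak is right after the low decoration `p` and right before the high decoration `e`; one of
  -- them is of kind `t`.
  by_cases ht : p.1 = t
  · have hpl := uniq hp hl ht (by tauto)
    rw [← hpl]
    simp only [and_true]
    split_ifs at hW ik <;> omega
  · have hek := uniq he hk (Kind.eq_of_ne_of_ne hkind.symm (Ne.symm ht)) (by tauto)
    have hlp : (t, l) ≠ p := fun h => ht (h ▸ rfl)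
    have il := hmin (t, l) hlp (hp.trans hl.symm)
    rw [offset_eq b0.1.le b0.2 b3.1.le b3.2, offset_eq b0.1.le b0.2 b5.1.le b5.2] at il
    simp only [hlp, and_false, or_false]
    rw [← hek]
    split_ifs at hW il <;> omega

end Grid

namespace Grid

variable {G : Grid n} {W : Dir → Deco n → Fin n} {P : Circ n → Deco n} {C : Circ n → Compass}

/-- The relative position of decorations with distinct coordinates does not depend on the
resolution. -/
theorem IsSingularGrid.resolve_lt_resolve (hG : G.IsSingularGrid) (I : Finset (Circ n)) {κ : Dir}
    {d e : Deco n} (h : G.coord κ d < G.coord κ e) :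
    (G.resolve G.sing I).coord κ d < (G.resolve G.sing I).coord κ e := by
  rcases hG.resolve_sub_cases I κ d with ⟨-, h1⟩ | ⟨hd, h1⟩ <;>
    rcases hG.resolve_sub_cases I κ e with ⟨-, h2⟩ | ⟨he, h2⟩
  · omega
  · obtain ⟨j, hj, hje⟩ := hG.coord_even he
    have := hG.coord_far hj d
    omega
  · obtain ⟨j, hj, hje⟩ := hG.coord_even hd
    have := hG.coord_far hj e
    omega
  · obtain ⟨j, hj, hjd⟩ := hG.coord_even hd
    obtain ⟨m, hm, hme⟩ := hG.coord_even he
    have := hG.sing_sep κ j m hj hm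
    unfold line at *
    omega

theorem IsSingularGrid.odd_resolve (hG : G.IsSingularGrid) (I : Finset (Circ n)) (κ : Dir)
    (d : Deco n) : Odd ((G.resolve G.sing I).coord κ d) := by
  have h := hG.resolve_sub_cases I κ d
  rw [Int.odd_iff, Int.even_iff] at h
  rw [Int.odd_iff]
  omega

/-- The cyclic condition `BeforeDot` in terms of the linear order. -/
theorem IsSingularGrid.beforeDot_iff (hG : G.IsSingularGrid) (x : G.Gen) (r : Circ n)
    (d : Deco n) :
    (BeforeDot W P x r d ↔
      (¬ BelowPeak W P G r d ∧
        (G.resolve G.sing x.1.1).coord r.1.other d < line (dotPlace x.2 r)) ∨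
      ((G.resolve G.sing x.1.1).coord r.1.other d < line (dotPlace x.2 r) ∧
        line (dotPlace x.2 r) < strip (W r.1 (P r))) ∨
      (line (dotPlace x.2 r) < strip (W r.1 (P r)) ∧ ¬ BelowPeak W P G r d)) ∧
    ((G.resolve G.sing x.1.1).coord r.1.other d < line (dotPlace x.2 r) →
      line (dotPlace x.2 r) < strip (W r.1 (P r)) → BelowPeak W P G r d) ∧
    (¬ (G.resolve G.sing x.1.1).coord r.1.other d < line (dotPlace x.2 r) →
      ¬ line (dotPlace x.2 r) < strip (W r.1 (P r)) → ¬ BelowPeak W P G r d) := by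
  have hw : (BelowPeak W P G r d ∧ (G.coord r.1.other d < strip (W r.1 (P r)) ∧
        (G.finePeak W P r d = 4 * strip (W r.1 (P r)) - 1 ∨
          G.finePeak W P r d = 4 * strip (W r.1 (P r)) + 1) ∨
        G.coord r.1.other d = strip (W r.1 (P r)) ∧
          G.finePeak W P r d = 4 * strip (W r.1 (P r)) + 1)) ∨
      ¬ BelowPeak W P G r d ∧ strip (W r.1 (P r)) ≤ G.coord r.1.other d ∧
        G.finePeak W P r d = 4 * strip (W r.1 (P r)) - 1 := by
    unfold finePeak BelowPeak
    by_cases h1 : G.coord r.1.other d = strip (W r.1 (P r))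
    · by_cases h2 : d = P r
      · rw [h2] at h1
        simp [h1, h2]
      · simp [h1, h2]; omega
    · simp only [h1, false_and, if_false, or_false]
      omega
  unfold BeforeDot finePos
  have hx := hG.resolve_sub_cases x.1.1 r.1.other d
  have b1 := hG.coord_bounds r.1.other d
  have b2 := line_lt (dotPlace x.2 r)
  have b3 := line_nonneg (dotPlace x.2 r)
  have b4 := strip_lt (W r.1 (P r))
  have b5 := strip_nonneg (W r.1 (P r))
  have b6 := even_line (dotPlace x.2 r)
  have b7 := odd_strip (W r.1 (P r))
  rw [Int.even_iff] at b6 hx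
  rw [Int.odd_iff] at b7 hx
  generalize BelowPeak W P G r d = Q at *
  generalize G.finePeak W P r d = f at *
  generalize (G.resolve G.sing x.1.1).coord r.1.other d = v at *
  generalize G.coord r.1.other d = c at *
  generalize strip (W r.1 (P r)) = w at *
  generalize line (dotPlace x.2 r) = l at *
  have e0 : 0 < f ∧ f < 8 * n := by omega
  have e1 : f < 4 * l ↔ w < l := by omega
  have e2 : 4 * c + (v - c) < 4 * l ↔ v < l := by omega
  have e3 : 4 * c + (v - c) < f ↔ Q := by
    rcases hw with ⟨h, hw⟩ | ⟨h, hw⟩ <;> simp only [h, iff_true, iff_false] <;> omega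
  have e4 : f ≠ 4 * c + (v - c) := by omega
  rw [btw_iff (n := 4 * n) (by omega) (by push_cast; omega) (by omega) (by push_cast; omega)
      (by omega) (by push_cast; omega)]
  rw [← e3, ← e2]
  omega

/-- The grading change of `relMaslov_exchange` in terms of the gauge factor, when the high
decoration precedes the low one. Here `A` and `B` say that the high and the low decoration are
between the peak and the dot, `Q` and `Q'` that they precede the peak, `V` and `V'` that they
precede the dot, and `H` that the dot precedes the peak. -/
theorem gauge_card_of_iff {A B Q Q' V V' H : Prop} [Decidable A] [Decidable B] [Decidable V]
    [Decidable V'] (a1 : A ↔ ¬ Q ∧ V ∨ V ∧ H ∨ H ∧ ¬ Q) (a2 : V → H → Q) (a3 : ¬ V → ¬ H → ¬ Q)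
    (b1 : B ↔ ¬ Q' ∧ V' ∨ V' ∧ H ∨ H ∧ ¬ Q') (b2 : V' → H → Q') (b3 : ¬ V' → ¬ H → ¬ Q')
    (q : Q' ↔ Q) :
    2 * ((if V' then (1 : ℤ) else 0) - (if V then 1 else 0)) + 1 - 2 * 0 =
      2 * ((if B then 1 else 0) + (if A then 0 else 1)) - 1 := by
  by_cases Q <;> by_cases Q' <;> by_cases V <;> by_cases V' <;> by_cases H <;> simp_all

/-- The same when the low decoration precedes the high one; then the peak is between them. -/
theorem gauge_card_of_and {A B Q Q' V V' H : Prop} [Decidable A] [Decidable B] [Decidable V]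
    [Decidable V'] (a1 : A ↔ ¬ Q ∧ V ∨ V ∧ H ∨ H ∧ ¬ Q) (a2 : V → H → Q) (a3 : ¬ V → ¬ H → ¬ Q)
    (b1 : B ↔ ¬ Q' ∧ V' ∨ V' ∧ H ∨ H ∧ ¬ Q') (b2 : V' → H → Q') (b3 : ¬ V' → ¬ H → ¬ Q')
    (q : Q' ∧ ¬ Q) :
    2 * ((if V' then (1 : ℤ) else 0) - (if V then 1 else 0)) + 1 - 2 * 1 =
      2 * ((if B then 1 else 0) + (if A then 0 else 1)) - 1 := by
  by_cases Q <;> by_cases Q' <;> by_cases V <;> by_cases V' <;> by_cases H <;> simp_all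

open Classical in
/-- The Maslov grading of a generator of the module of `G_-` compared with that of the
corresponding generator of the module of `G_+`, in terms of the gauge factor. -/
theorem IsEnhanced.relMaslov_insert (hG : G.IsEnhanced W P C) {r : Circ n} (hr : r ∈ G.sing)
    (x : G.Gen) (hx : r ∉ x.1.1) (t : Kind) :
    relMaslov (dots x.2) ((G.resolve G.sing (insert r x.1.1)).decos t) =
      relMaslov (dots x.2) ((G.resolve G.sing x.1.1).decos t) +
        2 * ((Finset.univ.filter (GaugeAt W P x t r)).card : ℤ) - 1 := by
  obtain ⟨κ, i⟩ := r
  have hg := hG.grid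
  obtain ⟨k, l, hkl, hk, hl, hk', hl', hall⟩ := hg.exists_pair hr t
  set I := x.1.1 with hI
  set v := (G.resolve G.sing I).coord κ.other (t, k) with hv
  set w := (G.resolve G.sing I).coord κ.other (t, l) with hw
  set h := line (dotPlace x.2 (κ, i)) with hh
  have hother : ∀ d, (G.resolve G.sing (insert (κ, i) I)).coord κ.other d =
      (G.resolve G.sing I).coord κ.other d := by
    intro d
    by_cases hd : ∃ j, (κ.other, j) ∈ G.sing ∧ G.coord κ.other d = line j
    · obtain ⟨j, hj, hd⟩ := hd
      rw [resolve_coord_of_mem hd hj, resolve_coord_of_mem hd hj]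
      refine shifted_congr ?_
      simp [Dir.other_ne]
    · rw [resolve_coord_of_odd hd, resolve_coord_of_odd hd]
  have ck : (G.resolve G.sing I).coord κ (t, k) = line i + 1 := by
    rw [resolve_coord_of_mem hk hr, shifted_of_high (by tauto), hk]
  have cl : (G.resolve G.sing I).coord κ (t, l) = line i - 1 := by
    rw [resolve_coord_of_mem hl hr, shifted_of_low (by tauto), hl]
  have ck' : (G.resolve G.sing (insert (κ, i) I)).coord κ (t, k) = line i - 1 := by
    rw [resolve_coord_of_mem hk hr, shifted_of_low (by simp [hk']), hk]
  have cl' : (G.resolve G.sing (insert (κ, i) I)).coord κ (t, l) = line i + 1 := by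
    rw [resolve_coord_of_mem hl hr, shifted_of_high (by simp [hl']), hl]
  have cj : ∀ j, j ≠ k → j ≠ l → (G.resolve G.sing (insert (κ, i) I)).coord κ (t, j) =
      (G.resolve G.sing I).coord κ (t, j) ∧ ((G.resolve G.sing I).coord κ (t, j) < line i - 1 ∨
        line i + 1 < (G.resolve G.sing I).coord κ (t, j)) := by
    intro j hjk hjl
    have hne : G.coord κ (t, j) ≠ line i := fun h => by
      rcases hall j h with h | h
      exacts [hjk h, hjl h]
    constructor
    · by_cases hd : ∃ m, (κ, m) ∈ G.sing ∧ G.coord κ (t, j) = line m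
      · obtain ⟨m, hm, hd⟩ := hd
        rw [resolve_coord_of_mem hd hm, resolve_coord_of_mem hd hm]
        refine shifted_congr ?_
        have : m ≠ i := fun h => hne (h ▸ hd)
        simp [this]
      · rw [resolve_coord_of_odd hd, resolve_coord_of_odd hd]
    · have h2 := (hg.coord_far hr (t, j)).resolve_left hne
      rcases hg.resolve_sub_cases I κ (t, j) with ⟨-, h1⟩ | ⟨he, h1⟩
      · omega
      · obtain ⟨m, hm, hd⟩ := hg.coord_even he
        have h3 := hg.sing_sep κ i m hr hm
        have h4 := hg.sing_sep κ m i hm hr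
        unfold line at *
        omega
  have hcne : G.coord κ.other (t, k) ≠ G.coord κ.other (t, l) := fun h =>
    hkl (by simpa using hg.eq_of_coord κ (hk.trans hl.symm) h)
  have hvw : (G.coord κ.other (t, k) < G.coord κ.other (t, l) ∧ v < w) ∨
      (G.coord κ.other (t, l) < G.coord κ.other (t, k) ∧ w < v) := by
    rcases lt_or_gt_of_ne hcne with h | h
    · exact Or.inl ⟨h, hg.resolve_lt_resolve I h⟩
    · exact Or.inr ⟨h, hg.resolve_lt_resolve I h⟩
  -- The change of the resolution moves the high decoration `k` and the low decoration `l` across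
  -- the circle, and nothing else.
  have hM : relMaslov (dots x.2) ((G.resolve G.sing (insert (κ, i) I)).decos t) -
      relMaslov (dots x.2) ((G.resolve G.sing I).decos t) =
      2 * ((if w < h then 1 else 0) - (if v < h then 1 else 0)) + 1 -
        2 * (if w < v then 1 else 0) := by
    have hov : Odd v := hg.odd_resolve I κ.other (t, k)
    have how : Odd w := hg.odd_resolve I κ.other (t, l)
    have hne : v ≠ w := by omega
    cases κ
    · exact relMaslov_exchange x.2 hkl ck cl ck' cl' (hother _) (hother _) hov how hne
        fun j h1 h2 => ⟨Prod.ext (cj j h1 h2).1 (hother _), (cj j h1 h2).2⟩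
    · rw [relMaslov_dots_symm, relMaslov_dots_symm x.2]
      exact relMaslov_exchange x.2.symm hkl ck cl ck' cl' (hother _) (hother _) hov how hne
        fun j h1 h2 => ⟨Prod.ext (cj j h1 h2).1 (hother _), (cj j h1 h2).2⟩
  have hcard : ((Finset.univ.filter (GaugeAt W P x t (κ, i))).card : ℤ) =
      (if BeforeDot W P x (κ, i) (t, l) then 1 else 0) +
        (if BeforeDot W P x (κ, i) (t, k) then 0 else 1) := by
    rw [Finset.card_filter]
    push_cast
    rw [sum_eq_pair_add hkl, Finset.sum_eq_zero, add_zero, add_comm]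
    · unfold GaugeAt
      simp only [hl, hl', hk, hk', true_and, true_iff, false_iff]
      simp only [ite_not]
    · intro j hj
      simp only [Finset.mem_erase, Finset.mem_univ, and_true] at hj
      refine if_neg fun hG => ?_
      rcases hall j hG.1 with h | h
      exacts [hj.2 h, hj.1 h]
  -- What remains is a comparison of the linear orders of the two decorations, the peak and the dot.
  obtain ⟨q1, q2⟩ := hG.belowPeak_iff hr hk hl hk' hl'
  obtain ⟨a1, a2, a3⟩ := hg.beforeDot_iff (W := W) (P := P) x (κ, i) (t, k)
  obtain ⟨b1, b2, b3⟩ := hg.beforeDot_iff (W := W) (P := P) x (κ, i) (t, l)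
  rw [hcard]
  simp only [← hv, ← hw, ← hh, ← hI] at a1 a2 a3 b1 b2 b3
  generalize BelowPeak W P G (κ, i) (t, k) = Q1 at *
  generalize BelowPeak W P G (κ, i) (t, l) = Q2 at *
  generalize BeforeDot W P x (κ, i) (t, k) = B1 at *
  generalize BeforeDot W P x (κ, i) (t, l) = B2 at *
  refine (sub_eq_iff_eq_add'.1 hM).trans ?_
  rw [add_sub_assoc (relMaslov _ _)]
  refine congrArg _ ?_
  rcases hvw with ⟨c1, c2⟩ | ⟨c1, c2⟩
  · rw [if_neg c2.asymm]
    exact gauge_card_of_iff a1 a2 a3 b1 b2 b3 (q2 c1)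
  · rw [if_pos c2]
    exact gauge_card_of_and a1 a2 a3 b1 b2 b3 (q1 c1)

end Grid

namespace Grid

variable {G : Grid n} {W : Dir → Deco n → Fin n} {P : Circ n → Deco n} {C : Circ n → Compass}

/-! ### Gradings of the ends of a polygon -/

/-- The Maslov grading of a generator relative to the decorations of kind `t`. -/
noncomputable def kindMaslov (G : Grid n) (t : Kind) (x : G.Gen) : ℤ :=
  relMaslov (dots x.2) ((G.resolve G.sing x.1.1).decos t) - (x.1.1.card : ℤ)

open Classical in
/-- The number of decorations of kind `t` in a polygon. -/
noncomputable def count (W : Dir → Deco n → Fin n) (P : Circ n → Deco n) (G : Grid n) (x : G.Gen)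
    (π : Polygon n) (t : Kind) : ℕ :=
  (Finset.univ.filter (In W P x π t)).card

open Classical in
theorem Balanced.card_add_card {p q p' q' : Fin n → Prop} (h : Balanced p q p' q') :
    (Finset.univ.filter p).card + (Finset.univ.filter q).card =
      (Finset.univ.filter p').card + (Finset.univ.filter q').card := by
  simp only [Finset.card_filter]
  rw [← Finset.sum_add_distrib, ← Finset.sum_add_distrib]
  refine Finset.sum_congr rfl fun k _ => ?_
  have := h k
  by_cases h1 : p k <;> by_cases h2 : q k <;> by_cases h3 : p' k <;> by_cases h4 : q' k <;>
    simp_all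

open Classical in
theorem IsSingularGrid.card_lowAt (hG : G.IsSingularGrid) {r : Circ n} (hr : r ∈ G.sing)
    (t : Kind) : (Finset.univ.filter (G.LowAt t r)).card = 1 ∧
      (Finset.univ.filter (G.HighAt t r)).card = 1 := by
  obtain ⟨κ, i⟩ := r
  obtain ⟨k, l, -, hk, hl, hk', hl', hall⟩ := hG.exists_pair hr t
  rw [Finset.card_eq_one, Finset.card_eq_one]
  constructor
  · refine ⟨l, Finset.ext fun j => ?_⟩
    simp only [Finset.mem_filter, Finset.mem_univ, true_and, Finset.mem_singleton]
    constructor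
    · rintro ⟨h1, h2⟩
      refine (hall j h1).resolve_left ?_
      rintro rfl
      exact hk' h2
    · rintro rfl
      exact ⟨hl, hl'⟩
  · refine ⟨k, Finset.ext fun j => ?_⟩
    simp only [Finset.mem_filter, Finset.mem_univ, true_and, Finset.mem_singleton]
    constructor
    · rintro ⟨h1, h2⟩
      refine (hall j h1).resolve_right ?_
      rintro rfl
      exact h2 hl'
    · rintro rfl
      exact ⟨hk, hk'⟩

theorem IsSingularGrid.resolve_pos (hG : G.IsSingularGrid) {r : Circ n} (hr : r ∈ G.sing)
    (x : (G.pos r).Gen) : (G.pos r).resolve (G.pos r).sing x.1.1 =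
      G.resolve G.sing (G.inclPos r x).1.1 :=
  hG.resolve_resolve hr (isLift_inclPos r x).mem_iff (isLift_inclPos r x).mem_self

theorem IsSingularGrid.resolve_neg (hG : G.IsSingularGrid) {r : Circ n} (hr : r ∈ G.sing)
    (x : (G.neg r).Gen) : (G.neg r).resolve (G.neg r).sing x.1.1 =
      G.resolve G.sing (G.inclNeg hr x).1.1 :=
  hG.resolve_resolve hr (isLift_inclNeg hr x).mem_iff (isLift_inclNeg hr x).mem_self

theorem IsSingularGrid.kindMaslov_inclPos (hG : G.IsSingularGrid) {r : Circ n} (hr : r ∈ G.sing)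
    (t : Kind) (x : (G.pos r).Gen) :
    G.kindMaslov t (G.inclPos r x) = (G.pos r).kindMaslov t x := by
  unfold kindMaslov
  rw [hG.resolve_pos hr]
  rfl

theorem IsSingularGrid.kindMaslov_inclNeg (hG : G.IsSingularGrid) {r : Circ n} (hr : r ∈ G.sing)
    (t : Kind) (x : (G.neg r).Gen) :
    G.kindMaslov t (G.inclNeg hr x) = (G.neg r).kindMaslov t x - 1 := by
  have hx : r ∉ x.1.1 := fun h => (mem_resolve_sing.1 (x.1.2 h)).2 rfl
  unfold kindMaslov
  rw [hG.resolve_neg hr]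
  have : (G.inclNeg hr x).1.1.card = x.1.1.card + 1 := Finset.card_insert_of_notMem hx
  rw [this]
  push_cast
  simp only [inclNeg]
  ring

theorem IsLift.count_eq (hG : G.IsEnhanced W P C) {r : Circ n} (hr : r ∈ G.sing)
    {J : Finset (Circ n)} {x : (G.resolve {r} J).Gen} {X : G.Gen} (hX : IsLift r J x X)
    {π : Polygon n} (hπ : r ∉ π.peaks) (t : Kind) :
    count W P (G.resolve {r} J) x π t = count W P G X π t := by
  classical
  unfold count
  congr 1
  exact Finset.filter_congr fun k _ => hX.contains_iff hG hr hπ _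

theorem IsSingularGrid.kindMaslov_of_regular (hG : G.IsSingularGrid) (hs : G.sing = ∅)
    {x y : G.Gen} {π : Polygon n} (h : G.IsPolygon W P x y π) (t : Kind) :
    G.kindMaslov t y - 2 * (count W P G x π t : ℤ) = G.kindMaslov t x - 1 := by
  have h0 : ∀ z : G.Gen, G.kindMaslov t z = relMaslov (dots z.2) (G.decos t) := by
    intro z
    have hz : z.1.1 = ∅ := Finset.subset_empty.1 (hs ▸ z.1.2)
    have : (G.resolve G.sing z.1.1).decos t = G.decos t := by
      funext k
      unfold decos
      rw [resolve_coord_of_odd (by simp [hs]), resolve_coord_of_odd (by simp [hs])]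
    unfold kindMaslov
    rw [this, hz]
    simp
  rw [h0, h0]
  exact hG.relMaslov_of_regular hs h t

/-- A polygon from a generator of the module of `G_+` to one of the module of `G_-` has the peak of
`r`; without it, it is a polygon of `G_+`. -/
theorem exists_eq_addPeak {r : Circ n} (hr : r ∈ G.sing) {x : (G.pos r).Gen} {y : (G.neg r).Gen}
    {π : Polygon n} (h : G.IsPolygon W P (G.inclPos r x) (G.inclNeg hr y) π) :
    ∃ (y' : (G.pos r).Gen) (π' : Polygon n), y = toNeg r y' ∧ π = addPeak r π' ∧
      (G.pos r).IsPolygon W P x y' π' ∧ (π'.OnLow x.2 r ∨ π'.OnHigh x.2 r) ∧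
      PeakInRange W P (G.inclPos r x) π' r := by
  have hm : r ∈ π.peaks := by
    have h1 := (h.mem_target r).1 (Finset.mem_insert_self _ _)
    exact h1.resolve_left (not_mem_pos x)
  have h1 : addPeak r ⟨π.west, π.east, π.peaks.erase r⟩ = π := by
    simp [addPeak, Finset.insert_erase hm]
  have h2 : r ∉ (⟨π.west, π.east, π.peaks.erase r⟩ : Polygon n).peaks := by simp
  have h3 := h
  rw [← h1] at h3
  have h4 := (isPolygon_addPeak hr (y := ⟨⟨y.1.1, y.1.2⟩, y.2⟩) h2).1 h3
  exact ⟨⟨⟨y.1.1, y.1.2⟩, y.2⟩, ⟨π.west, π.east, π.peaks.erase r⟩, rfl, h1.symm,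
    ((isLift_inclPos r x).isPolygon_iff (isLift_inclPos r _) h2).2 h4.1, h4.2⟩

theorem IsPolygon.not_mem_peaks_of_mem {x y : G.Gen} {π : Polygon n} (h : G.IsPolygon W P x y π)
    {r : Circ n} (hr : r ∈ x.1.1 ∨ r ∉ y.1.1) : r ∉ π.peaks := fun hp => by
  rcases hr with hr | hr
  · exact h.peak_alpha r hp hr
  · exact hr ((h.mem_target r).2 (Or.inr hp))

open Classical in
/-- The grading of the ends of a polygon, by induction on the number of singular rows and columns. A
polygon with a peak is compared with the polygon deprived of this peak; both the number of
decorations and the gradings change according to the gauge factor. -/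
theorem IsEnhanced.kindMaslov_polygon (hG : G.IsEnhanced W P C) {x y : G.Gen} {π : Polygon n}
    (h : G.IsPolygon W P x y π) (t : Kind) :
    G.kindMaslov t y - 2 * (count W P G x π t : ℤ) = G.kindMaslov t x - 1 := by
  induction hm : G.sing.card generalizing G π with
  | zero => exact hG.grid.kindMaslov_of_regular (Finset.card_eq_zero.1 hm) h t
  | succ m ih =>
    have hg := hG.grid
    obtain ⟨r, hr⟩ := Finset.card_pos.1 (by omega : 0 < G.sing.card)
    have hc : ∀ J, (G.resolve {r} J).sing.card = m := by
      intro J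
      have : (G.resolve {r} J).sing = G.sing.erase r := Finset.sdiff_singleton_eq_erase _ _
      rw [this, Finset.card_erase_of_mem hr, hm]
      rfl
    obtain ⟨x | x, rfl⟩ := (G.splitGen hr).surjective x <;>
      obtain ⟨y | y, rfl⟩ := (G.splitGen hr).surjective y
    · change G.IsPolygon W P (G.inclPos r x) (G.inclPos r y) π at h
      have hp : r ∉ π.peaks := h.not_mem_peaks_of_mem (Or.inr (not_mem_pos y))
      have h1 := ih (hG.resolve hr ∅)
        (((isLift_inclPos r x).isPolygon_iff (isLift_inclPos r y) hp).2 h) (hc ∅)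
      rw [(isLift_inclPos r x).count_eq hG hr hp] at h1
      change G.kindMaslov t (G.inclPos r y) - 2 * (count W P G (G.inclPos r x) π t : ℤ) =
        G.kindMaslov t (G.inclPos r x) - 1
      rw [hg.kindMaslov_inclPos hr, hg.kindMaslov_inclPos hr]
      exact h1
    · change G.IsPolygon W P (G.inclPos r x) (G.inclNeg hr y) π at h
      change G.kindMaslov t (G.inclNeg hr y) - 2 * (count W P G (G.inclPos r x) π t : ℤ) =
        G.kindMaslov t (G.inclPos r x) - 1
      obtain ⟨y, π, rfl, rfl, h', he, hrange⟩ := exists_eq_addPeak hr h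
      have hex := exchange_of_isPolygon hr h'
      have h1 := ih (hG.resolve hr ∅) h' (hc ∅)
      rw [(isLift_inclPos r x).count_eq hG hr hex.not_mem_peaks] at h1
      -- Each half of `r` contains a single decoration of each kind, whence the summand `1`.
      have hb : (Finset.univ.filter (GaugeAt W P (G.inclPos r y) t r)).card +
          count W P G (G.inclPos r x) π t =
          1 + count W P G (G.inclPos r x) (addPeak r π) t := by
        have hcard := hg.card_lowAt hr t
        unfold count
        rcases he with he | he
        · rw [(hex.balanced_low hg t he hrange).2.card_add_card, hcard.2]
        · rw [(hex.balanced_high hg t he hrange).2.card_add_card, hcard.1]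
      have hM : relMaslov (dots y.2) ((G.resolve G.sing (insert r y.1.1)).decos t) =
          relMaslov (dots y.2) ((G.resolve G.sing y.1.1).decos t) +
            2 * ((Finset.univ.filter (GaugeAt W P (G.inclPos r y) t r)).card : ℤ) - 1 :=
        hG.relMaslov_insert hr (G.inclPos r y) (not_mem_pos y) t
      have hyc : (G.inclNeg hr (toNeg r y)).1.1.card = (G.inclPos r y).1.1.card + 1 :=
        Finset.card_insert_of_notMem (not_mem_pos y)
      have hy : G.kindMaslov t (G.inclNeg hr (toNeg r y)) = G.kindMaslov t (G.inclPos r y) +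
          2 * ((Finset.univ.filter (GaugeAt W P (G.inclPos r y) t r)).card : ℤ) - 2 := by
        unfold kindMaslov
        rw [hyc]
        push_cast
        change relMaslov (dots y.2) ((G.resolve G.sing (insert r y.1.1)).decos t) - _ =
          relMaslov (dots y.2) ((G.resolve G.sing y.1.1).decos t) - _ + _ - _
        linear_combination hM
      have e1 := hg.kindMaslov_inclPos hr t x
      have e2 := hg.kindMaslov_inclPos hr t y
      change (G.pos r).kindMaslov t y - _ = (G.pos r).kindMaslov t x - 1 at h1
      rw [hy]
      omega
    · change G.IsPolygon W P (G.inclNeg hr x) (G.inclPos r y) π at h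
      exact absurd ((h.mem_target r).2 (Or.inl (Finset.mem_insert_self _ _))) (not_mem_pos y)
    · change G.IsPolygon W P (G.inclNeg hr x) (G.inclNeg hr y) π at h
      have hp : r ∉ π.peaks := h.not_mem_peaks_of_mem (Or.inl (Finset.mem_insert_self _ _))
      have h1 := ih (hG.resolve hr {r})
        (((isLift_inclNeg hr x).isPolygon_iff (isLift_inclNeg hr y) hp).2 h) (hc {r})
      rw [(isLift_inclNeg hr x).count_eq hG hr hp] at h1
      change G.kindMaslov t (G.inclNeg hr y) - 2 * (count W P G (G.inclNeg hr x) π t : ℤ) =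
        G.kindMaslov t (G.inclNeg hr x) - 1
      rw [hg.kindMaslov_inclNeg hr, hg.kindMaslov_inclNeg hr]
      change (G.neg r).kindMaslov t y - _ = (G.neg r).kindMaslov t x - 1 at h1
      omega

/-! ### Degrees of the maps that count polygons -/

/-- Whether two decorations share a row or column of a resolution does not depend on it. -/
theorem IsSingularGrid.resolve_eq_resolve_iff (hG : G.IsSingularGrid) (I : Finset (Circ n))
    (κ : Dir) (d e : Deco n) :
    (G.resolve G.sing I).coord κ d = (G.resolve G.sing I).coord κ e ↔ G.coord κ d = G.coord κ e ∧
      (Even (G.coord κ d) → (G.IsLow κ d ↔ G.IsLow κ e)) := by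
  rcases lt_trichotomy (G.coord κ d) (G.coord κ e) with h | h | h
  · simp [h.ne, (hG.resolve_lt_resolve I h).ne]
  · by_cases he : Even (G.coord κ d)
    · obtain ⟨i, hi, hd⟩ := hG.coord_even he
      rw [resolve_coord_of_mem hd hi, resolve_coord_of_mem (h ▸ hd) hi]
      simp only [h, true_and]
      have he' : Even (G.coord κ e) := h ▸ he
      simp only [he', true_imp_iff]
      unfold shifted
      by_cases h1 : G.IsLow κ d <;> by_cases h2 : G.IsLow κ e <;> by_cases h3 : (κ, i) ∈ I <;>
        simp [h1, h2, h3, h] <;> omega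
    · have h' : ∀ f, G.coord κ f = G.coord κ d → ¬ ∃ i, (κ, i) ∈ G.sing ∧ G.coord κ f = line i := by
        rintro f hf ⟨i, -, hi⟩
        exact he (hf ▸ hi ▸ even_line i)
      rw [resolve_coord_of_odd (h' d rfl), resolve_coord_of_odd (h' e h.symm)]
      simp [he]
  · simp [h.ne', (hG.resolve_lt_resolve I h).ne']

theorem IsSingularGrid.components_resolve (hG : G.IsSingularGrid) (I I' : Finset (Circ n)) :
    (G.resolve G.sing I).components = (G.resolve G.sing I').components := by
  unfold components
  simp only [hG.resolve_eq_resolve_iff]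

theorem IsEnhanced.alexander_polygon (hG : G.IsEnhanced W P C) {x y : G.Gen} {π : Polygon n}
    (h : G.IsPolygon W P x y π) :
    G.alexander y - (count W P G x π .O : ℚ) = G.alexander x - (count W P G x π .X : ℚ) := by
  have hO := hG.kindMaslov_polygon h .O
  have hX := hG.kindMaslov_polygon h .X
  unfold kindMaslov at hO hX
  have h1 := congrArg (Int.cast (R := ℚ)) hO
  have h2 := congrArg (Int.cast (R := ℚ)) hX
  push_cast at h1 h2
  unfold alexander alexanderReg
  rw [hG.grid.components_resolve y.1.1 x.1.1]
  linear_combination h1 / 2 - h2 / 2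

theorem degree_of_mem_support_weight {ε : Equiv.Perm (Fin n) → Fin n → Fin n → ℤˣ} {x : G.Gen}
    {π : Polygon n} {m : Fin n →₀ ℕ} (hm : m ∈ (G.weight ε W P C x π).support) :
    Finsupp.degree m = count W P G x π .O := by
  classical
  rw [weight_eq] at hm
  have h1 : mon (In W P x π .O) = MvPolynomial.monomial
      (∑ k ∈ Finset.univ.filter (In W P x π .O), Finsupp.single k 1) (1 : ℤ) := by
    unfold mon
    rw [MvPolynomial.monomial_sum_one]
    exact Finset.prod_congr rfl fun k _ => rfl
  rw [h1, MvPolynomial.C_mul_monomial] at hm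
  have h2 := Finset.mem_singleton.1 (MvPolynomial.support_monomial_subset hm)
  rw [h2, map_sum]
  simp only [Finsupp.degree_single]
  unfold count
  rw [Finset.card_eq_sum_ones]

theorem exists_of_mem_support_sum {ε : Equiv.Perm (Fin n) → Fin n → Fin n → ℤˣ} {x : G.Gen}
    {S : Finset (Polygon n)} {m : Fin n →₀ ℕ}
    (hm : m ∈ (∑ π ∈ S, G.weight ε W P C x π).support) :
    ∃ π ∈ S, Finsupp.degree m = count W P G x π .O := by
  classical
  obtain ⟨π, hπ, h⟩ := Finset.mem_biUnion.1 (MvPolynomial.support_sum hm)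
  exact ⟨π, hπ, degree_of_mem_support_weight h⟩

theorem differential_single_one_apply (ε : Equiv.Perm (Fin n) → Fin n → Fin n → ℤˣ) (x y : G.Gen) :
    G.differential ε W P C (Finsupp.single x 1) y =
      ∑ π ∈ G.polygons W P x y, G.weight ε W P C x π := by
  classical
  rw [differential_single, Finsupp.finsetSum_apply, Finset.sum_eq_single y]
  · simp [Finsupp.finsetSum_apply]
  · intro z _ hz
    simp [Finsupp.finsetSum_apply, hz]
  · simp

theorem peakMap_single_one_apply (ε : Equiv.Perm (Fin n) → Fin n → Fin n → ℤˣ) {r : Circ n}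
    (hr : r ∈ G.sing) (x : (G.pos r).Gen) (y : (G.neg r).Gen) :
    G.peakMap ε W P C hr (Finsupp.single x 1) y =
      ∑ π ∈ (G.polygons W P (G.inclPos r x) (G.inclNeg hr y)).filter (fun π => r ∈ π.peaks),
        G.weight ε W P C (G.inclPos r x) π := by
  classical
  rw [peakMap_single, Finsupp.finsetSum_apply, Finset.sum_eq_single y]
  · simp [Finsupp.finsetSum_apply]
  · intro z _ hz
    simp [Finsupp.finsetSum_apply, hz]
  · simp

theorem IsEnhanced.hasDegree_differential (hG : G.IsEnhanced W P C)
    (ε : Equiv.Perm (Fin n) → Fin n → Fin n → ℤˣ) :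
    BasedModule.HasDegree (G.CV ε W P C) (G.CV ε W P C) (G.differential ε W P C) (-1) := by
  intro (x : G.Gen) (y : G.Gen) m hm
  replace hm : m ∈ (∑ π ∈ G.polygons W P x y, G.weight ε W P C x π).support := by
    rw [← differential_single_one_apply]
    exact hm
  obtain ⟨π, hπ, hd⟩ := exists_of_mem_support_sum hm
  have h := hG.kindMaslov_polygon (mem_polygons.1 hπ) .O
  rw [hd]
  exact h

theorem IsEnhanced.isFiltered_differential (hG : G.IsEnhanced W P C)
    (ε : Equiv.Perm (Fin n) → Fin n → Fin n → ℤˣ) :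
    BasedModule.IsFiltered (G.CV ε W P C) (G.CV ε W P C) (G.differential ε W P C) := by
  intro (x : G.Gen) (y : G.Gen) m hm
  replace hm : m ∈ (∑ π ∈ G.polygons W P x y, G.weight ε W P C x π).support := by
    rw [← differential_single_one_apply]
    exact hm
  obtain ⟨π, hπ, hd⟩ := exists_of_mem_support_sum hm
  have h := hG.alexander_polygon (mem_polygons.1 hπ)
  rw [hd]
  change G.alexander y - _ ≤ G.alexander x
  rw [h]
  have : (0 : ℚ) ≤ count W P G x π .X := Nat.cast_nonneg _
  linarith

theorem IsSingularGrid.maslov_inclPos (hG : G.IsSingularGrid) {r : Circ n} (hr : r ∈ G.sing)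
    (x : (G.pos r).Gen) : G.maslov (G.inclPos r x) = (G.pos r).maslov x :=
  hG.kindMaslov_inclPos hr .O x

theorem IsSingularGrid.maslov_inclNeg (hG : G.IsSingularGrid) {r : Circ n} (hr : r ∈ G.sing)
    (x : (G.neg r).Gen) : G.maslov (G.inclNeg hr x) = (G.neg r).maslov x - 1 :=
  hG.kindMaslov_inclNeg hr .O x

theorem IsSingularGrid.alexander_inclPos (hG : G.IsSingularGrid) {r : Circ n} (hr : r ∈ G.sing)
    (x : (G.pos r).Gen) : G.alexander (G.inclPos r x) = (G.pos r).alexander x := by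
  unfold alexander
  rw [hG.resolve_pos hr]
  rfl

theorem IsSingularGrid.alexander_inclNeg (hG : G.IsSingularGrid) {r : Circ n} (hr : r ∈ G.sing)
    (x : (G.neg r).Gen) : G.alexander (G.inclNeg hr x) = (G.neg r).alexander x := by
  unfold alexander
  rw [hG.resolve_neg hr]
  rfl

theorem IsEnhanced.hasDegree_peakMap (hG : G.IsEnhanced W P C) {r : Circ n} (hr : r ∈ G.sing)
    (ε : Equiv.Perm (Fin n) → Fin n → Fin n → ℤˣ) :
    BasedModule.HasDegree ((G.pos r).CV ε W P C) ((G.neg r).CV ε W P C)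
      (G.peakMap ε W P C hr) 0 := by
  intro (x : (G.pos r).Gen) (y : (G.neg r).Gen) m hm
  replace hm : m ∈ (∑ π ∈ (G.polygons W P (G.inclPos r x) (G.inclNeg hr y)).filter
      (fun π => r ∈ π.peaks), G.weight ε W P C (G.inclPos r x) π).support := by
    rw [← peakMap_single_one_apply]
    exact hm
  obtain ⟨π, hπ, hd⟩ := exists_of_mem_support_sum hm
  have h := hG.kindMaslov_polygon (mem_polygons.1 (Finset.mem_filter.1 hπ).1) .O
  rw [hG.grid.kindMaslov_inclPos, hG.grid.kindMaslov_inclNeg] at h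
  · rw [hd]
    change (G.neg r).kindMaslov .O y - _ = (G.pos r).kindMaslov .O x + 0
    omega
  · exact hr

theorem IsEnhanced.isFiltered_peakMap (hG : G.IsEnhanced W P C) {r : Circ n} (hr : r ∈ G.sing)
    (ε : Equiv.Perm (Fin n) → Fin n → Fin n → ℤˣ) :
    BasedModule.IsFiltered ((G.pos r).CV ε W P C) ((G.neg r).CV ε W P C)
      (G.peakMap ε W P C hr) := by
  intro (x : (G.pos r).Gen) (y : (G.neg r).Gen) m hm
  replace hm : m ∈ (∑ π ∈ (G.polygons W P (G.inclPos r x) (G.inclNeg hr y)).filter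
      (fun π => r ∈ π.peaks), G.weight ε W P C (G.inclPos r x) π).support := by
    rw [← peakMap_single_one_apply]
    exact hm
  obtain ⟨π, hπ, hd⟩ := exists_of_mem_support_sum hm
  have h := hG.alexander_polygon (mem_polygons.1 (Finset.mem_filter.1 hπ).1)
  rw [hG.grid.alexander_inclPos hr, hG.grid.alexander_inclNeg hr] at h
  rw [hd]
  change (G.neg r).alexander y - _ ≤ (G.pos r).alexander x
  rw [h]
  have : (0 : ℚ) ≤ count W P G (G.inclPos r x) π .X := Nat.cast_nonneg _
  linarith

end Grid

/-! ### Mapping cones -/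

section Cone

variable {R X Y Z : Type} [CommRing R] {dX : (X →₀ R) →ₗ[R] (X →₀ R)} {dY : (Y →₀ R) →ₗ[R] (Y →₀ R)}
  {f : (X →₀ R) →ₗ[R] (Y →₀ R)}

/-- The differential of a mapping cone, on a free module whose basis is a disjoint union. -/
noncomputable def coneMap (dX : (X →₀ R) →ₗ[R] (X →₀ R)) (dY : (Y →₀ R) →ₗ[R] (Y →₀ R))
    (f : (X →₀ R) →ₗ[R] (Y →₀ R)) : (X ⊕ Y →₀ R) →ₗ[R] (X ⊕ Y →₀ R) :=
  (Finsupp.sumFinsuppLEquivProdFinsupp R).symm.toLinearMap ∘ₗ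
    LinearMap.prod (dX ∘ₗ LinearMap.fst _ _ _)
      (f ∘ₗ LinearMap.fst _ _ _ + dY ∘ₗ LinearMap.snd _ _ _) ∘ₗ
    (Finsupp.sumFinsuppLEquivProdFinsupp R).toLinearMap

theorem coneMap_apply (z : X ⊕ Y →₀ R) :
    Finsupp.sumFinsuppLEquivProdFinsupp R (coneMap dX dY f z) =
      (dX (Finsupp.sumFinsuppLEquivProdFinsupp R z).1,
        f (Finsupp.sumFinsuppLEquivProdFinsupp R z).1 +
          dY (Finsupp.sumFinsuppLEquivProdFinsupp R z).2) := by
  unfold coneMap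
  rw [LinearMap.comp_apply, LinearEquiv.coe_coe, LinearEquiv.apply_symm_apply]
  rfl

theorem coneMap_coneMap (hX : dX ∘ₗ dX = 0) (hY : dY ∘ₗ dY = 0) (hf : dY ∘ₗ f = -(f ∘ₗ dX)) :
    coneMap dX dY f ∘ₗ coneMap dX dY f = 0 := by
  have h1 := fun u => LinearMap.congr_fun hX u
  have h2 := fun u => LinearMap.congr_fun hY u
  have h3 := fun u => LinearMap.congr_fun hf u
  simp only [LinearMap.comp_apply, LinearMap.zero_apply, LinearMap.neg_apply] at h1 h2 h3
  refine LinearMap.ext fun z => (Finsupp.sumFinsuppLEquivProdFinsupp R).injective ?_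
  rw [LinearMap.comp_apply, coneMap_apply, coneMap_apply, LinearMap.zero_apply, map_zero]
  refine Prod.ext (h1 _) ?_
  simp only [map_add, h2, h3, Prod.snd_zero]
  abel

theorem coneMap_apply_inl (z : X ⊕ Y →₀ R) (y : X) : coneMap dX dY f z (Sum.inl y) =
    dX (Finsupp.sumFinsuppLEquivProdFinsupp R z).1 y := by
  rw [← Finsupp.fst_sumFinsuppLEquivProdFinsupp R, coneMap_apply]

theorem coneMap_apply_inr (z : X ⊕ Y →₀ R) (y : Y) : coneMap dX dY f z (Sum.inr y) =
    f (Finsupp.sumFinsuppLEquivProdFinsupp R z).1 y +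
      dY (Finsupp.sumFinsuppLEquivProdFinsupp R z).2 y := by
  rw [← Finsupp.snd_sumFinsuppLEquivProdFinsupp R, coneMap_apply]
  rfl

theorem sumFinsupp_single_inl (x : X) (a : R) :
    Finsupp.sumFinsuppLEquivProdFinsupp (α := X) (β := Y) R (Finsupp.single (Sum.inl x) a) =
      (Finsupp.single x a, 0) := by
  classical
  refine Prod.ext (Finsupp.ext fun y => ?_) (Finsupp.ext fun y => ?_)
  · rw [Finsupp.fst_sumFinsuppLEquivProdFinsupp]
    simp [Finsupp.single_apply]
  · rw [Finsupp.snd_sumFinsuppLEquivProdFinsupp]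
    simp

theorem sumFinsupp_single_inr (x : Y) (a : R) :
    Finsupp.sumFinsuppLEquivProdFinsupp (α := X) (β := Y) R (Finsupp.single (Sum.inr x) a) =
      (0, Finsupp.single x a) := by
  classical
  refine Prod.ext (Finsupp.ext fun y => ?_) (Finsupp.ext fun y => ?_)
  · rw [Finsupp.fst_sumFinsuppLEquivProdFinsupp]
    simp
  · rw [Finsupp.snd_sumFinsuppLEquivProdFinsupp]
    simp [Finsupp.single_apply]

/-- Endomorphisms of free modules with the same matrix are conjugate. -/
theorem conj_of_matrix_eq {e : X ≃ Z} {D : (X →₀ R) →ₗ[R] (X →₀ R)} {D' : (Z →₀ R) →ₗ[R] (Z →₀ R)}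
    (h : ∀ x y, D' (Finsupp.single (e x) 1) (e y) = D (Finsupp.single x 1) y) (z : X →₀ R) :
    D' (Finsupp.domLCongr (R := R) e z) = Finsupp.domLCongr (R := R) e (D z) := by
  have h' : D' ∘ₗ (Finsupp.domLCongr (R := R) (M := R) e).toLinearMap =
      (Finsupp.domLCongr (R := R) (M := R) e).toLinearMap ∘ₗ D := by
    refine Finsupp.lhom_ext' fun x => LinearMap.ext_ring (Finsupp.ext fun w => ?_)
    obtain ⟨y, rfl⟩ := e.surjective w
    simp only [LinearMap.comp_apply, Finsupp.lsingle_apply, LinearEquiv.coe_coe]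
    rw [Finsupp.domLCongr_single, Finsupp.domLCongr_apply, Finsupp.domCongr_apply,
      Finsupp.equivMapDomain_apply, Equiv.symm_apply_apply, h]
  exact LinearMap.congr_fun h' z

theorem comp_self_of_conj {e : X ≃ Z} {D : (X →₀ R) →ₗ[R] (X →₀ R)} {D' : (Z →₀ R) →ₗ[R] (Z →₀ R)}
    (h : ∀ z, D' (Finsupp.domLCongr (R := R) e z) = Finsupp.domLCongr (R := R) e (D z))
    (hD : D ∘ₗ D = 0) : D' ∘ₗ D' = 0 := by
  refine LinearMap.ext fun w => ?_
  obtain ⟨z, rfl⟩ := (Finsupp.domLCongr (R := R) (M := R) e).surjective w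
  rw [LinearMap.comp_apply, h, h, ← LinearMap.comp_apply, hD, LinearMap.zero_apply, map_zero,
    LinearMap.zero_apply]

end Cone

namespace Grid

variable {G : Grid n} {W : Dir → Deco n → Fin n} {P : Circ n → Deco n} {C : Circ n → Compass}

theorem IsLift.sum_weight_eq (hG : G.IsEnhanced W P C) {r : Circ n} (hr : r ∈ G.sing)
    {J : Finset (Circ n)} {x y : (G.resolve {r} J).Gen} {X Y : G.Gen} (hX : IsLift r J x X)
    (hY : IsLift r J y Y) (h : ∀ π, G.IsPolygon W P X Y π → r ∉ π.peaks)
    (ε : Equiv.Perm (Fin n) → Fin n → Fin n → ℤˣ) :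
    ∑ π ∈ G.polygons W P X Y, G.weight ε W P C X π =
      ∑ π ∈ (G.resolve {r} J).polygons W P x y, (G.resolve {r} J).weight ε W P C x π := by
  refine Finset.sum_congr (Finset.ext fun π => ?_) fun π hπ => ?_
  · rw [mem_polygons, mem_polygons]
    exact ⟨fun hp => (hX.isPolygon_iff hY (h π hp)).2 hp,
      fun hp => (hX.isPolygon_iff hY hp.not_mem_peaks).1 hp⟩
  · exact (hX.weight_eq hG hr ε (mem_polygons.1 hπ).not_mem_peaks).symm

/-- The polygons between the generators of the modules of `G_+` and `G_-` form the matrix of the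
differential of the mapping cone. -/
theorem IsEnhanced.differential_eq_coneMap (hG : G.IsEnhanced W P C) {r : Circ n} (hr : r ∈ G.sing)
    (ε : Equiv.Perm (Fin n) → Fin n → Fin n → ℤˣ)
    (z : (G.pos r).Gen ⊕ (G.neg r).Gen →₀ GroundRing n) :
    G.differential ε W P C (Finsupp.domLCongr (R := GroundRing n) (G.splitGen hr) z) =
      Finsupp.domLCongr (R := GroundRing n) (G.splitGen hr)
        (coneMap ((G.pos r).differential ε W P C) ((G.neg r).differential ε W P C)
          (G.peakMap ε W P C hr) z) := by
  refine conj_of_matrix_eq (fun x y => ?_) z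
  rw [differential_single_one_apply]
  rcases y with y | y
  · rw [coneMap_apply_inl]
    rcases x with x | x
    · rw [sumFinsupp_single_inl, differential_single_one_apply]
      exact (isLift_inclPos r x).sum_weight_eq hG hr (isLift_inclPos r y)
        (fun π hπ => hπ.not_mem_peaks_of_mem (Or.inr (not_mem_pos y))) ε
    · rw [sumFinsupp_single_inr, map_zero, Finsupp.zero_apply]
      refine Finset.sum_eq_zero fun π hπ => ?_
      exact absurd (((mem_polygons.1 hπ).mem_target r).2
        (Or.inl (Finset.mem_insert_self _ _))) (not_mem_pos y)
  · rw [coneMap_apply_inr]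
    rcases x with x | x
    · rw [sumFinsupp_single_inl, map_zero, Finsupp.zero_apply, add_zero, peakMap_single_one_apply,
        Finset.filter_true_of_mem]
      · rfl
      · intro π hπ
        exact (((mem_polygons.1 hπ).mem_target r).1
          (Finset.mem_insert_self _ _)).resolve_left (not_mem_pos x)
    · rw [sumFinsupp_single_inr, map_zero, Finsupp.zero_apply, zero_add,
        differential_single_one_apply]
      exact (isLift_inclNeg hr x).sum_weight_eq hG hr (isLift_inclNeg hr y)
        (fun π hπ => hπ.not_mem_peaks_of_mem (Or.inl (Finset.mem_insert_self _ _))) ε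

theorem IsEnhanced.isIso_cone (hG : G.IsEnhanced W P C) {r : Circ n} (hr : r ∈ G.sing)
    (ε : Equiv.Perm (Fin n) → Fin n → Fin n → ℤˣ) :
    BasedModule.IsIso
      (BasedModule.cone ((G.pos r).CV ε W P C) ((G.neg r).CV ε W P C) (G.peakMap ε W P C hr))
      (G.CV ε W P C) (G.splitGen hr) where
  maslov := by
    rintro (x | x)
    · exact hG.grid.maslov_inclPos hr x
    · exact hG.grid.maslov_inclNeg hr x
  alexander := by
    rintro (x | x)
    · exact hG.grid.alexander_inclPos hr x
    · exact hG.grid.alexander_inclNeg hr x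
  d := hG.differential_eq_coneMap hr ε

/-- The square of the differential, by induction on the number of singular rows and columns. -/
theorem IsEnhanced.differential_comp (hG : G.IsEnhanced W P C) (hn : 2 ≤ n)
    {ε : Equiv.Perm (Fin n) → Fin n → Fin n → ℤˣ} (hε : IsSignAssignment ε) :
    G.differential ε W P C ∘ₗ G.differential ε W P C = 0 := by
  induction hm : G.sing.card generalizing G with
  | zero => exact hG.grid.differential_comp_of_regular (Finset.card_eq_zero.1 hm) hn hε
  | succ m ih =>
    obtain ⟨r, hr⟩ := Finset.card_pos.1 (by omega : 0 < G.sing.card)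
    have hc : ∀ J, (G.resolve {r} J).sing.card = m := by
      intro J
      have : (G.resolve {r} J).sing = G.sing.erase r := Finset.sdiff_singleton_eq_erase _ _
      rw [this, Finset.card_erase_of_mem hr, hm]
      rfl
    have hp := ih (hG.resolve hr ∅) (hc ∅)
    have hq := ih (hG.resolve hr {r}) (hc {r})
    exact comp_self_of_conj (hG.differential_eq_coneMap hr ε)
      (coneMap_coneMap hp hq (hG.anticomm hr ε hp hq))

theorem IsEnhanced.isComplex (hG : G.IsEnhanced W P C) (hn : 2 ≤ n)
    {ε : Equiv.Perm (Fin n) → Fin n → Fin n → ℤˣ} (hε : IsSignAssignment ε) :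
    (G.CV ε W P C).IsComplex where
  d_comp_d := hG.differential_comp hn hε
  degree := hG.hasDegree_differential ε
  filtered := hG.isFiltered_differential ε

/-! ### Euler characteristics -/

theorem finite_setOf_degree {A : BasedModule n} [Finite A.Gen] (j : ℚ) :
    {p : A.Gen × (Fin n →₀ ℕ) | A.alexander p.1 - ((Finsupp.degree p.2 : ℕ) : ℚ) = j}.Finite := by
  have h : {p : A.Gen × (Fin n →₀ ℕ) | A.alexander p.1 - ((Finsupp.degree p.2 : ℕ) : ℚ) = j} ⊆
      ⋃ x : A.Gen, (fun m => (x, m)) '' {m | Finsupp.degree m ≤ ⌈A.alexander x - j⌉₊} := by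
    rintro ⟨x, m⟩ hp
    refine Set.mem_iUnion.2 ⟨x, m, ?_, rfl⟩
    have h1 : ((Finsupp.degree m : ℕ) : ℚ) = A.alexander x - j := by
      have : A.alexander x - ((Finsupp.degree m : ℕ) : ℚ) = j := hp
      linarith
    have h2 : Finsupp.degree m ≤ ⌈((Finsupp.degree m : ℕ) : ℚ)⌉₊ := by rw [Nat.ceil_natCast]
    rwa [h1] at h2
  exact (Set.finite_iUnion fun x => (Finsupp.finite_of_degree_le _).image _).subset h

/-- The generators over `ℤ` of a cone of a given Alexander degree are those of the source and those
of the target; the shift by one of the Maslov grading of the latter changes their signs. -/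
theorem eulerCoeff_cone {A B M : BasedModule n} [Finite A.Gen] [Finite B.Gen]
    {f : (A.Gen →₀ GroundRing n) →ₗ[GroundRing n] (B.Gen →₀ GroundRing n)}
    {e : A.Gen ⊕ B.Gen ≃ M.Gen} (h : BasedModule.IsIso (BasedModule.cone A B f) M e) (j : ℚ) :
    M.eulerCoeff j = A.eulerCoeff j - B.eulerCoeff j := by
  set SA := {p : A.Gen × (Fin n →₀ ℕ) | A.alexander p.1 - ((Finsupp.degree p.2 : ℕ) : ℚ) = j}
    with hSA
  set SB := {p : B.Gen × (Fin n →₀ ℕ) | B.alexander p.1 - ((Finsupp.degree p.2 : ℕ) : ℚ) = j}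
    with hSB
  set iA : A.Gen × (Fin n →₀ ℕ) → M.Gen × (Fin n →₀ ℕ) := fun p => (e (Sum.inl p.1), p.2) with hiA
  set iB : B.Gen × (Fin n →₀ ℕ) → M.Gen × (Fin n →₀ ℕ) := fun p => (e (Sum.inr p.1), p.2) with hiB
  have alA : ∀ x, M.alexander (e (Sum.inl x)) = A.alexander x := fun x => h.alexander (Sum.inl x)
  have alB : ∀ x, M.alexander (e (Sum.inr x)) = B.alexander x := fun x => h.alexander (Sum.inr x)
  have maA : ∀ x, M.maslov (e (Sum.inl x)) = A.maslov x := fun x => h.maslov (Sum.inl x)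
  have maB : ∀ x, M.maslov (e (Sum.inr x)) = B.maslov x - 1 := fun x => h.maslov (Sum.inr x)
  have hS : {p : M.Gen × (Fin n →₀ ℕ) | M.alexander p.1 - ((Finsupp.degree p.2 : ℕ) : ℚ) = j} =
      iA '' SA ∪ iB '' SB := by
    ext ⟨z, m⟩
    constructor
    · intro hz
      obtain ⟨x | x, rfl⟩ := e.surjective z
      · refine Or.inl ⟨(x, m), ?_, rfl⟩
        change A.alexander x - _ = j
        rw [← alA]; exact hz
      · refine Or.inr ⟨(x, m), ?_, rfl⟩
        change B.alexander x - _ = j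
        rw [← alB]; exact hz
    · rintro (⟨⟨x, m'⟩, hx, hxm⟩ | ⟨⟨x, m'⟩, hx, hxm⟩)
      · obtain ⟨rfl, rfl⟩ := Prod.mk.inj hxm
        change M.alexander (e (Sum.inl x)) - _ = j
        rw [alA]; exact hx
      · obtain ⟨rfl, rfl⟩ := Prod.mk.inj hxm
        change M.alexander (e (Sum.inr x)) - _ = j
        rw [alB]; exact hx
  have injA : Function.Injective iA := by
    rintro ⟨x, m⟩ ⟨y, m'⟩ hxy
    have h1 := Prod.mk.inj hxy
    exact Prod.ext (Sum.inl_injective (e.injective h1.1)) h1.2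
  have injB : Function.Injective iB := by
    rintro ⟨x, m⟩ ⟨y, m'⟩ hxy
    have h1 := Prod.mk.inj hxy
    exact Prod.ext (Sum.inr_injective (e.injective h1.1)) h1.2
  have hd : Disjoint (iA '' SA) (iB '' SB) := by
    rw [Set.disjoint_left]
    rintro _ ⟨⟨x, m⟩, -, rfl⟩ ⟨⟨y, m'⟩, -, hxy⟩
    exact absurd (e.injective (Prod.mk.inj hxy).1) (by simp)
  have fA : SA.Finite := finite_setOf_degree j
  have fB : SB.Finite := finite_setOf_degree j
  unfold BasedModule.eulerCoeff
  rw [hS, finsum_mem_union hd (fA.image _) (fB.image _), finsum_mem_image injA.injOn,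
    finsum_mem_image injB.injOn, sub_eq_add_neg, ← finsum_mem_neg_distrib _ fB]
  congr 1
  · refine finsum_mem_congr rfl fun p _ => ?_
    simp only [hiA, maA]
  · refine finsum_mem_congr rfl fun p _ => ?_
    simp only [hiB, maB]
    rw [sub_right_comm, Int.negOnePow_sub, Int.negOnePow_one]
    simp

end Grid
end SingularGridHomology

open SingularGridHomology in
theorem mainTheorem5 {n : ℕ} (G : Grid n)
    (W : Dir → Deco n → Fin n) (P : Circ n → Deco n) (C : Circ n → Compass)
    (hG : G.IsEnhanced W P C)
    (ε : Equiv.Perm (Fin n) → Fin n → Fin n → ℤˣ) (hε : IsSignAssignment ε)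
    (r : Circ n) (hr : r ∈ G.sing) :
    -- the two desingularizations are again enhanced singular grids
    (G.pos r).IsEnhanced W P C ∧ (G.neg r).IsEnhanced W P C ∧
    -- the three filtered chain complexes
    (G.CV ε W P C).IsComplex ∧ ((G.pos r).CV ε W P C).IsComplex ∧
    ((G.neg r).CV ε W P C).IsComplex ∧
    -- `f_p` is a filtered chain map of degree `0` that anticommutes with the differentials
    BasedModule.HasDegree ((G.pos r).CV ε W P C) ((G.neg r).CV ε W P C)
      (G.peakMap ε W P C hr) 0 ∧
    BasedModule.IsFiltered ((G.pos r).CV ε W P C) ((G.neg r).CV ε W P C)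
      (G.peakMap ε W P C hr) ∧
    ((G.neg r).differential ε W P C) ∘ₗ (G.peakMap ε W P C hr) =
      -((G.peakMap ε W P C hr) ∘ₗ ((G.pos r).differential ε W P C)) ∧
    -- `CV⁻(G)` is the mapping cone of `f_p`
    BasedModule.IsIso
      (BasedModule.cone ((G.pos r).CV ε W P C) ((G.neg r).CV ε W P C) (G.peakMap ε W P C hr))
      (G.CV ε W P C) (G.splitGen hr) ∧
    -- the skein relation for graded Euler characteristics
    ∀ j : ℚ, (G.CV ε W P C).eulerCoeff j =
      ((G.pos r).CV ε W P C).eulerCoeff j - ((G.neg r).CV ε W P C).eulerCoeff j := by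
  -- The place of a singular row or column is positive and less than `n`.
  have hn : 2 ≤ n := by
    have h1 := hG.grid.sing_pos r.1 r.2 hr
    have h2 := r.2.2
    omega
  have hp : (G.pos r).IsEnhanced W P C := hG.resolve hr ∅
  have hq : (G.neg r).IsEnhanced W P C := hG.resolve hr {r}
  have : Finite ((G.pos r).CV ε W P C).Gen := inferInstanceAs (Finite (G.pos r).Gen)
  have : Finite ((G.neg r).CV ε W P C).Gen := inferInstanceAs (Finite (G.neg r).Gen)
  exact ⟨hp, hq, hG.isComplex hn hε, hp.isComplex hn hε, hq.isComplex hn hε,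
    hG.hasDegree_peakMap hr ε, hG.isFiltered_peakMap hr ε,
    hG.anticomm hr ε (hp.differential_comp hn hε) (hq.differential_comp hn hε),
    hG.isIso_cone hr ε, Grid.eulerCoeff_cone (hG.isIso_cone hr ε)⟩
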